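/- \textbf{Setting.} Let $N,K,d\ge 1$ and let $\sigma,\lambda,\lambda_d>0$, $\lambda_1,x_{\max},b_{\max}$ be real constants. There are $N$ bandit instances with $K$ arms each; arm $k$ of instance $j$ has an unknown fixed parameter $\beta_{k,j}\in\mathbb R^d$ with $\|\beta_{k,j}\|_2\le b_{\max}$. In round $t=1,2,\dots$ an individual arrives at instance $Z_t$ with context $x_t\in\mathbb R^d$, $\|x_t\|_2\le x_{\max}$ almost surely; the pairs $(Z_t,x_t)$ are i.i.d., with $p_j=\mathbb P(Z_t=j)$. Pulling arm $k$ yields the reward $x_t^\top\beta_{k,Z_t}+\epsilon_{k,Z_t,t}$, where the noises are i.i.d. $\mathcal N(0,\sigma^2)$ and independent of everything else. The (known) prior covariances $\Sigma_k\in\mathbb R^{d\times d}$ are positive definite and the eigenvalues of $\Sigma_k^{-1}$ lie in $[\lambda_d,\lambda_1]$. \textbf{Estimators.} Let $X_{k,j,t}$ be the matrix whose rows are the contexts, and $y_{k,j,t}$ the vector of the rewards, of the rounds before $t$ in which arm $k$ of instance $j$ was pulled. Put $V_{k,j,t}=X_{k,j,t}\Sigma_kX_{k,j,t}^\top+\sigma^2I$,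 $\widetilde C_{k,j,t}=(X_{k,j,t}^\top X_{k,j,t}+\sigma^2\Sigma_k^{-1})^{-1}$, $\Phi_{k0,t}=(\sum_jX_{k,j,t}^\top V_{k,j,t}^{-1}X_{k,j,t}+\lambda I)^{-1}$, $\hat\beta_{k0,t}=\Phi_{k0,t}\sum_jX_{k,j,t}^\top V_{k,j,t}^{-1}y_{k,j,t}$, $$\hat\beta_{k,j,t}=\sigma^2\widetilde C_{k,j,t}\Sigma_k^{-1}\hat\beta_{k0,t}+\widetilde C_{k,j,t}X_{k,j,t}^\top y_{k,j,t},\qquad C_{k,j,t}=\sigma^2\widetilde C_{k,j,t}+\sigma^4\widetilde C_{k,j,t}\Sigma_k^{-1}\Phi_{k0,t}\Sigma_k^{-1}\widetilde C_{k,j,t}.$$ For $\delta>0$ let $$\alpha_t(\delta)=\sigma Nb_{\max}\sqrt{\lambda_1}+2\sqrt{\sigma^2d\max\{\lambda_1/\lambda,1\}\log\frac{\max\{\lambda,\sigma^2\lambda_1\}+tx_{\max}^2/d}{\sqrt{\lambda\lambda_d\sigma^2}\,\delta}},$$ where the square root of a negative number (possible only if $\delta>1$) is read as $0$. \textbf{Algorithm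 ebmTS.} In round $t\le K$ pull arm $\pi_t=t$. In round $t>K$ draw $\breve\beta_{k,Z_t,t}\sim\mathcal N(\hat\beta_{k,Z_t,t},\alpha_t(\delta)^2C_{k,Z_t,t})$ for all $k$ (independently, given the past and $(Z_t,x_t)$) and pull $\pi_t\in\arg\max_kx_t^\top\breve\beta_{k,Z_t,t}$, ties being broken by any measurable rule. The cumulative regret is $R_n=\sum_{t=1}^n\mathbb E[\max_kx_t^\top\beta_{k,Z_t}-x_t^\top\beta_{\pi_t,Z_t}]$. Put $n_j=p_jn$. \textbf{Theorem.} (i) For every $\delta>0$ the instantaneous regrets are integrable and for every $n\ge1$ $$R_n\le 2C\big(\sqrt{2\log(dn^2)}+1\big)\alpha_n(\delta)\sqrt{c_1ndK\sum_{j=1}^N\log(1+c_2n_j)+c_3ndK\log(1+c_4N)}+2x_{\max}b_{\max}KNn\Big(\delta+\frac{\pi^2}{6}\Big),$$ where $C=\max_{t\ge1}\frac{2}{|1/(4\sqrt{\pi e})-1/t^2|}+1$ (maximum over positive integers), $c_1=\frac{\lambda_d^{-1}x_{\max}^2}{\log(1+\sigma^{-2}\lambda_d^{-1}x_{\max}^2)}$,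 $c_2=\sigma^{-2}d^{-1}\lambda_d^{-1}x_{\max}^2$, $c_3=\frac{\lambda_d^{-2}\lambda_1^2\lambda^{-1}x_{\max}^2(1+\sigma^{-2}\lambda_d^{-1}x_{\max}^2)}{\log(1+\sigma^{-2}\lambda_d^{-2}\lambda_1^2\lambda^{-1}x_{\max}^2)}$ and $c_4=\lambda_1\lambda^{-1}$ (with $c_1=c_3=0$ if $x_{\max}=0$). (ii) Moreover $$R_n=O\Big(d\sqrt{n\,\log(n/\delta)\,\log n\,\Big(\sum_{j=1}^N\log n_j+\log N\Big)}\Big):$$ for every $\delta_{\max}>0$ there is a constant $M$, depending only on $\delta_{\max},N,K,\sigma,\lambda,\lambda_1,\lambda_d,x_{\max},b_{\max}$, such that $R_n$ is at most $M$ times the expression in parentheses for all $d\ge1$, all such multi-bandits, all $0<\delta\le\delta_{\max}$, and all $n\ge2$ with $n\ge2\delta$ and $n_j\ge1$ for all $j$. -/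

import Mathlib

/-!
Multi-task linear contextual bandits with Gaussian noise, the hierarchical Bayesian estimators, the
posterior sampling algorithm ebmTS, and its cumulative expected regret.

Time is indexed from `0` in the code: index `t` is the round `t + 1`.
-/

namespace EbmTS

open MeasureTheory ProbabilityTheory
open scoped MatrixOrder NNReal

/-- `ℝ^d` with the Euclidean norm. -/
abbrev Vec (d : ℕ) : Type := EuclideanSpace ℝ (Fin d)

/-- The real constants that the regret bound depends on: the noise standard deviation `σ`, the
hyperparameter `λ`, the eigenvalue bounds `λ₁` and `λ_d` of the matrices `Σ_k⁻¹`, and the bounds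
`x_max`, `b_max` on contexts and arm parameters. -/
structure Params where
  sigma : ℝ
  lam : ℝ
  lam1 : ℝ
  lamD : ℝ
  xMax : ℝ
  bMax : ℝ

/-- A multi-bandit: `N` bandit instances with `K` arms each and contexts in `ℝ^d`.
`beta k j` is the parameter of arm `k` in instance `j`, `Sigma k` the prior covariance of arm `k`,
and `arrival` the joint law of the pair (instance at which an individual arrives, its context). -/
structure MultiBandit (d N K : ℕ) where
  beta : Fin K → Fin N → Vec d
  Sigma : Fin K → Matrix (Fin d) (Fin d) ℝ
  arrival : Measure (Fin N × Vec d)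

/-- The arrival probability `p_j` of instance `j`. -/
noncomputable def MultiBandit.prob {d N K : ℕ} (B : MultiBandit d N K) (j : Fin N) : ℝ :=
  B.arrival.real {q | q.1 = j}

/-- The standing boundedness assumption. -/
structure MultiBandit.Bounded {d N K : ℕ} (B : MultiBandit d N K) (c : Params) : Prop where
  isProbabilityMeasure : IsProbabilityMeasure B.arrival
  beta_le : ∀ k j, ‖B.beta k j‖ ≤ c.bMax
  context_le : ∀ᵐ q ∂B.arrival, ‖q.2‖ ≤ c.xMax
  posDef : ∀ k, (B.Sigma k).PosDef
  eigenvalue_mem : ∀ k, ∀ μ ∈ spectrum ℝ (B.Sigma k)⁻¹, c.lamD ≤ μ ∧ μ ≤ c.lam1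

/-! ### Estimators -/

/-- The data stream: which arm was pulled, at which instance, with which context, and the observed
reward. The estimators for index `t` only look at the entries with index `< t`. -/
structure Data (d N K : ℕ) where
  arm : ℕ → Fin K
  bandit : ℕ → Fin N
  context : ℕ → Vec d
  reward : ℕ → ℝ

section Estimators

variable {d N K : ℕ} (D : Data d N K) (c : Params) (Sigma : Fin K → Matrix (Fin d) (Fin d) ℝ)

/-- The set of time indices before `t` at which arm `k` of instance `j` was pulled. -/
def Data.pulls (k : Fin K) (j : Fin N) (t : ℕ) : Finset ℕ :=
  (Finset.range t).filter fun s => D.arm s = k ∧ D.bandit s = j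

/-- The design matrix `X_{k,j,t}`, whose rows are the contexts at the pulls. -/
def Data.X (k : Fin K) (j : Fin N) (t : ℕ) : Matrix (D.pulls k j t) (Fin d) ℝ :=
  Matrix.of fun s i => D.context s i

/-- The reward vector `y_{k,j,t}`. -/
def Data.y (k : Fin K) (j : Fin N) (t : ℕ) : D.pulls k j t → ℝ :=
  fun s => D.reward s

/-- `V_{k,j,t} = X Σ_k Xᵀ + σ² I`. -/
noncomputable def Data.V (k : Fin K) (j : Fin N) (t : ℕ) :
    Matrix (D.pulls k j t) (D.pulls k j t) ℝ :=
  D.X k j t * Sigma k * (D.X k j t).transpose + c.sigma ^ 2 • (1 : Matrix _ _ ℝ)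

/-- `C̃_{k,j,t} = (Xᵀ X + σ² Σ_k⁻¹)⁻¹`. -/
noncomputable def Data.Ctilde (k : Fin K) (j : Fin N) (t : ℕ) : Matrix (Fin d) (Fin d) ℝ :=
  ((D.X k j t).transpose * D.X k j t + c.sigma ^ 2 • (Sigma k)⁻¹)⁻¹

/-- `Φ_{k0,t} = (∑_j Xᵀ V⁻¹ X + λ I)⁻¹`. -/
noncomputable def Data.Phi (k : Fin K) (t : ℕ) : Matrix (Fin d) (Fin d) ℝ :=
  (∑ j : Fin N, (D.X k j t).transpose * (D.V c Sigma k j t)⁻¹ * D.X k j t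
    + c.lam • (1 : Matrix (Fin d) (Fin d) ℝ))⁻¹

/-- The estimator `β̂_{k0,t} = Φ ∑_j Xᵀ V⁻¹ y` of the shared parameter. -/
noncomputable def Data.betaHat0 (k : Fin K) (t : ℕ) : Fin d → ℝ :=
  (D.Phi c Sigma k t).mulVec
    (∑ j : Fin N, ((D.X k j t).transpose * (D.V c Sigma k j t)⁻¹).mulVec (D.y k j t))

/-- The estimator `β̂_{k,j,t} = σ² C̃ Σ_k⁻¹ β̂_{k0,t} + C̃ Xᵀ y`. -/
noncomputable def Data.betaHat (k : Fin K) (j : Fin N) (t : ℕ) : Fin d → ℝ :=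
  (c.sigma ^ 2 • (D.Ctilde c Sigma k j t * (Sigma k)⁻¹)).mulVec (D.betaHat0 c Sigma k t)
    + (D.Ctilde c Sigma k j t * (D.X k j t).transpose).mulVec (D.y k j t)

/-- The posterior covariance `C_{k,j,t} = σ² C̃ + σ⁴ C̃ Σ_k⁻¹ Φ Σ_k⁻¹ C̃`. -/
noncomputable def Data.C (k : Fin K) (j : Fin N) (t : ℕ) : Matrix (Fin d) (Fin d) ℝ :=
  c.sigma ^ 2 • D.Ctilde c Sigma k j t
    + c.sigma ^ 4 • (D.Ctilde c Sigma k j t * (Sigma k)⁻¹ * D.Phi c Sigma k t * (Sigma k)⁻¹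
        * D.Ctilde c Sigma k j t)

end Estimators

/-! ### Constants of the bound -/

/-- The confidence radius `α_t(δ)`. -/
noncomputable def alpha (c : Params) (N d : ℕ) (δ : ℝ) (t : ℕ) : ℝ :=
  c.sigma * N * c.bMax * √c.lam1
    + 2 * √(c.sigma ^ 2 * d * max (c.lam1 / c.lam) 1
        * Real.log ((max c.lam (c.sigma ^ 2 * c.lam1) + t * c.xMax ^ 2 / d)
            / (√(c.lam * c.lamD * c.sigma ^ 2) * δ)))

noncomputable def c1 (c : Params) : ℝ :=
  (c.lamD⁻¹ * c.xMax ^ 2) / Real.log (1 + (c.sigma ^ 2)⁻¹ * c.lamD⁻¹ * c.xMax ^ 2)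

noncomputable def c2 (c : Params) (d : ℕ) : ℝ :=
  (c.sigma ^ 2)⁻¹ * (d : ℝ)⁻¹ * c.lamD⁻¹ * c.xMax ^ 2

noncomputable def c3 (c : Params) : ℝ :=
  ((c.lamD ^ 2)⁻¹ * c.lam1 ^ 2 * c.lam⁻¹ * c.xMax ^ 2
      * (1 + (c.sigma ^ 2)⁻¹ * c.lamD⁻¹ * c.xMax ^ 2))
    / Real.log (1 + (c.sigma ^ 2)⁻¹ * (c.lamD ^ 2)⁻¹ * c.lam1 ^ 2 * c.lam⁻¹ * c.xMax ^ 2)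

noncomputable def c4 (c : Params) : ℝ := c.lam1 * c.lam⁻¹

/-- `C = max_{t ≥ 1} 2 / |1 / (4 √(π e)) - 1 / t²| + 1`. -/
noncomputable def constC : ℝ :=
  (⨆ t : ℕ+, 2 / |1 / (4 * √(Real.pi * Real.exp 1)) - 1 / (t : ℝ) ^ 2|) + 1

/-! ### The algorithm ebmTS -/

/-- The randomness of one round: the arrival (instance and context), the noises `ε_{k,j}` of all
potential rewards, and the standard Gaussian vectors that drive the posterior samples of the `K`
arms. -/
abbrev Seed (d N K : ℕ) : Type := (Fin N × Vec d) × (Fin K → Fin N → ℝ) × (Fin K → Vec d)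

section Algorithm

variable {d N K : ℕ} (B : MultiBandit d N K) (c : Params) (δ : ℝ) (sel : (Fin K → ℝ) → Fin K)

/-- The law of the randomness of one round; all components are independent, except that the
instance and the context may be dependent. -/
noncomputable def seedLaw : Measure (Seed d N K) :=
  B.arrival.prod
    ((Measure.pi fun _ : Fin K => Measure.pi fun _ : Fin N =>
        gaussianReal 0 (Real.toNNReal (c.sigma ^ 2))).prod
      (Measure.pi fun _ : Fin K => stdGaussian (Vec d)))

/-- The law of the whole experiment: independent rounds. -/
noncomputable def law : Measure (ℕ → Seed d N K) :=
  Measure.infinitePi fun _ : ℕ => seedLaw B c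

/-- The data stream generated by the arms `a`; the reward of arm `k` in instance `j` at context `x`
is `xᵀ β_{k,j} + ε_{k,j}`. -/
noncomputable def dataOf (ω : ℕ → Seed d N K) (a : ℕ → Fin K) : Data d N K where
  arm := a
  bandit s := (ω s).1.1
  context s := (ω s).1.2
  reward s := inner ℝ (ω s).1.2 (B.beta (a s) (ω s).1.1) + (ω s).2.1 (a s) (ω s).1.1

/-- The posterior sample `β̆ = β̂ + (α² C)^{1/2} ζ` with `ζ` standard Gaussian. -/
noncomputable def posteriorSample (mean : Fin d → ℝ) (cov : Matrix (Fin d) (Fin d) ℝ)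
    (ζ : Vec d) : Vec d :=
  WithLp.toLp 2 mean + Matrix.toEuclideanCLM (𝕜 := ℝ) (CFC.sqrt cov) ζ

/-- With a standard Gaussian seed, the posterior sample has law `N(mean, cov)`. -/
theorem map_posteriorSample (mean : Fin d → ℝ) (cov : Matrix (Fin d) (Fin d) ℝ) :
    (stdGaussian (Vec d)).map (posteriorSample mean cov)
      = multivariateGaussian (WithLp.toLp 2 mean) cov := rfl

/-- The index `U_k = x_tᵀ β̆_k`, where `β̆_k` is drawn from `N(β̂_k, α_t(δ)² C_k)`. -/
noncomputable def index (ω : ℕ → Seed d N K) (D : Data d N K) (t : ℕ) (k : Fin K) : ℝ :=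
  inner ℝ (D.context t)
    (posteriorSample (D.betaHat c B.Sigma k (D.bandit t) t)
      (alpha c N d δ (t + 1) ^ 2 • D.C c B.Sigma k (D.bandit t) t) ((ω t).2.2 k))

/-- The selection rule: each arm is pulled once in the first `K` rounds; afterwards an arm with
the largest index is pulled. `sel` picks an index that maximizes a vector. -/
noncomputable def choice (ω : ℕ → Seed d N K) (a : ℕ → Fin K) (t : ℕ) : Fin K :=
  if h : t < K then ⟨t, h⟩ else sel (index B c δ ω (dataOf B ω a) t)

/-- The arms pulled before time index `t` (the entries with index `≥ t` are irrelevant). -/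
noncomputable def armsBefore (ω : ℕ → Seed d N K) : ℕ → ℕ → Fin K
  | 0 => fun _ => sel 0
  | t + 1 => Function.update (armsBefore ω t) t (choice B c δ sel ω (armsBefore ω t) t)

/-- The arm `π` pulled by ebmTS at time index `t`. -/
noncomputable def arm (ω : ℕ → Seed d N K) (t : ℕ) : Fin K := armsBefore B c δ sel ω (t + 1) t

/-- The instantaneous regret: the best mean reward minus the mean reward of the pulled arm. -/
noncomputable def gap (t : ℕ) (ω : ℕ → Seed d N K) : ℝ :=
  (⨆ k : Fin K, inner ℝ (ω t).1.2 (B.beta k (ω t).1.1))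
    - inner ℝ (ω t).1.2 (B.beta (arm B c δ sel ω t) (ω t).1.1)

/-- The cumulative expected regret `R_n`. -/
noncomputable def regret (n : ℕ) : ℝ :=
  ∑ t ∈ Finset.range n, ∫ ω, gap B c δ sel t ω ∂(law B c)

end Algorithm

/-- A measurable rule that picks a maximizing index of a vector (ties are broken arbitrarily). -/
structure IsArgmax {K : ℕ} (sel : (Fin K → ℝ) → Fin K) : Prop where
  measurable : Measurable sel
  le : ∀ (u : Fin K → ℝ) (k : Fin K), u k ≤ u (sel u)

end EbmTS

/-! Part (i) needs no bandit argument. An instantaneous regret is at most `2 * xMax * bMax` almost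
surely, so `R_n` is at most `2 * xMax * bMax * n` (`regret_le_linear`). The last summand of the
claimed bound is already larger, because `K`, `N` and `π² / 6` are at least 1, and the other summand
is nonnegative (`regret_le_explicit`).

Part (ii) combines three estimates. Write `A` for the regularized Gram matrix `XᵀX + σ²Σ⁻¹` of an
arm and instance, and `w = xᵀA⁻¹x` for the squared width of a context.

Concentration. With `u = Xᵀe` the accumulated noise, `exp (uᵀA⁻¹u / (2σ²)) / √det A` has constant
expectation in time: a pull multiplies the determinant by `1 + w`, and the Gaussian integral of the
change of the exponent is exactly `√(1 + w)` (`lintegral_expMart_step`). Markov's inequality bounds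
`uᵀA⁻¹u` by a multiple of `d log n` outside an event of probability `1/n`
(`measure_selfNorm_gt_le`). The estimation error of a mean reward is a bias term plus a noise term,
both proportional to `√w` (`Data.abs_dotProduct_betaHat_sub_le`). The shared estimator is only
bounded in length, which suffices since its influence is damped by `A⁻¹`.

One round of sampling. If each estimated mean lies within `κ` sampling deviations of the truth, then
with probability at least the Gaussian tail at `κ` the best sampled index exceeds the best true
value. Comparing the sample with an independent copy of itself bounds the expected regret by the
expected squared deviation of the pulled arm times a free parameter `a`, plus a multiple of `1/a`
(`lintegral_gap_le`). Here `κ` does not depend on `n`, `d` or `δ`.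

Elliptical potential. The widths of the pulled arms sum to `O(d log n)`, since the logarithms of `1
+ w` telescope into log-determinants (`Data.sum_width_le`).

The prescribed radius `α_t(δ)` may be too small at first. From round `d√n` on it is at least `σ√(d
log n)`, once `n` exceeds a constant (`le_alpha`). Earlier rounds cost `O(d√n)`, and smaller `n`
fall under the linear bound. With `α_t` of order at most `√(d log (n/δ))` (`alpha_le`), the squared
deviations sum to order `d² log (n/δ) log n`, and the optimal `a` gives the rate `d√(n log (n/δ) log
n)` (`regret_le_rate`). The remaining logarithmic factor in the theorem is at least `log 2`
(`log_two_le_sum_log`), so it only weakens the bound. -/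

namespace EbmTS

open MeasureTheory ProbabilityTheory Matrix
open scoped MatrixOrder NNReal

/-! ### Quadratic forms of real matrices -/

section LinearAlgebra

variable {n : Type*} [Fintype n]

/-- The Euclidean length of a coordinate vector. -/
noncomputable def len (v : n → ℝ) : ℝ := ‖WithLp.toLp 2 v‖

theorem len_nonneg (v : n → ℝ) : 0 ≤ len v := norm_nonneg _

theorem len_sq (v : n → ℝ) : len v ^ 2 = v ⬝ᵥ v := by
  rw [len, EuclideanSpace.real_norm_sq_eq, dotProduct]
  exact Finset.sum_congr rfl fun i _ => by simp [sq]

theorem len_add_le (v w : n → ℝ) : len (v + w) ≤ len v + len w := by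
  simpa only [len, WithLp.toLp_add] using norm_add_le (WithLp.toLp 2 v) (WithLp.toLp 2 w)

theorem len_sub_le (v w : n → ℝ) : len (v - w) ≤ len v + len w := by
  simpa only [len, WithLp.toLp_sub] using norm_sub_le (WithLp.toLp 2 v) (WithLp.toLp 2 w)

theorem len_smul (r : ℝ) (v : n → ℝ) : len (r • v) = |r| * len v := by
  simp only [len, WithLp.toLp_smul, norm_smul, Real.norm_eq_abs]

theorem len_sum_le {ι : Type*} (s : Finset ι) (f : ι → n → ℝ) :
    len (∑ i ∈ s, f i) ≤ ∑ i ∈ s, len (f i) := by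
  simpa only [len, WithLp.toLp_sum] using norm_sum_le s fun i => WithLp.toLp 2 (f i)

theorem dotProduct_sq_le (v w : n → ℝ) : (v ⬝ᵥ w) ^ 2 ≤ (v ⬝ᵥ v) * (w ⬝ᵥ w) := by
  simpa only [dotProduct, sq] using Finset.sum_mul_sq_le_sq_mul_sq Finset.univ v w

theorem abs_dotProduct_le (v w : n → ℝ) : |v ⬝ᵥ w| ≤ len v * len w := by
  refine abs_le_of_sq_le_sq ?_ (mul_nonneg (len_nonneg _) (len_nonneg _))
  rw [mul_pow, len_sq, len_sq]
  exact dotProduct_sq_le v w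

theorem _root_.Matrix.PosSemidef.quad_nonneg {M : Matrix n n ℝ} (hM : M.PosSemidef)
    (v : n → ℝ) : 0 ≤ v ⬝ᵥ M *ᵥ v := by
  simpa using hM.dotProduct_mulVec_nonneg v

theorem _root_.Matrix.IsHermitian.dotProduct_mulVec_comm' {M : Matrix n n ℝ}
    (hM : M.IsHermitian) (v w : n → ℝ) : v ⬝ᵥ M *ᵥ w = w ⬝ᵥ M *ᵥ v := by
  have hT : Mᵀ = M := by simpa [IsHermitian, conjTranspose_eq_transpose_of_trivial] using hM
  rw [dotProduct_mulVec, ← mulVec_transpose, hT, dotProduct_comm]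

theorem _root_.Matrix.IsHermitian.mulVec_dotProduct {M : Matrix n n ℝ}
    (hM : M.IsHermitian) (v w : n → ℝ) : (M *ᵥ v) ⬝ᵥ w = v ⬝ᵥ M *ᵥ w := by
  rw [dotProduct_comm, hM.dotProduct_mulVec_comm']

theorem posSemidef_vecMulVec_self (x : n → ℝ) : (vecMulVec x x).PosSemidef := by
  simpa using posSemidef_vecMulVec_self_star x

theorem vecMulVec_mulVec_eq (x y v : n → ℝ) : vecMulVec x y *ᵥ v = (y ⬝ᵥ v) • x := by
  ext i
  simp only [mulVec, dotProduct, vecMulVec_apply, Pi.smul_apply, smul_eq_mul, Finset.sum_mul]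
  exact Finset.sum_congr rfl fun j _ => by ring

variable [DecidableEq n]

/-- Cauchy–Schwarz for a positive semidefinite form. -/
theorem _root_.Matrix.PosSemidef.quad_sq_le {M : Matrix n n ℝ} (hM : M.PosSemidef)
    (v w : n → ℝ) : (v ⬝ᵥ M *ᵥ w) ^ 2 ≤ (v ⬝ᵥ M *ᵥ v) * (w ⬝ᵥ M *ᵥ w) := by
  have hS : (CFC.sqrt M).IsHermitian := (CFC.sqrt_nonneg M).posSemidef.isHermitian
  have key : ∀ a b : n → ℝ, a ⬝ᵥ M *ᵥ b = (CFC.sqrt M *ᵥ a) ⬝ᵥ (CFC.sqrt M *ᵥ b) := by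
    intro a b
    rw [hS.mulVec_dotProduct, mulVec_mulVec, CFC.sqrt_mul_sqrt_self M hM.nonneg]
  simp only [key]
  exact dotProduct_sq_le _ _

theorem _root_.Matrix.IsHermitian.le_quad_of_le_spectrum {M : Matrix n n ℝ}
    (hM : M.IsHermitian) {r : ℝ} (h : ∀ x ∈ spectrum ℝ M, r ≤ x) (v : n → ℝ) :
    r * (v ⬝ᵥ v) ≤ v ⬝ᵥ M *ᵥ v := by
  have h1 := algebraMap_le_of_le_spectrum h (a := M) (ha := hM)
  have h2 := (Matrix.le_iff.1 h1).quad_nonneg v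
  rw [sub_mulVec, dotProduct_sub, Algebra.algebraMap_eq_smul_one, smul_mulVec, one_mulVec,
    dotProduct_smul, smul_eq_mul] at h2
  linarith

theorem _root_.Matrix.IsHermitian.quad_le_of_spectrum_le {M : Matrix n n ℝ}
    (hM : M.IsHermitian) {r : ℝ} (h : ∀ x ∈ spectrum ℝ M, x ≤ r) (v : n → ℝ) :
    v ⬝ᵥ M *ᵥ v ≤ r * (v ⬝ᵥ v) := by
  have h1 := le_algebraMap_of_spectrum_le h (a := M) (ha := hM)
  have h2 := (Matrix.le_iff.1 h1).quad_nonneg v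
  rw [sub_mulVec, dotProduct_sub, Algebra.algebraMap_eq_smul_one, smul_mulVec, one_mulVec,
    dotProduct_smul, smul_eq_mul] at h2
  linarith

/-- Cauchy–Schwarz for the form of `M`, applied to `Mv` and `v`, gives `|Mv|⁴ ≤ r|Mv|² · r|v|²`. -/
theorem _root_.Matrix.PosSemidef.len_mulVec_le {M : Matrix n n ℝ} (hM : M.PosSemidef)
    {r : ℝ} (hr : 0 ≤ r) (h : ∀ v : n → ℝ, v ⬝ᵥ M *ᵥ v ≤ r * (v ⬝ᵥ v)) (v : n → ℝ) :
    len (M *ᵥ v) ≤ r * len v := by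
  have h1 := hM.quad_sq_le (M *ᵥ v) v
  have h2 : M *ᵥ v ⬝ᵥ M *ᵥ v = len (M *ᵥ v) ^ 2 := (len_sq _).symm
  have h3 := h (M *ᵥ v)
  have h4 := h v
  rw [← len_sq] at h3 h4
  rw [h2] at h1
  have h5 : (len (M *ᵥ v) ^ 2) ^ 2 ≤ (r * len (M *ᵥ v) ^ 2) * (r * len v ^ 2) :=
    h1.trans (mul_le_mul h3 h4 (hM.quad_nonneg _) (by positivity))
  by_contra hlt
  push Not at hlt
  have h0 : 0 ≤ r * len v := mul_nonneg hr (len_nonneg v)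
  have hpos : 0 < len (M *ᵥ v) := h0.trans_lt hlt
  have h6 : (r * len v) ^ 2 < len (M *ᵥ v) ^ 2 := pow_lt_pow_left₀ hlt h0 two_ne_zero
  have h7 : 0 < len (M *ᵥ v) ^ 2 := by positivity
  nlinarith [mul_lt_mul_of_pos_left h6 h7]

theorem _root_.Matrix.PosDef.det_le_pow {M : Matrix n n ℝ} (hM : M.PosDef) {r : ℝ}
    (h : ∀ v : n → ℝ, v ⬝ᵥ M *ᵥ v ≤ r * (v ⬝ᵥ v)) : M.det ≤ r ^ Fintype.card n := by
  rw [hM.isHermitian.det_eq_prod_eigenvalues, ← Finset.card_univ, ← Finset.prod_const]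
  refine Finset.prod_le_prod (fun i _ => (hM.eigenvalues_pos i).le) fun i _ => ?_
  have h1 := h (hM.isHermitian.eigenvectorBasis i)
  have h2 : (hM.isHermitian.eigenvectorBasis i : n → ℝ) ⬝ᵥ
      (hM.isHermitian.eigenvectorBasis i : n → ℝ) = 1 := by
    rw [← len_sq]
    simp [len]
  rw [h2, mul_one] at h1
  rw [hM.isHermitian.eigenvalues_eq]
  simpa using h1

theorem _root_.Matrix.PosDef.pow_le_det {M : Matrix n n ℝ} (hM : M.PosDef) {r : ℝ} (hr : 0 ≤ r)
    (h : ∀ v : n → ℝ, r * (v ⬝ᵥ v) ≤ v ⬝ᵥ M *ᵥ v) : r ^ Fintype.card n ≤ M.det := by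
  rw [hM.isHermitian.det_eq_prod_eigenvalues, ← Finset.card_univ, ← Finset.prod_const]
  refine Finset.prod_le_prod (fun i _ => hr) fun i _ => ?_
  have h1 := h (hM.isHermitian.eigenvectorBasis i)
  have h2 : (hM.isHermitian.eigenvectorBasis i : n → ℝ) ⬝ᵥ
      (hM.isHermitian.eigenvectorBasis i : n → ℝ) = 1 := by
    rw [← len_sq]
    simp [len]
  rw [h2, mul_one] at h1
  rw [hM.isHermitian.eigenvalues_eq]
  simpa using h1

/-! ### Inverses of positive definite matrices -/

theorem _root_.Matrix.PosDef.mulVec_inv_mulVec {A : Matrix n n ℝ} (hA : A.PosDef) (v : n → ℝ) :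
    A *ᵥ (A⁻¹ *ᵥ v) = v := by
  rw [mulVec_mulVec, Matrix.mul_nonsing_inv A ((isUnit_iff_isUnit_det A).1 hA.isUnit), one_mulVec]

theorem _root_.Matrix.PosDef.inv_mulVec_mulVec {A : Matrix n n ℝ} (hA : A.PosDef) (v : n → ℝ) :
    A⁻¹ *ᵥ (A *ᵥ v) = v := by
  rw [mulVec_mulVec, Matrix.nonsing_inv_mul A ((isUnit_iff_isUnit_det A).1 hA.isUnit), one_mulVec]

/-- Evaluate the lower bound for `A` at `A⁻¹v`. Keeping the form of `A⁻¹` on the right, instead of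
`|v|²`, is what later makes all errors proportional to the width. -/
theorem mul_len_inv_mulVec_sq_le {A : Matrix n n ℝ} (hA : A.PosDef) {r : ℝ}
    (h : ∀ v : n → ℝ, r * (v ⬝ᵥ v) ≤ v ⬝ᵥ A *ᵥ v) (v : n → ℝ) :
    r * len (A⁻¹ *ᵥ v) ^ 2 ≤ v ⬝ᵥ A⁻¹ *ᵥ v := by
  have h1 := h (A⁻¹ *ᵥ v)
  rwa [hA.mulVec_inv_mulVec, ← len_sq, dotProduct_comm _ v] at h1

theorem len_inv_mulVec_le_sqrt {A : Matrix n n ℝ} (hA : A.PosDef) {r : ℝ} (hr : 0 < r)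
    (h : ∀ v : n → ℝ, r * (v ⬝ᵥ v) ≤ v ⬝ᵥ A *ᵥ v) (v : n → ℝ) :
   
    len (A⁻¹ *ᵥ v) ≤ (√r)⁻¹ * √(v ⬝ᵥ A⁻¹ *ᵥ v) := by
  have h1 := mul_len_inv_mulVec_sq_le hA h v
  have h2 : 0 < √r := Real.sqrt_pos.2 hr
  rw [← div_eq_inv_mul, le_div_iff₀ h2]
  refine Real.le_sqrt_of_sq_le ?_
  rw [mul_pow, Real.sq_sqrt hr.le]
  linarith

theorem len_inv_mulVec_le {A : Matrix n n ℝ} (hA : A.PosDef) {r : ℝ} (hr : 0 < r)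
    (h : ∀ v : n → ℝ, r * (v ⬝ᵥ v) ≤ v ⬝ᵥ A *ᵥ v) (v : n → ℝ) :
    len (A⁻¹ *ᵥ v) ≤ r⁻¹ * len v := by
  have h1 := mul_len_inv_mulVec_sq_le hA h v
  have h2 := (le_abs_self _).trans (abs_dotProduct_le v (A⁻¹ *ᵥ v))
  rw [← div_eq_inv_mul, le_div_iff₀ hr]
  rcases (len_nonneg (A⁻¹ *ᵥ v)).eq_or_lt with h0 | h0
  · rw [← h0, zero_mul]; exact len_nonneg v
  · nlinarith

theorem quad_inv_le {A : Matrix n n ℝ} (hA : A.PosDef) {r : ℝ} (hr : 0 < r)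
    (h : ∀ v : n → ℝ, r * (v ⬝ᵥ v) ≤ v ⬝ᵥ A *ᵥ v) (v : n → ℝ) :
    v ⬝ᵥ A⁻¹ *ᵥ v ≤ r⁻¹ * (v ⬝ᵥ v) := by
  have h2 := (le_abs_self _).trans (abs_dotProduct_le v (A⁻¹ *ᵥ v))
  have h3 := len_inv_mulVec_le hA hr h v
  rw [← len_sq]
  calc _ ≤ len v * (r⁻¹ * len v) := h2.trans (mul_le_mul_of_nonneg_left h3 (len_nonneg v))
    _ = _ := by ring

/-! ### Rank one updates -/

theorem det_add_vecMulVec {A : Matrix n n ℝ} (hA : A.PosDef) (x : n → ℝ) :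
    (A + vecMulVec x x).det = A.det * (1 + x ⬝ᵥ A⁻¹ *ᵥ x) := by
  rw [vecMulVec_eq Unit, det_add_replicateCol_mul_replicateRow
    ((isUnit_iff_isUnit_det A).1 hA.isUnit), det_unique (n := Unit)]
  congr 1
  rw [Matrix.add_apply, Matrix.one_apply_eq, Matrix.mul_assoc]
  congr 1

/-- The Sherman–Morrison formula, checked by multiplying back with `A + xxᵀ`. -/
theorem inv_add_vecMulVec_mulVec {A : Matrix n n ℝ} (hA : A.PosDef) (x v : n → ℝ) :
    (A + vecMulVec x x)⁻¹ *ᵥ v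
      = A⁻¹ *ᵥ v - ((x ⬝ᵥ A⁻¹ *ᵥ v) / (1 + x ⬝ᵥ A⁻¹ *ᵥ x)) • A⁻¹ *ᵥ x := by
  have hA' : (A + vecMulVec x x).PosDef := hA.add_posSemidef (posSemidef_vecMulVec_self x)
  have hpos : 0 < 1 + x ⬝ᵥ A⁻¹ *ᵥ x := by
    linarith [hA.inv.posSemidef.quad_nonneg x]
  have key : (A + vecMulVec x x) *ᵥ
      (A⁻¹ *ᵥ v - ((x ⬝ᵥ A⁻¹ *ᵥ v) / (1 + x ⬝ᵥ A⁻¹ *ᵥ x)) • A⁻¹ *ᵥ x) = v := by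
    rw [add_mulVec, mulVec_sub, mulVec_smul, hA.mulVec_inv_mulVec, hA.mulVec_inv_mulVec,
      vecMulVec_mulVec_eq, dotProduct_sub, dotProduct_smul, smul_eq_mul, sub_add, ← sub_smul]
    have : (x ⬝ᵥ A⁻¹ *ᵥ v) / (1 + x ⬝ᵥ A⁻¹ *ᵥ x) - (x ⬝ᵥ A⁻¹ *ᵥ v
        - (x ⬝ᵥ A⁻¹ *ᵥ v) / (1 + x ⬝ᵥ A⁻¹ *ᵥ x) * (x ⬝ᵥ A⁻¹ *ᵥ x)) = 0 := by
      field_simp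
      ring
    rw [this, zero_smul, sub_zero]
  conv_lhs => rw [← key]
  rw [hA'.inv_mulVec_mulVec]

/-- The change of the quadratic form `uᵀ A⁻¹ u` under a rank one update of `A` and a shift of `u`
in the same direction. -/
theorem quad_inv_add_vecMulVec {A : Matrix n n ℝ} (hA : A.PosDef) (x u : n → ℝ) (e : ℝ) :
    (u + e • x) ⬝ᵥ (A + vecMulVec x x)⁻¹ *ᵥ (u + e • x)
      = u ⬝ᵥ A⁻¹ *ᵥ u + e ^ 2 - (e - x ⬝ᵥ A⁻¹ *ᵥ u) ^ 2 / (1 + x ⬝ᵥ A⁻¹ *ᵥ x) := by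
  have hpos : 0 < 1 + x ⬝ᵥ A⁻¹ *ᵥ x := by
    linarith [hA.inv.posSemidef.quad_nonneg x]
  rw [inv_add_vecMulVec_mulVec hA]
  have hsym : u ⬝ᵥ A⁻¹ *ᵥ x = x ⬝ᵥ A⁻¹ *ᵥ u := hA.inv.isHermitian.dotProduct_mulVec_comm' _ _
  simp only [mulVec_add, mulVec_smul, dotProduct_add, dotProduct_sub, dotProduct_smul,
    add_dotProduct, smul_dotProduct, smul_eq_mul, hsym]
  field_simp
  ring

end LinearAlgebra

end EbmTS
namespace EbmTS

open MeasureTheory ProbabilityTheory Matrix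
open scoped MatrixOrder NNReal ENNReal

/-! ### Measurability of matrix operations -/

section Measurability

variable {Ω : Type*} [MeasurableSpace Ω] {d : ℕ}

theorem measurable_matrix_det {n : Type*} [Fintype n] [DecidableEq n] {M : Ω → Matrix n n ℝ}
    (hM : ∀ i j, Measurable fun ω => M ω i j) : Measurable fun ω => (M ω).det := by
  simp only [det_apply']
  exact Finset.measurable_sum _ fun σ _ =>
    (Finset.measurable_prod _ fun i _ => hM _ _).const_mul _

/-- By Cramer's rule an entry of the inverse is a quotient of determinants; singular matrices cause
no exception, as both conventions return 0. -/
theorem measurable_matrix_inv {n : Type*} [Fintype n] [DecidableEq n] {M : Ω → Matrix n n ℝ}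
    (hM : ∀ i j, Measurable fun ω => M ω i j) (i j : n) :
    Measurable fun ω => (M ω)⁻¹ i j := by
  have h : ∀ ω, (M ω)⁻¹ i j = (M ω).det⁻¹ * ((M ω).updateRow j (Pi.single i 1)).det := by
    intro ω
    rw [Matrix.inv_def, Matrix.smul_apply, Ring.inverse_eq_inv', smul_eq_mul, adjugate_apply]
  simp only [h]
  refine (measurable_matrix_det hM).inv.mul (measurable_matrix_det fun a b => ?_)
  by_cases hab : a = j
  · subst hab; simp only [updateRow_self]; exact measurable_const
  · simp only [updateRow_ne hab]; exact hM _ _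

-- The square root is continuous on the positive semidefinite matrices, so the measurable map into
-- that subtype is composed with a continuous one.
open scoped Matrix.Norms.L2Operator in
theorem measurable_matrix_sqrt {M : Ω → Matrix (Fin d) (Fin d) ℝ}
    (hM : ∀ i j, Measurable fun ω => M ω i j) (hP : ∀ ω, (M ω).PosSemidef) (i j : Fin d) :
    Measurable fun ω => CFC.sqrt (M ω) i j := by
  have h1 : ContinuousOn (CFC.sqrt : Matrix (Fin d) (Fin d) ℝ → _) {a | 0 ≤ a} :=
    CFC.continuousOn_sqrt
  have h4 : Continuous fun a : {a : Fin d → Fin d → ℝ // 0 ≤ Matrix.of a} =>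
      CFC.sqrt (Matrix.of a.1) :=
    h1.comp_continuous (f := fun a : {a : Fin d → Fin d → ℝ // 0 ≤ Matrix.of a} =>
        Matrix.of a.1) continuous_subtype_val fun a => a.2
  have h2 : Continuous fun a : {a : Fin d → Fin d → ℝ // 0 ≤ Matrix.of a} =>
      CFC.sqrt (Matrix.of a.1) i j :=
    h4.matrix_elem i j
  have h3 : Measurable fun ω =>
      (⟨fun a b => M ω a b, (hP ω).nonneg⟩ : {a : Fin d → Fin d → ℝ // 0 ≤ Matrix.of a}) :=
    Measurable.subtype_mk (measurable_pi_lambda _ fun a => measurable_pi_lambda _ fun b => hM a b)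
  exact h2.measurable.comp h3

theorem measurable_mulVec {m n : Type*} [Fintype n] {M : Ω → Matrix m n ℝ} {v : Ω → n → ℝ}
    (hM : ∀ i j, Measurable fun ω => M ω i j) (hv : ∀ i, Measurable fun ω => v ω i) (i : m) :
    Measurable fun ω => (M ω *ᵥ v ω) i :=
  Finset.measurable_sum _ fun j _ => (hM i j).mul (hv j)

theorem measurable_matrix_mul {l m n : Type*} [Fintype m] {M : Ω → Matrix l m ℝ}
    {M' : Ω → Matrix m n ℝ} (hM : ∀ i j, Measurable fun ω => M ω i j)
    (hM' : ∀ i j, Measurable fun ω => M' ω i j) (i : l) (j : n) :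
    Measurable fun ω => (M ω * M' ω) i j :=
  Finset.measurable_sum _ fun k _ => (hM i k).mul (hM' k j)

theorem measurable_dotProduct {n : Type*} [Fintype n] {v w : Ω → n → ℝ}
    (hv : ∀ i, Measurable fun ω => v ω i) (hw : ∀ i, Measurable fun ω => w ω i) :
    Measurable fun ω => v ω ⬝ᵥ w ω :=
  Finset.measurable_sum _ fun j _ => (hv j).mul (hw j)

/-- Used to substitute a random arm or instance into a quantity that is measurable for each fixed
one. -/
theorem measurable_apply_of_countable {ι β : Type*} [Countable ι] [MeasurableSpace ι]
    [MeasurableSingletonClass ι] [MeasurableSpace β] {f : ι → Ω → β} {g : Ω → ι}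
    (hf : ∀ i, Measurable (f i)) (hg : Measurable g) : Measurable fun ω => f (g ω) ω :=
  (measurable_from_prod_countable_right (f := fun p : ι × Ω => f p.1 p.2) hf).comp
    (hg.prodMk measurable_id)

end Measurability

/-! ### Resampling one coordinate of an infinite product -/

/-- The map replacing coordinate `t` by an independent draw preserves the product measure, as is
seen on finite boxes. It takes the place of conditioning on the other coordinates. -/
theorem lintegral_infinitePi_update {X : Type*} [MeasurableSpace X] (μ : Measure X)
    [IsProbabilityMeasure μ] (t : ℕ) {f : (ℕ → X) → ℝ≥0∞} (hf : Measurable f) :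
    ∫⁻ ω, f ω ∂(Measure.infinitePi fun _ : ℕ => μ)
      = ∫⁻ ω, ∫⁻ z, f (Function.update ω t z) ∂μ ∂(Measure.infinitePi fun _ : ℕ => μ) := by
  have hm : Measurable fun p : (ℕ → X) × X => Function.update p.1 t p.2 := by
    refine measurable_pi_lambda _ fun i => ?_
    by_cases hi : i = t
    · subst hi; simpa using measurable_snd
    · simp only [Function.update_of_ne hi]; fun_prop
  have hmap : ((Measure.infinitePi fun _ : ℕ => μ).prod μ).map
      (fun p : (ℕ → X) × X => Function.update p.1 t p.2) = Measure.infinitePi fun _ : ℕ => μ := by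
    refine Measure.eq_infinitePi _ fun s u hu => ?_
    rw [Measure.map_apply hm (.pi s.countable_toSet fun _ _ => hu _)]
    have hpre : (fun p : (ℕ → X) × X => Function.update p.1 t p.2) ⁻¹' ((s : Set ℕ).pi u)
        = (((s.erase t : Finset ℕ) : Set ℕ).pi u) ×ˢ (if t ∈ s then u t else Set.univ) := by
      ext p
      simp only [Set.mem_preimage, Set.mem_pi, Set.mem_prod, Finset.mem_coe, Finset.mem_erase]
      constructor
      · intro h
        refine ⟨fun i hi => by simpa [Function.update_of_ne hi.1] using h i hi.2, ?_⟩
        split_ifs with ht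
        · simpa using h t ht
        · trivial
      · rintro ⟨h1, h2⟩ i hi
        by_cases hit : i = t
        · subst hit; simpa [hi] using h2
        · simpa [Function.update_of_ne hit] using h1 i ⟨hit, hi⟩
    rw [hpre, Measure.prod_prod, Measure.infinitePi_pi _ fun i _ => hu i]
    split_ifs with ht
    · rw [Finset.prod_erase_mul _ _ ht]
    · rw [measure_univ, mul_one, Finset.erase_eq_of_notMem ht]
  conv_lhs => rw [← hmap]
  rw [lintegral_map hf hm, lintegral_prod (fun p : (ℕ → X) × X => f (Function.update p.1 t p.2))
    (hf.comp hm).aemeasurable]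

/-! ### Gaussian computations -/

/-- The factor `exp (e² / (2s²))` cancels the Gaussian density of variance `s²`; what remains is
`√(1 + h)` times the density with mean `a` and variance `s²(1 + h)`. -/
theorem lintegral_exp_quad_gaussianReal {s : ℝ} (hs : 0 < s) (a : ℝ) {h : ℝ} (hh : 0 ≤ h) :
    ∫⁻ e, ENNReal.ofReal (Real.exp ((e ^ 2 - (e - a) ^ 2 / (1 + h)) / (2 * s ^ 2)))
        ∂(gaussianReal 0 (Real.toNNReal (s ^ 2))) = ENNReal.ofReal √(1 + h) := by
  have hs2 : 0 < s ^ 2 := by positivity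
  have hv : Real.toNNReal (s ^ 2) ≠ 0 := by simpa using hs.ne'
  have hv' : Real.toNNReal (s ^ 2 * (1 + h)) ≠ 0 := by
    rw [Ne, Real.toNNReal_eq_zero, not_le]; positivity
  rw [gaussianReal_of_var_ne_zero _ hv, lintegral_withDensity_eq_lintegral_mul _
    (measurable_gaussianPDF _ _) (by fun_prop)]
  have key : ∀ e : ℝ, (gaussianPDF 0 (Real.toNNReal (s ^ 2)) * fun e : ℝ =>
      ENNReal.ofReal (Real.exp ((e ^ 2 - (e - a) ^ 2 / (1 + h)) / (2 * s ^ 2)))) e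
      = ENNReal.ofReal √(1 + h) *
        ENNReal.ofReal (gaussianPDFReal a (Real.toNNReal (s ^ 2 * (1 + h))) e) := by
    intro e
    rw [Pi.mul_apply, gaussianPDF, ← ENNReal.ofReal_mul (gaussianPDFReal_nonneg _ _ _),
      ← ENNReal.ofReal_mul (Real.sqrt_nonneg _)]
    congr 1
    rw [gaussianPDFReal, gaussianPDFReal, Real.coe_toNNReal _ hs2.le,
      Real.coe_toNNReal _ (by positivity), ← mul_assoc (2 * Real.pi), Real.sqrt_mul' _ (by positivity : 0 ≤ 1 + h),
      mul_inv, mul_assoc, ← Real.exp_add]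
    have h1 : √(1 + h) ≠ 0 := (Real.sqrt_pos.2 (by positivity)).ne'
    have h2 : -(e - 0) ^ 2 / (2 * s ^ 2) + (e ^ 2 - (e - a) ^ 2 / (1 + h)) / (2 * s ^ 2)
        = -(e - a) ^ 2 / (2 * (s ^ 2 * (1 + h))) := by
      field_simp
      ring
    rw [h2]
    field_simp
  simp only [key]
  rw [lintegral_const_mul _ (by fun_prop), lintegral_gaussianPDFReal_eq_one _ hv', mul_one]

theorem map_inner_stdGaussian {d : ℕ} (w : Vec d) :
    (stdGaussian (Vec d)).map (fun ζ => inner ℝ w ζ)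
      = gaussianReal 0 (Real.toNNReal (‖w‖ ^ 2)) := by
  have h := IsGaussian.map_eq_gaussianReal (μ := stdGaussian (Vec d)) (innerSL ℝ w)
  rw [integral_strongDual_stdGaussian, variance_dual_stdGaussian, innerSL_apply_norm] at h
  exact h

theorem lintegral_inner_sq_stdGaussian {d : ℕ} (w : Vec d) :
    ∫⁻ ζ, ENNReal.ofReal (inner ℝ w ζ ^ 2) ∂(stdGaussian (Vec d)) = ENNReal.ofReal (‖w‖ ^ 2) := by
  have h1 : Measurable fun ζ : Vec d => (inner ℝ w ζ : ℝ) := by fun_prop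
  have h2 := lintegral_map (μ := stdGaussian (Vec d))
    (f := fun e : ℝ => ENNReal.ofReal (e ^ 2)) (by fun_prop) h1
  rw [← h2, map_inner_stdGaussian]
  have h3 := variance_fun_id_gaussianReal (μ := 0) (v := Real.toNNReal (‖w‖ ^ 2))
  rw [variance_eq_integral (by fun_prop), integral_id_gaussianReal] at h3
  rw [← ofReal_integral_eq_lintegral_ofReal]
  · simp only [sub_zero] at h3
    rw [h3, Real.coe_toNNReal _ (by positivity)]
  · exact (memLp_id_gaussianReal 2).integrable_sq
  · exact ae_of_all _ fun e => sq_nonneg e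

/-- The probability that a standard Gaussian variable is at least `κ`. -/
noncomputable def gaussianTail (κ : ℝ) : ℝ := (gaussianReal 0 1).real (Set.Ici κ)

theorem gaussianTail_pos (κ : ℝ) : 0 < gaussianTail κ := by
  rw [gaussianTail, measureReal_def, ENNReal.toReal_pos_iff]
  refine ⟨pos_iff_ne_zero.2 fun h => ?_, measure_lt_top _ _⟩
  have h1 := gaussianReal_absolutelyContinuous' 0 one_ne_zero h
  simp at h1

theorem gaussianTail_le_one (κ : ℝ) : gaussianTail κ ≤ 1 := measureReal_le_one

/-- Normalizing `w` reduces this to a standard Gaussian variable. For `w = 0` the event is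
everything, so degenerate directions need no exclusion. -/
theorem gaussianTail_le_measure {d : ℕ} (w : Vec d) (κ : ℝ) :
    ENNReal.ofReal (gaussianTail κ) ≤ stdGaussian (Vec d) {ζ | κ * ‖w‖ ≤ inner ℝ w ζ} := by
  rcases eq_or_ne w 0 with rfl | hw
  · simpa using gaussianTail_le_one κ
  have hw' : 0 < ‖w‖ := norm_pos_iff.2 hw
  have h1 : Measurable fun ζ : Vec d => (inner ℝ (‖w‖⁻¹ • w) ζ : ℝ) := by fun_prop
  have h2 := map_inner_stdGaussian (‖w‖⁻¹ • w)
  have h3 : ‖‖w‖⁻¹ • w‖ = 1 := by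
    rw [norm_smul, norm_inv, norm_norm, inv_mul_cancel₀ hw'.ne']
  rw [h3, one_pow, Real.toNNReal_one] at h2
  rw [gaussianTail, ofReal_measureReal, ← h2, Measure.map_apply h1 measurableSet_Ici]
  refine measure_mono fun ζ hζ => ?_
  simp only [Set.mem_preimage, Set.mem_Ici, real_inner_smul_left] at hζ
  rwa [← div_eq_inv_mul, le_div_iff₀ hw'] at hζ

end EbmTS
namespace EbmTS

open MeasureTheory ProbabilityTheory Matrix
open scoped MatrixOrder NNReal ENNReal

/-! ### One round of posterior sampling -/

section PosteriorSampling

variable {d K : ℕ}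

/-- The sum over the arms of the squares of the normalized perturbations. -/
noncomputable def normalizedSq (w : Fin K → Vec d) (ζ : Fin K → Vec d) : ℝ :=
  ∑ k, inner ℝ (‖w k‖⁻¹ • w k) (ζ k) ^ 2

theorem normalizedSq_nonneg (w ζ : Fin K → Vec d) : 0 ≤ normalizedSq w ζ :=
  Finset.sum_nonneg fun _ _ => sq_nonneg _

theorem measurable_normalizedSq (w : Fin K → Vec d) : Measurable (normalizedSq w) := by
  unfold normalizedSq
  fun_prop

theorem lintegral_normalizedSq_le (w : Fin K → Vec d) :
    ∫⁻ ζ, ENNReal.ofReal (normalizedSq w ζ) ∂(Measure.pi fun _ : Fin K => stdGaussian (Vec d))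
      ≤ ENNReal.ofReal K := by
  have h : ∀ ζ, ENNReal.ofReal (normalizedSq w ζ)
      = ∑ k, ENNReal.ofReal (inner ℝ (‖w k‖⁻¹ • w k) (ζ k) ^ 2) := fun ζ =>
    ENNReal.ofReal_sum_of_nonneg fun _ _ => sq_nonneg _
  simp only [h]
  rw [lintegral_finsetSum _ fun k _ => by fun_prop]
  have h2 : ∀ k : Fin K, ∫⁻ ζ, ENNReal.ofReal (inner ℝ (‖w k‖⁻¹ • w k) (ζ k) ^ 2)
      ∂(Measure.pi fun _ : Fin K => stdGaussian (Vec d)) ≤ 1 := by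
    intro k
    have h3 := (measurePreserving_eval (fun _ : Fin K => stdGaussian (Vec d)) k).lintegral_comp
      (f := fun z => ENNReal.ofReal (inner ℝ (‖w k‖⁻¹ • w k) z ^ 2)) (by fun_prop)
    simp only [Function.eval] at h3
    rw [h3, lintegral_inner_sq_stdGaussian, ENNReal.ofReal_le_one]
    rw [norm_smul, norm_inv, norm_norm]
    rcases eq_or_ne ‖w k‖ 0 with h0 | h0
    · simp [h0]
    · simp [inv_mul_cancel₀ h0]
  calc _ ≤ ∑ _k : Fin K, (1 : ℝ≥0∞) := Finset.sum_le_sum fun k _ => h2 k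
    _ = ENNReal.ofReal K := by simp

/-- The AM-GM inequality with weight `a`. Since `normalizedSq` sums over all arms, the bound remains
usable when `k` is chosen depending on `ζ`, at the price of a factor `K` in expectation. -/
theorem abs_inner_le_normalizedSq {w ζ : Fin K → Vec d} {a : ℝ} (ha : 0 < a) (k : Fin K) :
    |inner ℝ (w k) (ζ k)| ≤ (a * ‖w k‖ ^ 2 + a⁻¹ * normalizedSq w ζ) / 2 := by
  have h1 : inner ℝ (‖w k‖⁻¹ • w k) (ζ k) ^ 2 ≤ normalizedSq w ζ :=
    Finset.single_le_sum (f := fun k => inner ℝ (‖w k‖⁻¹ • w k) (ζ k) ^ 2)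
      (fun _ _ => sq_nonneg _) (Finset.mem_univ k)
  have h2 : (inner ℝ (w k) (ζ k) : ℝ) = ‖w k‖ * inner ℝ (‖w k‖⁻¹ • w k) (ζ k) := by
    rcases eq_or_ne ‖w k‖ 0 with h0 | h0
    · rw [norm_eq_zero.1 h0]; simp
    · rw [real_inner_smul_left, ← mul_assoc, mul_inv_cancel₀ h0, one_mul]
  set y : ℝ := inner ℝ (‖w k‖⁻¹ • w k) (ζ k)
  rw [h2, abs_mul, abs_of_nonneg (norm_nonneg _)]
  have h3 : a⁻¹ * y ^ 2 ≤ a⁻¹ * normalizedSq w ζ :=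
    mul_le_mul_of_nonneg_left h1 (inv_nonneg.2 ha.le)
  have h4 : 0 ≤ a⁻¹ * (a * ‖w k‖ - |y|) ^ 2 := by positivity
  have h5 : a⁻¹ * (a * ‖w k‖ - |y|) ^ 2 = a * ‖w k‖ ^ 2 - 2 * (‖w k‖ * |y|) + a⁻¹ * y ^ 2 := by
    rw [← sq_abs y]
    field_simp
    ring
  linarith

/-- The constant in the one round bound for posterior sampling. -/
noncomputable def samplingConst (K : ℕ) (κ : ℝ) : ℝ :=
  (gaussianTail κ)⁻¹ * (K + 1) + κ + K + 1

/-- The regret is split at the maximal sampled index `M`. That `M` exceeds the true value of the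
pulled arm is due to estimation error and perturbation of that arm alone. That the best value
exceeds `M` is controlled by an independent copy `ζ'`, which is optimistic with probability at least
`gaussianTail κ`. -/
theorem lintegral_gap_le {sel : (Fin K → ℝ) → Fin K} (hsel : IsArgmax sel) (m θ : Fin K → ℝ)
    (w : Fin K → Vec d) {κ : ℝ} (hκ : 0 ≤ κ) (hconf : ∀ k, |m k - θ k| ≤ κ * ‖w k‖)
    (k₀ : Fin K) {a : ℝ} (ha : 0 < a) :
    ∫⁻ ζ, ENNReal.ofReal (θ k₀ - θ (sel fun k => m k + inner ℝ (w k) (ζ k)))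
        ∂(Measure.pi fun _ : Fin K => stdGaussian (Vec d))
      ≤ ENNReal.ofReal (samplingConst K κ * a) *
          ∫⁻ ζ, ENNReal.ofReal (‖w (sel fun k => m k + inner ℝ (w k) (ζ k))‖ ^ 2)
            ∂(Measure.pi fun _ : Fin K => stdGaussian (Vec d))
        + ENNReal.ofReal (samplingConst K κ * a⁻¹) := by
  set ν := Measure.pi fun _ : Fin K => stdGaussian (Vec d) with hν
  set U : (Fin K → Vec d) → Fin K → ℝ := fun ζ k => m k + inner ℝ (w k) (ζ k) with hU
  have hUm : Measurable U := measurable_pi_lambda _ fun k => by simp only [hU]; fun_prop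
  have hπm : Measurable fun ζ => sel (U ζ) := hsel.measurable.comp hUm
  set M : (Fin K → Vec d) → ℝ := fun ζ => U ζ (sel (U ζ)) with hM
  have hMm : Measurable M := measurable_apply_of_countable (f := fun k ζ => U ζ k)
    (fun k => (measurable_pi_apply k).comp hUm) hπm
  set τ : (Fin K → Vec d) → ℝ := fun ζ => ‖w (sel (U ζ))‖ ^ 2 with hτ
  have hτm : Measurable τ := (measurable_from_top (f := fun k => ‖w k‖ ^ 2)).comp hπm
  set I := ∫⁻ ζ, ENNReal.ofReal (τ ζ) ∂ν with hI
  have hSm := measurable_normalizedSq w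
  have hS := lintegral_normalizedSq_le w
  rw [← hν] at hS
  have ha' : 0 < a⁻¹ := inv_pos.2 ha
  -- the chosen index against the true value of the chosen arm
  have h1 : ∫⁻ ζ, ENNReal.ofReal (M ζ - θ (sel (U ζ))) ∂ν
      ≤ ENNReal.ofReal ((κ + 1) * a) * I + ENNReal.ofReal ((κ + K) * a⁻¹) := by
    calc _ ≤ ∫⁻ ζ, (ENNReal.ofReal ((κ + 1) * a) * ENNReal.ofReal (τ ζ)
          + (ENNReal.ofReal (κ * a⁻¹) + ENNReal.ofReal a⁻¹ *
            ENNReal.ofReal (normalizedSq w ζ))) ∂ν := by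
          refine lintegral_mono fun ζ => ?_
          have hτ0 : 0 ≤ τ ζ := sq_nonneg _
          have hS0 := normalizedSq_nonneg w ζ
          rw [← ENNReal.ofReal_mul (by positivity), ← ENNReal.ofReal_mul ha'.le,
            ← ENNReal.ofReal_add (by positivity) (by positivity),
            ← ENNReal.ofReal_add (by positivity) (by positivity)]
          refine ENNReal.ofReal_le_ofReal ?_
          have e1 := (abs_le.1 (hconf (sel (U ζ)))).2
          have e2 := (le_abs_self _).trans
            (abs_inner_le_normalizedSq (w := w) (ζ := ζ) ha (sel (U ζ)))
          have e3 : M ζ = m (sel (U ζ)) + inner ℝ (w (sel (U ζ))) (ζ (sel (U ζ))) := rfl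
          have e4 : ‖w (sel (U ζ))‖ ≤ a * τ ζ + a⁻¹ := by
            have : 0 ≤ a⁻¹ * (a * ‖w (sel (U ζ))‖ - 1) ^ 2 := by positivity
            have e5 : a⁻¹ * (a * ‖w (sel (U ζ))‖ - 1) ^ 2
                = a * τ ζ - 2 * ‖w (sel (U ζ))‖ + a⁻¹ := by
              simp only [hτ]; field_simp; ring
            have e6 : 0 ≤ a * τ ζ + a⁻¹ := by positivity
            linarith
          have e7 := mul_le_mul_of_nonneg_left e4 hκ
          have e8 : 0 ≤ a * τ ζ := by positivity
          have e9 : 0 ≤ a⁻¹ * normalizedSq w ζ := by positivity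
          have e10 : τ ζ = ‖w (sel (U ζ))‖ ^ 2 := rfl
          rw [e10] at *
          linarith
      _ = ENNReal.ofReal ((κ + 1) * a) * I + (ENNReal.ofReal (κ * a⁻¹) + ENNReal.ofReal a⁻¹ *
            ∫⁻ ζ, ENNReal.ofReal (normalizedSq w ζ) ∂ν) := by
          rw [lintegral_add_left (by fun_prop), lintegral_const_mul _ (by fun_prop),
            lintegral_add_left (by fun_prop), lintegral_const_mul _ (by fun_prop),
            lintegral_const, measure_univ, mul_one]
      _ ≤ ENNReal.ofReal ((κ + 1) * a) * I + (ENNReal.ofReal (κ * a⁻¹) + ENNReal.ofReal a⁻¹ *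
            ENNReal.ofReal K) := by gcongr
      _ = _ := by
          rw [← ENNReal.ofReal_mul ha'.le, ← ENNReal.ofReal_add (by positivity) (by positivity)]
          congr 2
          ring
  -- the best value against the chosen index, by comparison with an independent copy
  have h2 : ∫⁻ ζ, ENNReal.ofReal (θ k₀ - M ζ) ∂ν
      ≤ ENNReal.ofReal (gaussianTail κ)⁻¹ * (ENNReal.ofReal a * I + ENNReal.ofReal (K * a⁻¹)) := by
    have hp : ENNReal.ofReal (gaussianTail κ) ≤ ν {ζ | θ k₀ ≤ M ζ} := by
      refine (gaussianTail_le_measure (w k₀) κ).trans ?_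
      have hpre := (measurePreserving_eval (fun _ : Fin K => stdGaussian (Vec d)) k₀).measure_preimage
        (s := {ζ | κ * ‖w k₀‖ ≤ inner ℝ (w k₀) ζ})
        (measurableSet_le (by fun_prop) (by fun_prop)).nullMeasurableSet
      rw [← hpre]
      refine measure_mono fun ζ hζ => ?_
      have e1 : κ * ‖w k₀‖ ≤ inner ℝ (w k₀) (ζ k₀) := hζ
      have e2 := (abs_le.1 (hconf k₀)).1
      have e3 : U ζ k₀ ≤ M ζ := hsel.le (U ζ) k₀
      have e4 : U ζ k₀ = m k₀ + inner ℝ (w k₀) (ζ k₀) := rfl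
      change θ k₀ ≤ M ζ
      linarith
    -- With `ζ` fixed, average over the copies `ζ'` whose maximum reaches `θ k₀`. For such a copy
    -- the deficit is at most `M ζ' - M ζ`.
    have hpt : ∀ ζ, ENNReal.ofReal (gaussianTail κ) * ENNReal.ofReal (θ k₀ - M ζ)
        ≤ ENNReal.ofReal a * I + (ENNReal.ofReal (a⁻¹ / 2) * ENNReal.ofReal (normalizedSq w ζ)
          + ENNReal.ofReal (a⁻¹ / 2) * ENNReal.ofReal K) := by
      intro ζ
      have hms : MeasurableSet {ζ' | θ k₀ ≤ M ζ'} := measurableSet_le measurable_const hMm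
      calc _ ≤ ν {ζ' | θ k₀ ≤ M ζ'} * ENNReal.ofReal (θ k₀ - M ζ) := by gcongr
        _ = ∫⁻ ζ', Set.indicator {ζ' | θ k₀ ≤ M ζ'}
              (fun _ => ENNReal.ofReal (θ k₀ - M ζ)) ζ' ∂ν := by
            rw [lintegral_indicator_const hms, mul_comm]
        _ ≤ ∫⁻ ζ', (ENNReal.ofReal a * ENNReal.ofReal (τ ζ') +
              (ENNReal.ofReal (a⁻¹ / 2) * ENNReal.ofReal (normalizedSq w ζ)
              + ENNReal.ofReal (a⁻¹ / 2) * ENNReal.ofReal (normalizedSq w ζ'))) ∂ν := by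
            refine lintegral_mono fun ζ' =>
              Set.indicator_apply_le' (fun hζ' => ?_) fun _ => zero_le
            have hτ0 : 0 ≤ τ ζ' := sq_nonneg _
            have hS0 := normalizedSq_nonneg w ζ
            have hS0' := normalizedSq_nonneg w ζ'
            rw [← ENNReal.ofReal_mul ha.le, ← ENNReal.ofReal_mul (by positivity),
              ← ENNReal.ofReal_mul (by positivity),
              ← ENNReal.ofReal_add (by positivity) (by positivity),
              ← ENNReal.ofReal_add (by positivity) (by positivity)]
            refine ENNReal.ofReal_le_ofReal ?_
            have e1 : θ k₀ ≤ M ζ' := hζ'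
            have e2 := (le_abs_self _).trans
              (abs_inner_le_normalizedSq (w := w) (ζ := ζ') ha (sel (U ζ')))
            have e3 := (neg_abs_le _).trans' (neg_le_neg
              (abs_inner_le_normalizedSq (w := w) (ζ := ζ) ha (sel (U ζ'))))
            -- `M ζ` is bounded below by the index under `ζ` of the arm that `ζ'` selects. The
            -- estimated means then cancel, leaving two perturbations of the same arm.
            have e4 : U ζ (sel (U ζ')) ≤ M ζ := hsel.le (U ζ) _
            have e5 : U ζ (sel (U ζ')) =
              m (sel (U ζ')) + inner ℝ (w (sel (U ζ'))) (ζ (sel (U ζ'))) := rfl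
            have e6 : M ζ' = m (sel (U ζ')) + inner ℝ (w (sel (U ζ'))) (ζ' (sel (U ζ'))) := rfl
            have e10 : τ ζ' = ‖w (sel (U ζ'))‖ ^ 2 := rfl
            rw [e10]
            linarith
        _ = ENNReal.ofReal a * I + (ENNReal.ofReal (a⁻¹ / 2) * ENNReal.ofReal (normalizedSq w ζ)
              + ENNReal.ofReal (a⁻¹ / 2) * ∫⁻ ζ', ENNReal.ofReal (normalizedSq w ζ') ∂ν) := by
            rw [lintegral_add_left (by fun_prop), lintegral_const_mul _ (by fun_prop),
              lintegral_add_left (by fun_prop), lintegral_const_mul _ (by fun_prop),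
              lintegral_const_mul _ (by fun_prop), lintegral_const, measure_univ, mul_one]
        _ ≤ _ := by gcongr
    have hint : ENNReal.ofReal (gaussianTail κ) * ∫⁻ ζ, ENNReal.ofReal (θ k₀ - M ζ) ∂ν
        ≤ ENNReal.ofReal a * I + ENNReal.ofReal (K * a⁻¹) := by
      rw [← lintegral_const_mul _ (by fun_prop)]
      refine (lintegral_mono hpt).trans ?_
      rw [lintegral_add_left (by fun_prop), lintegral_add_left (by fun_prop),
        lintegral_const, lintegral_const, measure_univ, mul_one, mul_one]
      gcongr
      calc _ ≤ ENNReal.ofReal (a⁻¹ / 2) * ENNReal.ofReal K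
            + ENNReal.ofReal (a⁻¹ / 2) * ENNReal.ofReal K := by
            rw [lintegral_const_mul _ (by fun_prop)]
            gcongr
        _ = _ := by
            rw [← ENNReal.ofReal_mul (by positivity),
              ← ENNReal.ofReal_add (by positivity) (by positivity)]
            congr 1
            ring
    have hpp := gaussianTail_pos κ
    calc _ = ENNReal.ofReal (gaussianTail κ)⁻¹ * (ENNReal.ofReal (gaussianTail κ) *
          ∫⁻ ζ, ENNReal.ofReal (θ k₀ - M ζ) ∂ν) := by
          rw [← mul_assoc, ← ENNReal.ofReal_mul (by positivity), inv_mul_cancel₀ hpp.ne',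
            ENNReal.ofReal_one, one_mul]
      _ ≤ _ := by gcongr
  have hpp := inv_pos.2 (gaussianTail_pos κ)
  calc _ ≤ ∫⁻ ζ, (ENNReal.ofReal (θ k₀ - M ζ) + ENNReal.ofReal (M ζ - θ (sel (U ζ)))) ∂ν := by
        refine lintegral_mono fun ζ => ?_
        rw [show θ k₀ - θ (sel (U ζ)) = (θ k₀ - M ζ) + (M ζ - θ (sel (U ζ))) by ring]
        exact ENNReal.ofReal_add_le
    _ = ∫⁻ ζ, ENNReal.ofReal (θ k₀ - M ζ) ∂ν
        + ∫⁻ ζ, ENNReal.ofReal (M ζ - θ (sel (U ζ))) ∂ν := lintegral_add_left (by fun_prop) _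
    _ ≤ ENNReal.ofReal (gaussianTail κ)⁻¹ * (ENNReal.ofReal a * I + ENNReal.ofReal (K * a⁻¹))
        + (ENNReal.ofReal ((κ + 1) * a) * I + ENNReal.ofReal ((κ + K) * a⁻¹)) :=
        add_le_add h2 h1
    _ = ENNReal.ofReal (((gaussianTail κ)⁻¹ + κ + 1) * a) * I
        + ENNReal.ofReal (((gaussianTail κ)⁻¹ * K + κ + K) * a⁻¹) := by
        rw [mul_add, ← mul_assoc, ← ENNReal.ofReal_mul hpp.le, ← ENNReal.ofReal_mul hpp.le,
          add_add_add_comm, ← add_mul, ← ENNReal.ofReal_add (by positivity) (by positivity),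
          ← ENNReal.ofReal_add (by positivity) (by positivity)]
        congr 3 <;> ring
    _ ≤ _ := by
        have hK : (0 : ℝ) ≤ (gaussianTail κ)⁻¹ * K := by positivity
        unfold samplingConst
        -- `samplingConst` is a common upper bound of the two coefficients just obtained.
        gcongr ENNReal.ofReal (?_ * a) * I + ENNReal.ofReal (?_ * a⁻¹)
        · linarith [(Nat.cast_nonneg K : (0 : ℝ) ≤ K)]
        · linarith

end PosteriorSampling

end EbmTS
namespace EbmTS

open MeasureTheory ProbabilityTheory Matrix
open scoped MatrixOrder NNReal ENNReal

/-! ### Deterministic estimates for the estimators -/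

/-- Positivity of the hyperparameters and eigenvalue bounds of the prior precisions. -/
structure Admissible {d K : ℕ} (c : Params) (Sigma : Fin K → Matrix (Fin d) (Fin d) ℝ) : Prop where
  sigma_pos : 0 < c.sigma
  lam_pos : 0 < c.lam
  lamD_pos : 0 < c.lamD
  lam1_nonneg : 0 ≤ c.lam1
  posDef : ∀ k, (Sigma k).PosDef
  eigenvalue_mem : ∀ k, ∀ μ ∈ spectrum ℝ (Sigma k)⁻¹, c.lamD ≤ μ ∧ μ ≤ c.lam1

section Estimators

variable {d N K : ℕ} (D : Data d N K) (c : Params) (Sigma : Fin K → Matrix (Fin d) (Fin d) ℝ)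

/-- The Gram matrix `Xᵀ X` of the contexts at the pulls. -/
noncomputable def Data.gram (k : Fin K) (j : Fin N) (t : ℕ) : Matrix (Fin d) (Fin d) ℝ :=
  ∑ s ∈ D.pulls k j t, vecMulVec (D.context s).ofLp (D.context s).ofLp

/-- The regularized Gram matrix `Xᵀ X + σ² Σ_k⁻¹`. -/
noncomputable def Data.regGram (k : Fin K) (j : Fin N) (t : ℕ) : Matrix (Fin d) (Fin d) ℝ :=
  c.sigma ^ 2 • (Sigma k)⁻¹ + D.gram k j t

/-- The vector `Xᵀ e` for a sequence `e` indexed by time. -/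
noncomputable def Data.moment (e : ℕ → ℝ) (k : Fin K) (j : Fin N) (t : ℕ) : Fin d → ℝ :=
  ∑ s ∈ D.pulls k j t, e s • (D.context s).ofLp

/-- The self-normalized size of `Xᵀ e`. -/
noncomputable def Data.selfNorm (e : ℕ → ℝ) (k : Fin K) (j : Fin N) (t : ℕ) : ℝ :=
  D.moment e k j t ⬝ᵥ (D.regGram c Sigma k j t)⁻¹ *ᵥ D.moment e k j t

/-- The squared width `xᵀ (Xᵀ X + σ² Σ_k⁻¹)⁻¹ x`. -/
noncomputable def Data.width (k : Fin K) (j : Fin N) (t : ℕ) (x : Fin d → ℝ) : ℝ :=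
  x ⬝ᵥ (D.regGram c Sigma k j t)⁻¹ *ᵥ x

theorem Data.transpose_X_mul_X (k : Fin K) (j : Fin N) (t : ℕ) :
    (D.X k j t)ᵀ * D.X k j t = D.gram k j t := by
  ext a b
  rw [Matrix.mul_apply, Data.gram, Matrix.sum_apply]
  exact Finset.sum_coe_sort (D.pulls k j t) fun s =>
    vecMulVec (D.context s).ofLp (D.context s).ofLp a b

theorem Data.transpose_X_mulVec (e : ℕ → ℝ) (k : Fin K) (j : Fin N) (t : ℕ) :
    (D.X k j t)ᵀ *ᵥ (fun s => e s) = D.moment e k j t := by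
  ext a
  rw [Data.moment, Finset.sum_apply]
  refine Eq.trans ?_ (Finset.sum_coe_sort (D.pulls k j t) fun s =>
    (e s • (D.context s).ofLp) a)
  simp only [mulVec, dotProduct]
  exact Finset.sum_congr rfl fun s _ => mul_comm (D.context s a) (e s)

theorem Data.Ctilde_eq (k : Fin K) (j : Fin N) (t : ℕ) :
    D.Ctilde c Sigma k j t = (D.regGram c Sigma k j t)⁻¹ := by
  rw [Data.Ctilde, Data.regGram, D.transpose_X_mul_X, add_comm]

theorem Data.posSemidef_gram (k : Fin K) (j : Fin N) (t : ℕ) : (D.gram k j t).PosSemidef :=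
  posSemidef_sum _ fun _ _ => posSemidef_vecMulVec_self _

theorem Data.quad_gram_le {t : ℕ} {r : ℝ} (hx : ∀ s < t, ‖D.context s‖ ≤ r) (k : Fin K)
    (j : Fin N) (v : Fin d → ℝ) :
    v ⬝ᵥ D.gram k j t *ᵥ v ≤ t * r ^ 2 * (v ⬝ᵥ v) := by
  rw [Data.gram, Matrix.sum_mulVec, dotProduct_sum]
  have h1 : ∀ s ∈ D.pulls k j t, v ⬝ᵥ vecMulVec (D.context s).ofLp (D.context s).ofLp *ᵥ v
      ≤ r ^ 2 * (v ⬝ᵥ v) := by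
    intro s hs
    have hst : s < t := Finset.mem_range.1 (Finset.mem_filter.1 hs).1
    rw [vecMulVec_mulVec_eq, dotProduct_smul, smul_eq_mul, dotProduct_comm v, ← sq]
    refine (dotProduct_sq_le _ _).trans (mul_le_mul_of_nonneg_right ?_ ?_)
    · rw [← len_sq]
      exact pow_le_pow_left₀ (norm_nonneg _) (hx s hst) 2
    · rw [← len_sq]; positivity
  have h0 : 0 ≤ r ^ 2 * (v ⬝ᵥ v) := by rw [← len_sq]; positivity
  refine (Finset.sum_le_sum h1).trans ?_
  rw [Finset.sum_const, nsmul_eq_mul, mul_assoc]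
  refine mul_le_mul_of_nonneg_right ?_ h0
  exact_mod_cast (Finset.card_filter_le _ _).trans (Finset.card_range t).le

variable {c Sigma}

theorem Admissible.le_quad_inv (hc : Admissible c Sigma) (k : Fin K) (v : Fin d → ℝ) :
    c.lamD * (v ⬝ᵥ v) ≤ v ⬝ᵥ (Sigma k)⁻¹ *ᵥ v :=
  (hc.posDef k).inv.isHermitian.le_quad_of_le_spectrum
    (fun x hx => (hc.eigenvalue_mem k x hx).1) v

theorem Admissible.quad_inv_le (hc : Admissible c Sigma) (k : Fin K) (v : Fin d → ℝ) :
    v ⬝ᵥ (Sigma k)⁻¹ *ᵥ v ≤ c.lam1 * (v ⬝ᵥ v) :=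
  (hc.posDef k).inv.isHermitian.quad_le_of_spectrum_le
    (fun x hx => (hc.eigenvalue_mem k x hx).2) v

theorem Admissible.len_inv_mulVec_le (hc : Admissible c Sigma) (k : Fin K) (v : Fin d → ℝ) :
    len ((Sigma k)⁻¹ *ᵥ v) ≤ c.lam1 * len v :=
  (hc.posDef k).inv.posSemidef.len_mulVec_le hc.lam1_nonneg (hc.quad_inv_le k) v

/-- The lower bound `σ² λ_d` for the regularized Gram matrices. -/
noncomputable def Params.floor (c : Params) : ℝ := c.sigma ^ 2 * c.lamD

theorem Admissible.floor_pos (hc : Admissible c Sigma) : 0 < c.floor :=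
  mul_pos (pow_pos hc.sigma_pos 2) hc.lamD_pos

theorem Data.posDef_regGram (hc : Admissible c Sigma) (k : Fin K) (j : Fin N) (t : ℕ) :
    (D.regGram c Sigma k j t).PosDef :=
  ((hc.posDef k).inv.smul (pow_pos hc.sigma_pos 2)).add_posSemidef (D.posSemidef_gram k j t)

theorem Data.le_quad_regGram (hc : Admissible c Sigma) (k : Fin K) (j : Fin N) (t : ℕ)
    (v : Fin d → ℝ) : c.floor * (v ⬝ᵥ v) ≤ v ⬝ᵥ D.regGram c Sigma k j t *ᵥ v := by
  have h1 := (D.posSemidef_gram k j t).quad_nonneg v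
  have h2 := mul_le_mul_of_nonneg_left (hc.le_quad_inv k v) (sq_nonneg c.sigma)
  rw [Data.regGram, add_mulVec, dotProduct_add, smul_mulVec, dotProduct_smul, smul_eq_mul,
    Params.floor]
  linarith

theorem Data.quad_regGram_le (hc : Admissible c Sigma) {t : ℕ} {r : ℝ}
    (hx : ∀ s < t, ‖D.context s‖ ≤ r) (k : Fin K) (j : Fin N) (v : Fin d → ℝ) :
    v ⬝ᵥ D.regGram c Sigma k j t *ᵥ v ≤ (c.sigma ^ 2 * c.lam1 + t * r ^ 2) * (v ⬝ᵥ v) := by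
  have h1 := D.quad_gram_le hx k j v
  have h2 := mul_le_mul_of_nonneg_left (hc.quad_inv_le k v) (sq_nonneg c.sigma)
  rw [Data.regGram, add_mulVec, dotProduct_add, smul_mulVec, dotProduct_smul, smul_eq_mul]
  linarith

theorem Data.det_regGram_le (hc : Admissible c Sigma) {t : ℕ} {r : ℝ}
    (hx : ∀ s < t, ‖D.context s‖ ≤ r) (k : Fin K) (j : Fin N) :
    (D.regGram c Sigma k j t).det ≤ (c.sigma ^ 2 * c.lam1 + t * r ^ 2) ^ d := by
  simpa using (D.posDef_regGram hc k j t).det_le_pow (D.quad_regGram_le hc hx k j)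

theorem Data.le_det_regGram (hc : Admissible c Sigma) (k : Fin K) (j : Fin N) (t : ℕ) :
    c.floor ^ d ≤ (D.regGram c Sigma k j t).det := by
  simpa using (D.posDef_regGram hc k j t).pow_le_det hc.floor_pos.le (D.le_quad_regGram hc k j t)

theorem Data.width_nonneg (hc : Admissible c Sigma) (k : Fin K) (j : Fin N) (t : ℕ)
    (x : Fin d → ℝ) : 0 ≤ D.width c Sigma k j t x :=
  (D.posDef_regGram hc k j t).inv.posSemidef.quad_nonneg x

theorem Data.width_le (hc : Admissible c Sigma) (k : Fin K) (j : Fin N) (t : ℕ)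
    (x : Fin d → ℝ) : D.width c Sigma k j t x ≤ c.floor⁻¹ * (x ⬝ᵥ x) :=
  EbmTS.quad_inv_le (D.posDef_regGram hc k j t) hc.floor_pos (D.le_quad_regGram hc k j t) x

theorem Data.posDef_V (hc : Admissible c Sigma) (k : Fin K) (j : Fin N) (t : ℕ) :
    (D.V c Sigma k j t).PosDef := by
  have h := (hc.posDef k).posSemidef.mul_mul_conjTranspose_same (D.X k j t)
  rw [conjTranspose_eq_transpose_of_trivial] at h
  exact PosDef.posSemidef_add h (PosDef.one.smul (pow_pos hc.sigma_pos 2))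

/-- The push-through identity: `A Σ Xᵀ = Xᵀ V`, then invert both sides. It trades a matrix whose
size is the number of pulls for `d × d` matrices. -/
theorem Data.transpose_X_mul_inv_V (hc : Admissible c Sigma) (k : Fin K) (j : Fin N) (t : ℕ) :
    (D.X k j t)ᵀ * (D.V c Sigma k j t)⁻¹
      = (Sigma k)⁻¹ * ((D.regGram c Sigma k j t)⁻¹ * (D.X k j t)ᵀ) := by
  have hV := (isUnit_iff_isUnit_det _).1 (D.posDef_V hc k j t).isUnit
  have hA := (isUnit_iff_isUnit_det _).1 (D.posDef_regGram hc k j t).isUnit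
  have hS := (isUnit_iff_isUnit_det _).1 (hc.posDef k).isUnit
  have key : D.regGram c Sigma k j t * (Sigma k * (D.X k j t)ᵀ)
      = (D.X k j t)ᵀ * D.V c Sigma k j t := by
    rw [Data.regGram, Data.V, ← D.transpose_X_mul_X, Matrix.add_mul, Matrix.mul_add,
      Matrix.smul_mul, ← Matrix.mul_assoc (Sigma k)⁻¹, Matrix.nonsing_inv_mul _ hS,
      Matrix.one_mul, Matrix.mul_smul, Matrix.mul_one, add_comm]
    simp only [Matrix.mul_assoc]
  have h1 : (Sigma k)⁻¹ * ((D.regGram c Sigma k j t)⁻¹ *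
      (D.regGram c Sigma k j t * (Sigma k * (D.X k j t)ᵀ))) = (D.X k j t)ᵀ := by
    rw [Matrix.nonsing_inv_mul_cancel_left _ _ hA, Matrix.nonsing_inv_mul_cancel_left _ _ hS]
  rw [key] at h1
  conv_lhs => rw [← h1]
  simp only [Matrix.mul_assoc]
  rw [Matrix.mul_nonsing_inv _ hV, Matrix.mul_one]

theorem Data.posDef_inv_Phi (hc : Admissible c Sigma) (k : Fin K) (t : ℕ) :
    (∑ j : Fin N, (D.X k j t)ᵀ * (D.V c Sigma k j t)⁻¹ * D.X k j t
      + c.lam • (1 : Matrix (Fin d) (Fin d) ℝ)).PosDef ∧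
    ∀ v : Fin d → ℝ, c.lam * (v ⬝ᵥ v) ≤
      v ⬝ᵥ (∑ j : Fin N, (D.X k j t)ᵀ * (D.V c Sigma k j t)⁻¹ * D.X k j t
        + c.lam • (1 : Matrix (Fin d) (Fin d) ℝ)) *ᵥ v := by
  have h : (∑ j : Fin N, (D.X k j t)ᵀ * (D.V c Sigma k j t)⁻¹ * D.X k j t).PosSemidef := by
    refine posSemidef_sum _ fun j _ => ?_
    have h1 := (D.posDef_V hc k j t).inv.posSemidef.conjTranspose_mul_mul_same (D.X k j t)
    rwa [conjTranspose_eq_transpose_of_trivial] at h1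
  refine ⟨PosDef.posSemidef_add h (PosDef.one.smul hc.lam_pos), fun v => ?_⟩
  rw [add_mulVec, dotProduct_add, smul_mulVec, one_mulVec, dotProduct_smul, smul_eq_mul]
  linarith [h.quad_nonneg v]

theorem Data.posDef_Phi (hc : Admissible c Sigma) (k : Fin K) (t : ℕ) :
    (D.Phi c Sigma k t).PosDef := (D.posDef_inv_Phi hc k t).1.inv

theorem Data.quad_Phi_le (hc : Admissible c Sigma) (k : Fin K) (t : ℕ) (v : Fin d → ℝ) :
    v ⬝ᵥ D.Phi c Sigma k t *ᵥ v ≤ c.lam⁻¹ * (v ⬝ᵥ v) :=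
  EbmTS.quad_inv_le (D.posDef_inv_Phi hc k t).1 hc.lam_pos (D.posDef_inv_Phi hc k t).2 v

theorem Data.len_Phi_mulVec_le (hc : Admissible c Sigma) (k : Fin K) (t : ℕ) (v : Fin d → ℝ) :
    len (D.Phi c Sigma k t *ᵥ v) ≤ c.lam⁻¹ * len v :=
  EbmTS.len_inv_mulVec_le (D.posDef_inv_Phi hc k t).1 hc.lam_pos (D.posDef_inv_Phi hc k t).2 v

/-- The quadratic form of the posterior covariance. -/
theorem Data.quad_C (hc : Admissible c Sigma) (k : Fin K) (j : Fin N) (t : ℕ) (x : Fin d → ℝ) :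
    x ⬝ᵥ D.C c Sigma k j t *ᵥ x = c.sigma ^ 2 * D.width c Sigma k j t x
      + c.sigma ^ 4 * (((Sigma k)⁻¹ *ᵥ ((D.regGram c Sigma k j t)⁻¹ *ᵥ x)) ⬝ᵥ
        D.Phi c Sigma k t *ᵥ ((Sigma k)⁻¹ *ᵥ ((D.regGram c Sigma k j t)⁻¹ *ᵥ x))) := by
  rw [Data.C, D.Ctilde_eq, add_mulVec, dotProduct_add, smul_mulVec, dotProduct_smul, smul_mulVec,
    dotProduct_smul, smul_eq_mul, smul_eq_mul, Data.width]
  congr 2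
  simp only [← mulVec_mulVec]
  rw [← (D.posDef_regGram hc k j t).inv.isHermitian.mulVec_dotProduct,
    ← (hc.posDef k).inv.isHermitian.mulVec_dotProduct]

theorem Data.posSemidef_C (hc : Admissible c Sigma) (k : Fin K) (j : Fin N) (t : ℕ) :
    (D.C c Sigma k j t).PosSemidef := by
  have hA := (D.posDef_regGram hc k j t).inv
  have hS := (hc.posDef k).inv
  have hΦ := D.posDef_Phi hc k t
  rw [Data.C, D.Ctilde_eq]
  refine (hA.posSemidef.smul (sq_nonneg c.sigma)).add (PosSemidef.smul ?_ (by positivity))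
  have h := hΦ.posSemidef.mul_mul_conjTranspose_same
    ((D.regGram c Sigma k j t)⁻¹ * (Sigma k)⁻¹)
  rw [conjTranspose_mul, hA.isHermitian.eq, hS.isHermitian.eq] at h
  simpa only [Matrix.mul_assoc] using h

theorem Data.le_quad_C (hc : Admissible c Sigma) (k : Fin K) (j : Fin N) (t : ℕ)
    (x : Fin d → ℝ) :
    c.sigma ^ 2 * D.width c Sigma k j t x ≤ x ⬝ᵥ D.C c Sigma k j t *ᵥ x := by
  rw [D.quad_C hc]
  have := (D.posDef_Phi hc k t).posSemidef.quad_nonneg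
    ((Sigma k)⁻¹ *ᵥ ((D.regGram c Sigma k j t)⁻¹ *ᵥ x))
  have := hc.sigma_pos
  nlinarith [pow_pos this 4]

/-- The factor by which the posterior variance may exceed the squared width. -/
noncomputable def Params.varFactor (c : Params) : ℝ :=
  c.sigma ^ 2 + c.sigma ^ 4 * (c.lam⁻¹ * (c.lam1 ^ 2 * c.floor⁻¹))

/-- The second term of the posterior covariance sees `x` only through `A⁻¹x`, whose squared length
is at most the width divided by `c.floor`. -/
theorem Data.quad_C_le (hc : Admissible c Sigma) (k : Fin K) (j : Fin N) (t : ℕ)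
    (x : Fin d → ℝ) :
    x ⬝ᵥ D.C c Sigma k j t *ᵥ x ≤ c.varFactor * D.width c Sigma k j t x := by
  rw [D.quad_C hc, Params.varFactor, add_mul]
  have h1 := D.quad_Phi_le hc k t ((Sigma k)⁻¹ *ᵥ ((D.regGram c Sigma k j t)⁻¹ *ᵥ x))
  have h2 := pow_le_pow_left₀ (len_nonneg _)
    (hc.len_inv_mulVec_le k ((D.regGram c Sigma k j t)⁻¹ *ᵥ x)) 2
  have h3 := mul_len_inv_mulVec_sq_le (D.posDef_regGram hc k j t) (D.le_quad_regGram hc k j t) x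
  rw [← le_div_iff₀' hc.floor_pos, div_eq_inv_mul] at h3
  rw [← len_sq] at h1
  rw [mul_pow] at h2
  have hl := hc.lam_pos
  have h4 := h1.trans (mul_le_mul_of_nonneg_left
    (h2.trans (mul_le_mul_of_nonneg_left h3 (sq_nonneg c.lam1))) (inv_nonneg.2 hl.le))
  have h5 := mul_le_mul_of_nonneg_left h4 (by positivity : 0 ≤ c.sigma ^ 4)
  have h6 : x ⬝ᵥ (D.regGram c Sigma k j t)⁻¹ *ᵥ x = D.width c Sigma k j t x := rfl
  rw [h6] at h5
  linarith

/-! ### Bias and noise in the estimation error. -/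

theorem Data.moment_reward (b : Fin d → ℝ) (e : ℕ → ℝ) (k : Fin K) (j : Fin N) (t : ℕ)
    (h : ∀ s ∈ D.pulls k j t, D.reward s = (D.context s).ofLp ⬝ᵥ b + e s) :
    D.moment D.reward k j t = D.gram k j t *ᵥ b + D.moment e k j t := by
  rw [Data.moment, Data.moment, Data.gram, Matrix.sum_mulVec, ← Finset.sum_add_distrib]
  refine Finset.sum_congr rfl fun s hs => ?_
  rw [h s hs, add_smul, vecMulVec_mulVec_eq]

theorem Data.inv_regGram_mulVec_gram (hc : Admissible c Sigma) (k : Fin K) (j : Fin N) (t : ℕ)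
    (b : Fin d → ℝ) :
    (D.regGram c Sigma k j t)⁻¹ *ᵥ (D.gram k j t *ᵥ b)
      = b - c.sigma ^ 2 • (D.regGram c Sigma k j t)⁻¹ *ᵥ ((Sigma k)⁻¹ *ᵥ b) := by
  have h : D.gram k j t *ᵥ b
      = D.regGram c Sigma k j t *ᵥ b - c.sigma ^ 2 • (Sigma k)⁻¹ *ᵥ b := by
    rw [Data.regGram, add_mulVec, smul_mulVec, add_sub_cancel_left]
  rw [h, mulVec_sub, mulVec_smul, (D.posDef_regGram hc k j t).inv_mulVec_mulVec]

theorem Data.betaHat0_eq (hc : Admissible c Sigma) (k : Fin K) (t : ℕ) :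
    D.betaHat0 c Sigma k t = D.Phi c Sigma k t *ᵥ ∑ j : Fin N,
      (Sigma k)⁻¹ *ᵥ ((D.regGram c Sigma k j t)⁻¹ *ᵥ D.moment D.reward k j t) := by
  rw [Data.betaHat0]
  congr 1
  refine Finset.sum_congr rfl fun j _ => ?_
  rw [D.transpose_X_mul_inv_V hc, ← mulVec_mulVec, ← mulVec_mulVec, ← D.transpose_X_mulVec]
  rfl

theorem Data.betaHat_eq (k : Fin K) (j : Fin N) (t : ℕ) :
    D.betaHat c Sigma k j t
      = c.sigma ^ 2 • (D.regGram c Sigma k j t)⁻¹ *ᵥ ((Sigma k)⁻¹ *ᵥ D.betaHat0 c Sigma k t)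
        + (D.regGram c Sigma k j t)⁻¹ *ᵥ D.moment D.reward k j t := by
  rw [Data.betaHat, D.Ctilde_eq, smul_mulVec, ← mulVec_mulVec, ← mulVec_mulVec,
    ← D.transpose_X_mulVec]
  rfl

theorem Data.len_inv_regGram_moment_le (hc : Admissible c Sigma) (e : ℕ → ℝ) (k : Fin K)
    (j : Fin N) (t : ℕ) :
    len ((D.regGram c Sigma k j t)⁻¹ *ᵥ D.moment e k j t)
      ≤ (√c.floor)⁻¹ * √(D.selfNorm c Sigma e k j t) :=
  len_inv_mulVec_le_sqrt (D.posDef_regGram hc k j t) hc.floor_pos (D.le_quad_regGram hc k j t) _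

/-- The bias part of the confidence radius. -/
noncomputable def Params.biasConst (c : Params) (N : ℕ) : ℝ :=
  c.sigma ^ 2 * (√c.floor)⁻¹ * c.lam1 *
    (c.lam⁻¹ * (N * (c.lam1 * (c.bMax + c.sigma ^ 2 * (c.floor⁻¹ * (c.lam1 * c.bMax))))) + c.bMax)

/-- The factor of the noise part of the confidence radius. -/
noncomputable def Params.noiseConst (c : Params) (N : ℕ) : ℝ :=
  c.sigma ^ 2 * (√c.floor)⁻¹ * c.lam1 * (c.lam⁻¹ * (N * (c.lam1 * (√c.floor)⁻¹))) + 1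

/-- No consistency of the shared estimator is needed: `Φ ≤ λ⁻¹` bounds its length in terms of `q`,
and it enters the error only through `A⁻¹x`, which is of order `√w`. -/
theorem Data.abs_dotProduct_betaHat_sub_le (hc : Admissible c Sigma)
    (b : Fin K → Fin N → Fin d → ℝ) (hb : ∀ k j, len (b k j) ≤ c.bMax) (e : ℕ → ℝ) (t : ℕ)
    (h : ∀ s < t, D.reward s = (D.context s).ofLp ⬝ᵥ b (D.arm s) (D.bandit s) + e s)
    (k : Fin K) {q : ℝ} (hq : ∀ i, √(D.selfNorm c Sigma e k i t) ≤ q) (j : Fin N)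
    (x : Fin d → ℝ) :
    |x ⬝ᵥ (D.betaHat c Sigma k j t - b k j)|
      ≤ √(D.width c Sigma k j t x) * (c.biasConst N + c.noiseConst N * q) := by
  have hσ := hc.sigma_pos
  have hl := hc.lam_pos
  have hl1 := hc.lam1_nonneg
  have hf := hc.floor_pos
  have hsf : 0 < √c.floor := Real.sqrt_pos.2 hf
  have hmom : ∀ i, D.moment D.reward k i t = D.gram k i t *ᵥ b k i + D.moment e k i t := by
    refine fun i => D.moment_reward _ _ _ _ _ fun s hs => ?_
    obtain ⟨h1, h2, h3⟩ := Finset.mem_filter.1 hs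
    rw [h s (Finset.mem_range.1 h1), h2, h3]
  have hA := fun i => D.posDef_regGram hc k i t
  have hterm : ∀ i, len ((Sigma k)⁻¹ *ᵥ ((D.regGram c Sigma k i t)⁻¹ *ᵥ D.moment D.reward k i t))
      ≤ c.lam1 * ((c.bMax + c.sigma ^ 2 * (c.floor⁻¹ * (c.lam1 * c.bMax))) + (√c.floor)⁻¹ * q) := by
    intro i
    refine (hc.len_inv_mulVec_le k _).trans (mul_le_mul_of_nonneg_left ?_ hl1)
    rw [hmom, mulVec_add, D.inv_regGram_mulVec_gram hc]
    refine (len_add_le _ _).trans (add_le_add ((len_sub_le _ _).trans (add_le_add (hb k i) ?_))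
      ((D.len_inv_regGram_moment_le hc e k i t).trans
        (mul_le_mul_of_nonneg_left (hq i) (inv_nonneg.2 hsf.le))))
    rw [len_smul, abs_of_nonneg (sq_nonneg _)]
    refine mul_le_mul_of_nonneg_left ?_ (sq_nonneg _)
    refine (len_inv_mulVec_le (hA i) hf (D.le_quad_regGram hc k i t) _).trans
      (mul_le_mul_of_nonneg_left ?_ (inv_nonneg.2 hf.le))
    exact (hc.len_inv_mulVec_le k _).trans (mul_le_mul_of_nonneg_left (hb k i) hl1)
  have hβ0 : len (D.betaHat0 c Sigma k t) ≤ c.lam⁻¹ * (N * (c.lam1 *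
      ((c.bMax + c.sigma ^ 2 * (c.floor⁻¹ * (c.lam1 * c.bMax))) + (√c.floor)⁻¹ * q))) := by
    rw [D.betaHat0_eq hc]
    refine (D.len_Phi_mulVec_le hc k t _).trans
      (mul_le_mul_of_nonneg_left ((len_sum_le _ _).trans ?_) (inv_nonneg.2 hl.le))
    refine (Finset.sum_le_sum fun i _ => hterm i).trans ?_
    simp
  -- The shrinkage bias of the ridge part combines with the prior mean into the single difference of
  -- the shared estimator and `b k j`.
  have hdecomp : x ⬝ᵥ (D.betaHat c Sigma k j t - b k j)
      = c.sigma ^ 2 * (((D.regGram c Sigma k j t)⁻¹ *ᵥ x) ⬝ᵥ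
          ((Sigma k)⁻¹ *ᵥ (D.betaHat0 c Sigma k t - b k j)))
        + x ⬝ᵥ (D.regGram c Sigma k j t)⁻¹ *ᵥ D.moment e k j t := by
    rw [D.betaHat_eq, hmom, mulVec_add, D.inv_regGram_mulVec_gram hc,
      (hA j).inv.isHermitian.mulVec_dotProduct]
    simp only [mulVec_sub, dotProduct_add, dotProduct_sub, dotProduct_smul, smul_eq_mul]
    ring
  have h1 : |((D.regGram c Sigma k j t)⁻¹ *ᵥ x) ⬝ᵥ
      ((Sigma k)⁻¹ *ᵥ (D.betaHat0 c Sigma k t - b k j))|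
      ≤ ((√c.floor)⁻¹ * √(D.width c Sigma k j t x)) * (c.lam1 * (c.lam⁻¹ * (N * (c.lam1 *
      ((c.bMax + c.sigma ^ 2 * (c.floor⁻¹ * (c.lam1 * c.bMax))) + (√c.floor)⁻¹ * q)))
        + c.bMax)) := by
    refine (abs_dotProduct_le _ _).trans (mul_le_mul ?_ ?_ (len_nonneg _) (by positivity))
    · exact len_inv_mulVec_le_sqrt (hA j) hf (D.le_quad_regGram hc k j t) x
    · exact (hc.len_inv_mulVec_le k _).trans (mul_le_mul_of_nonneg_left
        ((len_sub_le _ _).trans (add_le_add hβ0 (hb k j))) hl1)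
  have h2 : |x ⬝ᵥ (D.regGram c Sigma k j t)⁻¹ *ᵥ D.moment e k j t|
      ≤ √(D.width c Sigma k j t x) * q := by
    have h3 := (hA j).inv.posSemidef.quad_sq_le x (D.moment e k j t)
    refine (Real.abs_le_sqrt h3).trans ?_
    rw [Real.sqrt_mul ((hA j).inv.posSemidef.quad_nonneg x)]
    exact mul_le_mul_of_nonneg_left (hq j) (Real.sqrt_nonneg _)
  rw [hdecomp]
  refine (abs_add_le _ _).trans ?_
  rw [abs_mul, abs_of_nonneg (sq_nonneg c.sigma)]
  refine (add_le_add (mul_le_mul_of_nonneg_left h1 (sq_nonneg _)) h2).trans (le_of_eq ?_)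
  rw [Params.biasConst, Params.noiseConst]
  ring

/-! ### The elliptical potential -/

theorem Data.pulls_succ (k : Fin K) (j : Fin N) (t : ℕ) :
    D.pulls k j (t + 1)
      = if D.arm t = k ∧ D.bandit t = j then insert t (D.pulls k j t) else D.pulls k j t := by
  rw [Data.pulls, Finset.range_add_one, Finset.filter_insert]
  rfl

theorem Data.notMem_pulls (k : Fin K) (j : Fin N) (t : ℕ) : t ∉ D.pulls k j t := by
  simp [Data.pulls]

theorem Data.regGram_succ_of_pull {k : Fin K} {j : Fin N} {t : ℕ}
    (h : D.arm t = k ∧ D.bandit t = j) :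
    D.regGram c Sigma k j (t + 1)
      = D.regGram c Sigma k j t + vecMulVec (D.context t).ofLp (D.context t).ofLp := by
  rw [Data.regGram, Data.regGram, Data.gram, Data.gram, D.pulls_succ, if_pos h,
    Finset.sum_insert (D.notMem_pulls k j t), add_assoc, add_comm (vecMulVec _ _)]

theorem Data.regGram_succ_of_not_pull {k : Fin K} {j : Fin N} {t : ℕ}
    (h : ¬(D.arm t = k ∧ D.bandit t = j)) :
    D.regGram c Sigma k j (t + 1) = D.regGram c Sigma k j t := by
  rw [Data.regGram, Data.regGram, Data.gram, Data.gram, D.pulls_succ, if_neg h]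

theorem Data.moment_succ_of_pull (e : ℕ → ℝ) {k : Fin K} {j : Fin N} {t : ℕ}
    (h : D.arm t = k ∧ D.bandit t = j) :
    D.moment e k j (t + 1) = D.moment e k j t + e t • (D.context t).ofLp := by
  rw [Data.moment, Data.moment, D.pulls_succ, if_pos h,
    Finset.sum_insert (D.notMem_pulls k j t), add_comm]

theorem Data.moment_succ_of_not_pull (e : ℕ → ℝ) {k : Fin K} {j : Fin N} {t : ℕ}
    (h : ¬(D.arm t = k ∧ D.bandit t = j)) :
    D.moment e k j (t + 1) = D.moment e k j t := by
  rw [Data.moment, Data.moment, D.pulls_succ, if_neg h]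

/-- Each round updates exactly one pair of arm and instance by a rank one matrix, and the
determinant of that pair is multiplied by one plus the width. -/
theorem Data.sum_log_one_add_width (hc : Admissible c Sigma) (n : ℕ) :
    ∑ t ∈ Finset.range n,
        Real.log (1 + D.width c Sigma (D.arm t) (D.bandit t) t (D.context t).ofLp)
      = ∑ k, ∑ j, (Real.log (D.regGram c Sigma k j n).det
          - Real.log (D.regGram c Sigma k j 0).det) := by
  induction n with
  | zero => simp
  | succ n ih =>
    rw [Finset.sum_range_succ, ih]
    symm
    rw [← sub_eq_iff_eq_add', ← Finset.sum_sub_distrib]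
    rw [Finset.sum_eq_single (D.arm n) _ (by simp), ← Finset.sum_sub_distrib,
      Finset.sum_eq_single (D.bandit n) _ (by simp)]
    · have hA := D.posDef_regGram hc (D.arm n) (D.bandit n) n
      rw [D.regGram_succ_of_pull ⟨rfl, rfl⟩, det_add_vecMulVec hA, Real.log_mul hA.det_pos.ne']
      · rw [Data.width]; ring
      · have := D.width_nonneg hc (D.arm n) (D.bandit n) n (D.context n).ofLp
        rw [Data.width] at this
        positivity
    · intro j _ hj
      rw [D.regGram_succ_of_not_pull fun h => hj h.2.symm, sub_self]
    · intro k _ hk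
      rw [← Finset.sum_sub_distrib]
      refine Finset.sum_eq_zero fun j _ => ?_
      rw [D.regGram_succ_of_not_pull fun h => hk h.1.symm, sub_self]

theorem Data.sum_width_le (hc : Admissible c Sigma) {n : ℕ} {r : ℝ}
    (hx : ∀ s < n, ‖D.context s‖ ≤ r) (hr : 0 < r) :
    ∑ t ∈ Finset.range n, D.width c Sigma (D.arm t) (D.bandit t) t (D.context t).ofLp
      ≤ (1 + c.floor⁻¹ * r ^ 2) * (K * N * (d * Real.log ((c.sigma ^ 2 * c.lam1 + n * r ^ 2)
          / c.floor))) := by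
  have hf := hc.floor_pos
  have hl1 := hc.lam1_nonneg
  have hσ := hc.sigma_pos
  have h1 : ∀ t ∈ Finset.range n, D.width c Sigma (D.arm t) (D.bandit t) t (D.context t).ofLp
      ≤ (1 + c.floor⁻¹ * r ^ 2) *
        Real.log (1 + D.width c Sigma (D.arm t) (D.bandit t) t (D.context t).ofLp) := by
    intro t ht
    have hw := D.width_nonneg hc (D.arm t) (D.bandit t) t (D.context t).ofLp
    have hw2 := D.width_le hc (D.arm t) (D.bandit t) t (D.context t).ofLp
    have hw3 : D.width c Sigma (D.arm t) (D.bandit t) t (D.context t).ofLp ≤ c.floor⁻¹ * r ^ 2 := by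
      refine hw2.trans (mul_le_mul_of_nonneg_left ?_ (inv_nonneg.2 hf.le))
      rw [← len_sq]
      exact pow_le_pow_left₀ (norm_nonneg _) (hx t (Finset.mem_range.1 ht)) 2
    set w := D.width c Sigma (D.arm t) (D.bandit t) t (D.context t).ofLp
    -- From `w / (1 + w) ≤ log (1 + w)` the factor `1 + w` passes to the right, where it is bounded
    -- because contexts are bounded.
    have h2 := Real.one_sub_inv_le_log_of_pos (by positivity : 0 < 1 + w)
    have h3 : w = (1 + w) * (1 - (1 + w)⁻¹) := by
      field_simp
      ring
    have h4 : 0 ≤ Real.log (1 + w) := Real.log_nonneg (by linarith)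
    calc w ≤ (1 + w) * Real.log (1 + w) :=
          h3.le.trans (mul_le_mul_of_nonneg_left h2 (by positivity))
      _ ≤ _ := mul_le_mul_of_nonneg_right (by linarith) h4
  refine (Finset.sum_le_sum h1).trans ?_
  rw [← Finset.mul_sum, D.sum_log_one_add_width hc]
  refine mul_le_mul_of_nonneg_left ?_ (by positivity)
  have h5 : ∀ k j, Real.log (D.regGram c Sigma k j n).det - Real.log (D.regGram c Sigma k j 0).det
      ≤ d * Real.log ((c.sigma ^ 2 * c.lam1 + n * r ^ 2) / c.floor) := by
    intro k j
    have hp := (D.posDef_regGram hc k j n).det_pos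
    have h6 := Real.log_le_log hp (D.det_regGram_le hc hx k j)
    have h7 := Real.log_le_log (pow_pos hf d) (D.le_det_regGram hc k j 0)
    rw [Real.log_pow] at h6 h7
    -- At `n = 0` the term `n * r ^ 2` no longer makes the numerator positive, so `log_div` is
    -- unavailable; the two determinant bounds compared at time 0 show that the quotient is at least
    -- 1 when `d > 0`.
    rcases Nat.eq_zero_or_pos n with rfl | hn
    · simp only [sub_self]
      rcases Nat.eq_zero_or_pos d with rfl | hd
      · simp
      have h8 := (D.le_det_regGram hc k j 0).trans (D.det_regGram_le hc hx k j)
      have h9 := (pow_le_pow_iff_left₀ hf.le (by positivity) hd.ne').1 h8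
      have := Real.log_nonneg ((one_le_div hf).2 h9)
      positivity
    · have hn' : (0 : ℝ) < n := by exact_mod_cast hn
      rw [Real.log_div (by positivity) hf.ne']
      linarith
  calc _ ≤ ∑ _k : Fin K, ∑ _j : Fin N, d * Real.log ((c.sigma ^ 2 * c.lam1 + n * r ^ 2) / c.floor) :=
        Finset.sum_le_sum fun k _ => Finset.sum_le_sum fun j _ => h5 k j
    _ = _ := by simp; ring

end Estimators

end EbmTS
namespace EbmTS

open MeasureTheory ProbabilityTheory Matrix
open scoped MatrixOrder NNReal ENNReal

/-! ### The estimators depend only on the past -/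

section Congruence

variable {d N K : ℕ} {D D' : Data d N K} {c : Params} {Sigma : Fin K → Matrix (Fin d) (Fin d) ℝ}

/-- Two data streams agree before time `t`. -/
def Data.AgreeBefore (D D' : Data d N K) (t : ℕ) : Prop :=
  ∀ s < t, D.arm s = D'.arm s ∧ D.bandit s = D'.bandit s ∧ D.context s = D'.context s
    ∧ D.reward s = D'.reward s

theorem Data.AgreeBefore.pulls_eq {t : ℕ} (h : D.AgreeBefore D' t) (k : Fin K) (j : Fin N) :
    D.pulls k j t = D'.pulls k j t := by
  refine Finset.filter_congr fun s hs => ?_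
  obtain ⟨h1, h2, -⟩ := h s (Finset.mem_range.1 hs)
  rw [h1, h2]

theorem Data.AgreeBefore.moment_eq {t : ℕ} (h : D.AgreeBefore D' t) {e e' : ℕ → ℝ}
    (he : ∀ s < t, e s = e' s) (k : Fin K) (j : Fin N) :
    D.moment e k j t = D'.moment e' k j t := by
  rw [Data.moment, Data.moment, h.pulls_eq]
  refine Finset.sum_congr rfl fun s hs => ?_
  have hst : s < t := Finset.mem_range.1 (Finset.mem_filter.1 hs).1
  rw [(h s hst).2.2.1, he s hst]

theorem Data.AgreeBefore.gram_eq {t : ℕ} (h : D.AgreeBefore D' t) (k : Fin K) (j : Fin N) :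
    D.gram k j t = D'.gram k j t := by
  rw [Data.gram, Data.gram, h.pulls_eq]
  refine Finset.sum_congr rfl fun s hs => ?_
  rw [(h s (Finset.mem_range.1 (Finset.mem_filter.1 hs).1)).2.2.1]

theorem Data.AgreeBefore.regGram_eq {t : ℕ} (h : D.AgreeBefore D' t) (k : Fin K) (j : Fin N) :
    D.regGram c Sigma k j t = D'.regGram c Sigma k j t := by
  rw [Data.regGram, Data.regGram, h.gram_eq]

/-- In this form no matrix is indexed by the random set of pulls, which is what the congruence and
measurability arguments require. -/
theorem Data.Phi_eq (hc : Admissible c Sigma) (D : Data d N K) (k : Fin K) (t : ℕ) :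
    D.Phi c Sigma k t = (∑ j : Fin N,
      (Sigma k)⁻¹ * ((D.regGram c Sigma k j t)⁻¹ * D.gram k j t)
        + c.lam • (1 : Matrix (Fin d) (Fin d) ℝ))⁻¹ := by
  rw [Data.Phi]
  congr 2
  refine Finset.sum_congr rfl fun j _ => ?_
  rw [D.transpose_X_mul_inv_V hc, Matrix.mul_assoc, Matrix.mul_assoc, D.transpose_X_mul_X]

theorem Data.AgreeBefore.Phi_eq (hc : Admissible c Sigma) {t : ℕ} (h : D.AgreeBefore D' t)
    (k : Fin K) : D.Phi c Sigma k t = D'.Phi c Sigma k t := by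
  rw [Data.Phi_eq hc, Data.Phi_eq hc]
  simp only [h.regGram_eq, h.gram_eq]

theorem Data.AgreeBefore.C_eq (hc : Admissible c Sigma) {t : ℕ} (h : D.AgreeBefore D' t)
    (k : Fin K) (j : Fin N) : D.C c Sigma k j t = D'.C c Sigma k j t := by
  rw [Data.C, Data.C, Data.Ctilde_eq, Data.Ctilde_eq, h.Phi_eq hc, h.regGram_eq]

theorem Data.AgreeBefore.betaHat_eq (hc : Admissible c Sigma) {t : ℕ} (h : D.AgreeBefore D' t)
    (k : Fin K) (j : Fin N) : D.betaHat c Sigma k j t = D'.betaHat c Sigma k j t := by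
  have hm := fun i => h.moment_eq (fun s hs => (h s hs).2.2.2) k i
  rw [Data.betaHat_eq, Data.betaHat_eq, Data.betaHat0_eq _ hc, Data.betaHat0_eq _ hc, h.Phi_eq hc]
  simp only [h.regGram_eq, hm]

end Congruence

/-! ### The trajectory of the algorithm -/

section Trajectory

variable {d N K : ℕ} (B : MultiBandit d N K) (c : Params) (δ : ℝ) (sel : (Fin K → ℝ) → Fin K)

/-- The data stream produced by ebmTS. -/
noncomputable def traj (ω : ℕ → Seed d N K) : Data d N K := dataOf B ω (arm B c δ sel ω)

/-- The noise in the observed rewards. -/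
noncomputable def noise (ω : ℕ → Seed d N K) (s : ℕ) : ℝ :=
  (ω s).2.1 (arm B c δ sel ω s) (ω s).1.1

variable {B c}

theorem index_congr (hc : Admissible c B.Sigma) (ω : ℕ → Seed d N K) {D D' : Data d N K} {t : ℕ}
    (h : D.AgreeBefore D' t) (hb : D.bandit t = D'.bandit t) (hx : D.context t = D'.context t) :
    index B c δ ω D t = index B c δ ω D' t := by
  funext k
  rw [index, index, hx, hb, h.betaHat_eq hc, h.C_eq hc]

variable (B c)

theorem armsBefore_of_lt (ω : ℕ → Seed d N K) {s t : ℕ} (h : s < t) :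
    armsBefore B c δ sel ω t s = arm B c δ sel ω s := by
  induction t with
  | zero => omega
  | succ t ih =>
    rcases Nat.lt_succ_iff_lt_or_eq.1 h with h1 | h1
    · rw [armsBefore, Function.update_of_ne h1.ne, ih h1]
    · rw [h1, arm]

variable {B c}

/-- The partially filled arm sequence of the recursion may be replaced by the complete trajectory,
because the index at time `t` reads only earlier arms and rewards. -/
theorem arm_eq (hc : Admissible c B.Sigma) (ω : ℕ → Seed d N K) (t : ℕ) :
    arm B c δ sel ω t
      = if h : t < K then ⟨t, h⟩ else sel (index B c δ ω (traj B c δ sel ω) t) := by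
  rw [arm, armsBefore, Function.update_self, choice]
  congr 1
  funext _
  congr 1
  refine index_congr δ hc ω (fun s hs => ?_) rfl rfl
  have h := armsBefore_of_lt B c δ sel ω hs
  simp only [traj, dataOf, h, and_self]

theorem traj_agreeBefore {ω ω' : ℕ → Seed d N K} {t : ℕ} (h : ∀ s < t, ω s = ω' s)
    (ha : ∀ s < t, arm B c δ sel ω s = arm B c δ sel ω' s) :
    (traj B c δ sel ω).AgreeBefore (traj B c δ sel ω') t := by
  intro s hs
  simp only [traj, dataOf, ha s hs, h s hs, and_self]

/-- The reward noises of round `t` are absent from the hypotheses: the arm is chosen before they are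
seen. This is the predictability behind the martingale. -/
theorem arm_congr (hc : Admissible c B.Sigma) {ω ω' : ℕ → Seed d N K} {t : ℕ}
    (h : ∀ s < t, ω s = ω' s) (h1 : (ω t).1 = (ω' t).1) (h2 : (ω t).2.2 = (ω' t).2.2) :
    arm B c δ sel ω t = arm B c δ sel ω' t := by
  induction t using Nat.strong_induction_on with
  | _ t ih =>
    rw [arm_eq δ sel hc, arm_eq δ sel hc]
    have hA := traj_agreeBefore δ sel h fun s hs =>
      ih s hs (fun r hr => h r (hr.trans hs)) (by rw [h s hs]) (by rw [h s hs])
    have h3 : index B c δ ω (traj B c δ sel ω) t = index B c δ ω' (traj B c δ sel ω') t := by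
      rw [index_congr δ hc ω hA (by simp only [traj, dataOf, h1])
        (by simp only [traj, dataOf, h1])]
      funext k
      rw [index, index, h2]
    rw [h3]

theorem traj_agreeBefore_of_eq (hc : Admissible c B.Sigma) {ω ω' : ℕ → Seed d N K} {t : ℕ}
    (h : ∀ s < t, ω s = ω' s) :
    (traj B c δ sel ω).AgreeBefore (traj B c δ sel ω') t :=
  traj_agreeBefore δ sel h fun s hs => arm_congr δ sel hc (fun r hr => h r (hr.trans hs))
    (by rw [h s hs]) (by rw [h s hs])

theorem noise_congr (hc : Admissible c B.Sigma) {ω ω' : ℕ → Seed d N K} {t : ℕ}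
    (h : ∀ s < t, ω s = ω' s) : ∀ s < t, noise B c δ sel ω s = noise B c δ sel ω' s := by
  intro s hs
  rw [noise, noise, h s hs, arm_congr δ sel hc (fun r hr => h r (hr.trans hs))
    (by rw [h s hs]) (by rw [h s hs])]

theorem traj_reward (ω : ℕ → Seed d N K) (s : ℕ) :
    (traj B c δ sel ω).reward s = ((traj B c δ sel ω).context s).ofLp ⬝ᵥ
      (B.beta ((traj B c δ sel ω).arm s) ((traj B c δ sel ω).bandit s)).ofLp
        + noise B c δ sel ω s := by
  rw [dotProduct_comm]
  rfl

/-! ### Measurability -/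

variable {t : ℕ}

theorem measurableSet_pull (ha : ∀ s < t, Measurable fun ω => arm B c δ sel ω s) (k : Fin K)
    (j : Fin N) {s : ℕ} (hs : s < t) :
    MeasurableSet {ω | (traj B c δ sel ω).arm s = k ∧ (traj B c δ sel ω).bandit s = j} := by
  have h1 : Measurable fun ω : ℕ → Seed d N K => (ω s).1.1 := by fun_prop
  exact ((ha s hs) (measurableSet_singleton k)).inter (h1 (measurableSet_singleton j))

theorem measurable_gram (ha : ∀ s < t, Measurable fun ω => arm B c δ sel ω s) (k : Fin K)
    (j : Fin N) (a b : Fin d) :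
    Measurable fun ω => (traj B c δ sel ω).gram k j t a b := by
  simp only [Data.gram, Data.pulls, Matrix.sum_apply, Finset.sum_filter]
  refine Finset.measurable_sum _ fun s hs => ?_
  refine Measurable.ite (measurableSet_pull δ sel ha k j (Finset.mem_range.1 hs)) ?_
    measurable_const
  simp only [vecMulVec_apply, traj, dataOf]
  fun_prop

theorem measurable_regGram (ha : ∀ s < t, Measurable fun ω => arm B c δ sel ω s) (k : Fin K)
    (j : Fin N) (a b : Fin d) :
    Measurable fun ω => (traj B c δ sel ω).regGram c B.Sigma k j t a b :=
  (measurable_gram δ sel ha k j a b).const_add _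

theorem measurable_moment (ha : ∀ s < t, Measurable fun ω => arm B c δ sel ω s)
    {e : (ℕ → Seed d N K) → ℕ → ℝ} (he : ∀ s < t, Measurable fun ω => e ω s) (k : Fin K)
    (j : Fin N) (a : Fin d) :
    Measurable fun ω => (traj B c δ sel ω).moment (e ω) k j t a := by
  simp only [Data.moment, Data.pulls, Finset.sum_apply, Finset.sum_filter]
  refine Finset.measurable_sum _ fun s hs => ?_
  refine Measurable.ite (measurableSet_pull δ sel ha k j (Finset.mem_range.1 hs)) ?_
    measurable_const
  simp only [Pi.smul_apply, traj, dataOf]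
  exact (he s (Finset.mem_range.1 hs)).mul (by fun_prop)

theorem measurable_noise {s : ℕ} (ha : Measurable fun ω => arm B c δ sel ω s) :
    Measurable fun ω => noise B c δ sel ω s := by
  have h1 : Measurable fun ω : ℕ → Seed d N K => (ω s).1.1 := by fun_prop
  exact measurable_apply_of_countable
    (f := fun (p : Fin K × Fin N) (ω : ℕ → Seed d N K) => (ω s).2.1 p.1 p.2)
    (fun p => by fun_prop) (ha.prodMk h1)

theorem measurable_traj_reward {s : ℕ} (ha : Measurable fun ω => arm B c δ sel ω s) :
    Measurable fun ω => (traj B c δ sel ω).reward s := by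
  have h1 : Measurable fun ω : ℕ → Seed d N K => (ω s).1.1 := by fun_prop
  have h2 : ∀ ω, (traj B c δ sel ω).reward s
      = inner ℝ (ω s).1.2 (B.beta (arm B c δ sel ω s) (ω s).1.1) + noise B c δ sel ω s :=
    fun _ => rfl
  simp only [h2]
  have h3 : ∀ p : Fin K × Fin N,
      Measurable fun ω : ℕ → Seed d N K => (inner ℝ (ω s).1.2 (B.beta p.1 p.2) : ℝ) := by
    intro p
    have h4 : Measurable fun ω : ℕ → Seed d N K => (ω s).1.2 := by fun_prop
    exact h4.inner_const
  have h5 : Measurable fun ω => (inner ℝ (ω s).1.2 (B.beta (arm B c δ sel ω s) (ω s).1.1) : ℝ) :=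
    measurable_apply_of_countable h3 (ha.prodMk h1)
  exact h5.add (measurable_noise δ sel ha)

theorem measurable_Phi (hc : Admissible c B.Sigma)
    (ha : ∀ s < t, Measurable fun ω => arm B c δ sel ω s) (k : Fin K) (a b : Fin d) :
    Measurable fun ω => (traj B c δ sel ω).Phi c B.Sigma k t a b := by
  simp only [Data.Phi_eq hc]
  refine measurable_matrix_inv (fun a b => ?_) a b
  simp only [Matrix.add_apply, Matrix.sum_apply]
  refine (Finset.measurable_sum _ fun j _ => ?_).add_const _
  exact measurable_matrix_mul (M := fun _ => (B.Sigma k)⁻¹)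
    (fun _ _ => measurable_const) (measurable_matrix_mul
    (measurable_matrix_inv (measurable_regGram δ sel ha k j)) (measurable_gram δ sel ha k j)) a b

theorem measurable_C (hc : Admissible c B.Sigma)
    (ha : ∀ s < t, Measurable fun ω => arm B c δ sel ω s) (k : Fin K) (j : Fin N) (a b : Fin d) :
    Measurable fun ω => (traj B c δ sel ω).C c B.Sigma k j t a b := by
  have hA := measurable_matrix_inv (measurable_regGram δ sel ha k j)
  simp only [Data.C, Data.Ctilde_eq, Matrix.add_apply, Matrix.smul_apply, smul_eq_mul]
  refine ((hA a b).const_mul _).add (Measurable.const_mul ?_ _)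
  exact measurable_matrix_mul (measurable_matrix_mul (measurable_matrix_mul
    (measurable_matrix_mul (M' := fun _ => (B.Sigma k)⁻¹) hA fun _ _ => measurable_const)
      (measurable_Phi δ sel hc ha k)) (M' := fun _ => (B.Sigma k)⁻¹)
      fun _ _ => measurable_const) hA a b

theorem measurable_betaHat (hc : Admissible c B.Sigma)
    (ha : ∀ s < t, Measurable fun ω => arm B c δ sel ω s) (k : Fin K) (j : Fin N) (a : Fin d) :
    Measurable fun ω => (traj B c δ sel ω).betaHat c B.Sigma k j t a := by
  have hA := fun j => measurable_matrix_inv (measurable_regGram δ sel ha k j)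
  have hr := fun j => measurable_moment δ sel ha
    (e := fun ω => (traj B c δ sel ω).reward) (fun s hs => measurable_traj_reward δ sel (ha s hs)) k j
  simp only [Data.betaHat_eq, Data.betaHat0_eq _ hc, Pi.add_apply, Pi.smul_apply, smul_eq_mul]
  refine (Measurable.const_mul ?_ _).add (measurable_mulVec (hA j) (hr j) a)
  refine measurable_mulVec (hA j) (measurable_mulVec (M := fun _ => (B.Sigma k)⁻¹) (fun _ _ => measurable_const)
    (measurable_mulVec (measurable_Phi δ sel hc ha k) fun i => ?_)) a
  simp only [Finset.sum_apply]
  exact Finset.measurable_sum _ fun l _ =>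
    measurable_mulVec (M := fun _ => (B.Sigma k)⁻¹) (fun _ _ => measurable_const) (measurable_mulVec (hA l) (hr l)) i

/-- The direction in which the Gaussian seed perturbs the index of an arm. -/
noncomputable def perturbation (D : Data d N K) (t : ℕ) (k : Fin K) : Vec d :=
  Matrix.toEuclideanCLM (𝕜 := ℝ) (CFC.sqrt
    (alpha c N d δ (t + 1) ^ 2 • D.C c B.Sigma k (D.bandit t) t)) (D.context t)

theorem posSemidef_cov (hc : Admissible c B.Sigma) (D : Data d N K) (t s : ℕ) (k : Fin K)
    (j : Fin N) : (alpha c N d δ s ^ 2 • D.C c B.Sigma k j t).PosSemidef :=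
  (D.posSemidef_C hc k j t).smul (sq_nonneg _)

/-- Moving the symmetric square root onto the context exhibits the index as estimated mean plus a
linear functional of the seed, as required by `lintegral_gap_le`. -/
theorem index_eq (ω : ℕ → Seed d N K) (D : Data d N K) (t : ℕ)
    (k : Fin K) :
    index B c δ ω D t k = (D.context t).ofLp ⬝ᵥ D.betaHat c B.Sigma k (D.bandit t) t
      + inner ℝ (perturbation (B := B) (c := c) δ D t k) ((ω t).2.2 k) := by
  have hS : (CFC.sqrt (alpha c N d δ (t + 1) ^ 2 • D.C c B.Sigma k (D.bandit t) t)).IsHermitian :=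
    (CFC.sqrt_nonneg _).posSemidef.isHermitian
  rw [index, posteriorSample, inner_add_right]
  congr 1
  · rw [EuclideanSpace.inner_eq_star_dotProduct, dotProduct_comm]
    rfl
  · rw [perturbation, EuclideanSpace.inner_eq_star_dotProduct,
      EuclideanSpace.inner_eq_star_dotProduct]
    simp only [Matrix.ofLp_toEuclideanCLM, star_trivial]
    rw [dotProduct_comm, ← hS.mulVec_dotProduct, dotProduct_comm]

theorem norm_perturbation_sq (hc : Admissible c B.Sigma) (D : Data d N K) (t : ℕ) (k : Fin K) :
    ‖perturbation (B := B) (c := c) δ D t k‖ ^ 2 = alpha c N d δ (t + 1) ^ 2 *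
      ((D.context t).ofLp ⬝ᵥ D.C c B.Sigma k (D.bandit t) t *ᵥ (D.context t).ofLp) := by
  have hP := posSemidef_cov δ hc D t (t + 1) k (D.bandit t)
  have hS : (CFC.sqrt (alpha c N d δ (t + 1) ^ 2 • D.C c B.Sigma k (D.bandit t) t)).IsHermitian :=
    (CFC.sqrt_nonneg _).posSemidef.isHermitian
  have h1 : ‖perturbation (B := B) (c := c) δ D t k‖ ^ 2
      = len (perturbation (B := B) (c := c) δ D t k).ofLp ^ 2 := rfl
  rw [h1, len_sq, perturbation, Matrix.ofLp_toEuclideanCLM, hS.mulVec_dotProduct, mulVec_mulVec,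
    CFC.sqrt_mul_sqrt_self _ hP.nonneg, smul_mulVec, dotProduct_smul, smul_eq_mul]

theorem measurable_index (hc : Admissible c B.Sigma)
    (ha : ∀ s < t, Measurable fun ω => arm B c δ sel ω s) :
    Measurable fun ω => index B c δ ω (traj B c δ sel ω) t := by
  refine measurable_pi_lambda _ fun k => ?_
  have hx : ∀ i : Fin d, Measurable fun ω : ℕ → Seed d N K => (ω t).1.2 i := fun i => by fun_prop
  have hz : ∀ i : Fin d, Measurable fun ω : ℕ → Seed d N K => (ω t).2.2 k i :=
    fun i => by fun_prop
  have hj : Measurable fun ω : ℕ → Seed d N K => (ω t).1.1 := by fun_prop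
  -- Measurability is proved for each fixed instance `j`; the random instance is substituted
  -- afterwards.
  have hj' : ∀ j : Fin N, Measurable fun ω : ℕ → Seed d N K =>
      (ω t).1.2.ofLp ⬝ᵥ (traj B c δ sel ω).betaHat c B.Sigma k j t
        + (CFC.sqrt (alpha c N d δ (t + 1) ^ 2 • (traj B c δ sel ω).C c B.Sigma k j t)
            *ᵥ (ω t).1.2.ofLp) ⬝ᵥ ((ω t).2.2 k).ofLp := by
    intro j
    refine (measurable_dotProduct hx (measurable_betaHat δ sel hc ha k j)).add ?_
    refine measurable_dotProduct (measurable_mulVec (measurable_matrix_sqrt (fun a b => ?_)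
      fun ω => posSemidef_cov δ hc _ _ _ _ _) hx) hz
    simp only [Matrix.smul_apply, smul_eq_mul]
    exact (measurable_C δ sel hc ha k j a b).const_mul _
  have hm := measurable_apply_of_countable hj' hj
  convert hm using 2 with ω
  rw [index_eq δ]
  simp only [perturbation, EuclideanSpace.inner_eq_star_dotProduct, star_trivial,
    Matrix.ofLp_toEuclideanCLM]
  rw [dotProduct_comm ((ω t).2.2 k).ofLp]
  rfl

theorem measurable_arm (hc : Admissible c B.Sigma) (hsel : Measurable sel) (t : ℕ) :
    Measurable fun ω => arm B c δ sel ω t := by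
  induction t using Nat.strong_induction_on with
  | _ t ih =>
    simp only [arm_eq δ sel hc]
    by_cases h : t < K
    · simp only [h, dite_true]; exact measurable_const
    · simp only [h, dite_false]
      exact hsel.comp (measurable_index δ sel hc ih)

end Trajectory

end EbmTS
namespace EbmTS

open MeasureTheory ProbabilityTheory Matrix
open scoped MatrixOrder NNReal ENNReal

/-! ### The law of the experiment -/

/-- Resampling part of one coordinate of an infinite product does not change integrals. -/
theorem lintegral_infinitePi_resample {X Y : Type*} [MeasurableSpace X] [MeasurableSpace Y]
    (μ : Measure X) [IsProbabilityMeasure μ] (ν : Measure Y) [IsProbabilityMeasure ν]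
    {r : X × Y → X} (hr : Measurable r)
    (hμ : ∀ F : X → ℝ≥0∞, Measurable F → ∫⁻ z, ∫⁻ y, F (r (z, y)) ∂ν ∂μ = ∫⁻ z, F z ∂μ)
    (t : ℕ) {f : (ℕ → X) → ℝ≥0∞} (hf : Measurable f) :
    ∫⁻ ω, f ω ∂(Measure.infinitePi fun _ : ℕ => μ)
      = ∫⁻ ω, ∫⁻ y, f (Function.update ω t (r (ω t, y))) ∂ν
          ∂(Measure.infinitePi fun _ : ℕ => μ) := by
  have hm : Measurable fun p : (ℕ → X) × X => Function.update p.1 t p.2 := by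
    refine measurable_pi_lambda _ fun i => ?_
    by_cases hi : i = t
    · subst hi; simpa using measurable_snd
    · simp only [Function.update_of_ne hi]; fun_prop
  have hg : Measurable fun ω : ℕ → X => ∫⁻ y, f (Function.update ω t (r (ω t, y))) ∂ν := by
    refine Measurable.lintegral_prod_right'
      (f := fun p : (ℕ → X) × Y => f (Function.update p.1 t (r (p.1 t, p.2)))) ?_
    have h1 : Measurable fun p : (ℕ → X) × Y => (p.1, r (p.1 t, p.2)) := by fun_prop
    exact hf.comp (hm.comp h1)
  rw [lintegral_infinitePi_update μ t hf, lintegral_infinitePi_update μ t hg]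
  refine lintegral_congr fun ω => ?_
  simp only [Function.update_self, Function.update_idem]
  have h2 : Measurable fun z => f (Function.update ω t z) :=
    hf.comp (hm.comp (measurable_const.prodMk measurable_id))
  exact (hμ (fun z => f (Function.update ω t z)) h2).symm

section Law

variable {d N K : ℕ} (B : MultiBandit d N K) (c : Params)

/-- The law of the noises of one round. -/
noncomputable def noiseLaw (N K : ℕ) (c : Params) : Measure (Fin K → Fin N → ℝ) :=
  Measure.pi fun _ : Fin K => Measure.pi fun _ : Fin N =>
    gaussianReal 0 (Real.toNNReal (c.sigma ^ 2))

/-- The law of the seeds of the posterior samples of one round. -/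
noncomputable def sampleLaw (d K : ℕ) : Measure (Fin K → Vec d) :=
  Measure.pi fun _ : Fin K => stdGaussian (Vec d)

instance : IsProbabilityMeasure (noiseLaw N K c) := by
  unfold noiseLaw; infer_instance

instance : IsProbabilityMeasure (sampleLaw d K) := by
  unfold sampleLaw; infer_instance

theorem seedLaw_eq : seedLaw B c = B.arrival.prod ((noiseLaw N K c).prod (sampleLaw d K)) := rfl

theorem isProbabilityMeasure_seedLaw (hB : IsProbabilityMeasure B.arrival) :
    IsProbabilityMeasure (seedLaw B c) := by
  rw [seedLaw_eq]; infer_instance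

theorem isProbabilityMeasure_law (hB : IsProbabilityMeasure B.arrival) :
    IsProbabilityMeasure (law B c) := by
  have := isProbabilityMeasure_seedLaw B c hB
  unfold law; infer_instance

/-- Integrating first over the reward noises of round `t` with everything else frozen; this is the
conditioning step of the martingale. -/
theorem lintegral_law_resample_noise (hB : IsProbabilityMeasure B.arrival) (t : ℕ)
    {f : (ℕ → Seed d N K) → ℝ≥0∞} (hf : Measurable f) :
    ∫⁻ ω, f ω ∂(law B c) = ∫⁻ ω, ∫⁻ ε, f (Function.update ω t ((ω t).1, ε, (ω t).2.2))
      ∂(noiseLaw N K c) ∂(law B c) := by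
  have := isProbabilityMeasure_seedLaw B c hB
  refine lintegral_infinitePi_resample (seedLaw B c) (noiseLaw N K c)
    (r := fun p => (p.1.1, p.2, p.1.2.2)) (by fun_prop) (fun F hF => ?_) t hf
  have h1 : Measurable fun z : Seed d N K => ∫⁻ y, F (z.1, y, z.2.2) ∂(noiseLaw N K c) :=
    Measurable.lintegral_prod_right'
      (f := fun p : Seed d N K × (Fin K → Fin N → ℝ) => F (p.1.1, p.2, p.1.2.2)) (by fun_prop)
  have h2 : ∀ q, Measurable fun z : (Fin K → Fin N → ℝ) × (Fin K → Vec d) =>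
      ∫⁻ y, F (q, y, z.2) ∂(noiseLaw N K c) := fun q => h1.comp (measurable_const.prodMk measurable_id)
  rw [seedLaw_eq, lintegral_prod _ h1.aemeasurable, lintegral_prod _ hF.aemeasurable]
  refine lintegral_congr fun q => ?_
  have h3 : Measurable fun z : (Fin K → Fin N → ℝ) × (Fin K → Vec d) => F (q, z) := by fun_prop
  rw [lintegral_prod _ (h2 q).aemeasurable, lintegral_prod _ h3.aemeasurable]
  simp only [lintegral_const, measure_univ, mul_one]
  exact (lintegral_lintegral_swap (f := fun y z => F (q, y, z)) (by fun_prop)).symm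

/-- The analogue for the Gaussian seeds of round `t`, which reduces a round to `lintegral_gap_le`.
-/
theorem lintegral_law_resample_sample (hB : IsProbabilityMeasure B.arrival) (t : ℕ)
    {f : (ℕ → Seed d N K) → ℝ≥0∞} (hf : Measurable f) :
    ∫⁻ ω, f ω ∂(law B c) = ∫⁻ ω, ∫⁻ ζ, f (Function.update ω t ((ω t).1, (ω t).2.1, ζ))
      ∂(sampleLaw d K) ∂(law B c) := by
  have := isProbabilityMeasure_seedLaw B c hB
  refine lintegral_infinitePi_resample (seedLaw B c) (sampleLaw d K)
    (r := fun p => (p.1.1, p.1.2.1, p.2)) (by fun_prop) (fun F hF => ?_) t hf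
  have h1 : Measurable fun z : Seed d N K => ∫⁻ y, F (z.1, z.2.1, y) ∂(sampleLaw d K) :=
    Measurable.lintegral_prod_right'
      (f := fun p : Seed d N K × (Fin K → Vec d) => F (p.1.1, p.1.2.1, p.2)) (by fun_prop)
  have h2 : ∀ q, Measurable fun z : (Fin K → Fin N → ℝ) × (Fin K → Vec d) =>
      ∫⁻ y, F (q, z.1, y) ∂(sampleLaw d K) := fun q => h1.comp (measurable_const.prodMk measurable_id)
  rw [seedLaw_eq, lintegral_prod _ h1.aemeasurable, lintegral_prod _ hF.aemeasurable]
  refine lintegral_congr fun q => ?_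
  have h3 : Measurable fun z : (Fin K → Fin N → ℝ) × (Fin K → Vec d) => F (q, z) := by fun_prop
  rw [lintegral_prod _ (h2 q).aemeasurable, lintegral_prod _ h3.aemeasurable]
  refine lintegral_congr fun e => ?_
  simp only [lintegral_const, measure_univ, mul_one]

variable {B c}

theorem ae_context_le (hB : B.Bounded c) : ∀ᵐ ω ∂(law B c), ∀ t, ‖(ω t).1.2‖ ≤ c.xMax := by
  have := hB.isProbabilityMeasure
  have := isProbabilityMeasure_seedLaw B c hB.isProbabilityMeasure
  rw [ae_all_iff]
  intro t
  have h1 : ∀ᵐ z ∂(seedLaw B c), ‖z.1.2‖ ≤ c.xMax := by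
    rw [seedLaw_eq]
    exact Measure.quasiMeasurePreserving_fst.ae hB.context_le
  exact (measurePreserving_eval_infinitePi (fun _ : ℕ => seedLaw B c) t).quasiMeasurePreserving.ae h1

theorem MultiBandit.Bounded.admissible (hB : B.Bounded c) (hsigma : 0 < c.sigma)
    (hlam : 0 < c.lam) (hlamD : 0 < c.lamD) (hd : 1 ≤ d) (k : Fin K) :
    Admissible c B.Sigma where
  sigma_pos := hsigma
  lam_pos := hlam
  lamD_pos := hlamD
  lam1_nonneg := by
    -- Since `d ≥ 1`, the precision matrix has an eigenvalue, and it lies between `lamD > 0` and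
    -- `lam1`.
    have hH := (hB.posDef k).inv.isHermitian
    have h := hB.eigenvalue_mem k _ (hH.eigenvalues_mem_spectrum_real ⟨0, hd⟩)
    linarith
  posDef := hB.posDef
  eigenvalue_mem := hB.eigenvalue_mem

/-! ### Regret of a single round -/

variable (δ : ℝ) (sel : (Fin K → ℝ) → Fin K)

theorem gap_nonneg (t : ℕ) (ω : ℕ → Seed d N K) : 0 ≤ gap B c δ sel t ω :=
  sub_nonneg.2 (le_ciSup (f := fun k : Fin K => (inner ℝ (ω t).1.2 (B.beta k (ω t).1.1) : ℝ))
    (Set.finite_range _).bddAbove _)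

theorem exists_gap_eq (t : ℕ) (ω : ℕ → Seed d N K) :
    ∃ k₀ : Fin K, gap B c δ sel t ω = inner ℝ (ω t).1.2 (B.beta k₀ (ω t).1.1)
      - inner ℝ (ω t).1.2 (B.beta (arm B c δ sel ω t) (ω t).1.1) := by
  have : Nonempty (Fin K) := ⟨sel 0⟩
  obtain ⟨k₀, hk₀⟩ := exists_eq_ciSup_of_finite
    (f := fun k : Fin K => (inner ℝ (ω t).1.2 (B.beta k (ω t).1.1) : ℝ))
  exact ⟨k₀, by rw [gap, ← hk₀]⟩

theorem gap_le (hB : B.Bounded c) (t : ℕ) (ω : ℕ → Seed d N K) (hω : ‖(ω t).1.2‖ ≤ c.xMax) :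
    gap B c δ sel t ω ≤ 2 * c.xMax * c.bMax := by
  obtain ⟨k₀, hk₀⟩ := exists_gap_eq (B := B) (c := c) δ sel t ω
  have h : ∀ k, |(inner ℝ (ω t).1.2 (B.beta k (ω t).1.1) : ℝ)| ≤ c.xMax * c.bMax := fun k =>
    (abs_real_inner_le_norm _ _).trans (mul_le_mul hω (hB.beta_le _ _) (norm_nonneg _)
      ((norm_nonneg _).trans hω))
  have h1 := (abs_le.1 (h k₀)).2
  have h2 := (abs_le.1 (h (arm B c δ sel ω t))).1
  rw [hk₀]
  linarith

theorem measurable_gap (hc : Admissible c B.Sigma) (hsel : Measurable sel) (t : ℕ) :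
    Measurable (gap B c δ sel t) := by
  have hx : Measurable fun ω : ℕ → Seed d N K => (ω t).1.2 := by fun_prop
  have hj : Measurable fun ω : ℕ → Seed d N K => (ω t).1.1 := by fun_prop
  have hθ : ∀ p : Fin K × Fin N,
      Measurable fun ω : ℕ → Seed d N K => (inner ℝ (ω t).1.2 (B.beta p.1 p.2) : ℝ) :=
    fun p => hx.inner_const
  have h1 : Measurable fun ω : ℕ → Seed d N K =>
      ⨆ k : Fin K, (inner ℝ (ω t).1.2 (B.beta k (ω t).1.1) : ℝ) :=
    Measurable.iSup fun k => measurable_apply_of_countable (fun j => hθ (k, j)) hj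
  have h2 : Measurable fun ω =>
      (inner ℝ (ω t).1.2 (B.beta (arm B c δ sel ω t) (ω t).1.1) : ℝ) :=
    measurable_apply_of_countable hθ ((measurable_arm δ sel hc hsel t).prodMk hj)
  exact h1.sub h2

theorem integrable_gap (hc : Admissible c B.Sigma) (hB : B.Bounded c) (hsel : Measurable sel)
    (t : ℕ) : Integrable (gap B c δ sel t) (law B c) := by
  have := isProbabilityMeasure_law B c hB.isProbabilityMeasure
  refine Integrable.of_bound (measurable_gap δ sel hc hsel t).aestronglyMeasurable
    (2 * c.xMax * c.bMax) ?_
  filter_upwards [ae_context_le hB] with ω hω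
  rw [Real.norm_of_nonneg (gap_nonneg δ sel t ω)]
  exact gap_le δ sel hB t ω (hω t)

theorem integral_gap_le (hc : Admissible c B.Sigma) (hB : B.Bounded c) (hsel : Measurable sel)
    (t : ℕ) : ∫ ω, gap B c δ sel t ω ∂(law B c) ≤ 2 * c.xMax * c.bMax := by
  have := isProbabilityMeasure_law B c hB.isProbabilityMeasure
  have h := integral_mono_ae (integrable_gap δ sel hc hB hsel t)
    (integrable_const (2 * c.xMax * c.bMax)) (by
      filter_upwards [ae_context_le hB] with ω hω
      exact gap_le δ sel hB t ω (hω t))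
  simpa using h

theorem regret_le_linear (hc : Admissible c B.Sigma) (hB : B.Bounded c) (hsel : Measurable sel)
    (n : ℕ) : regret B c δ sel n ≤ 2 * c.xMax * c.bMax * n := by
  refine (Finset.sum_le_sum fun t _ => integral_gap_le δ sel hc hB hsel t).trans (le_of_eq ?_)
  rw [Finset.sum_const, Finset.card_range, nsmul_eq_mul, mul_comm]

/-! ### The self-normalized martingale -/

/-- The exponential martingale of the self-normalized noise. -/
noncomputable def expMart (k : Fin K) (j : Fin N) (t : ℕ) (ω : ℕ → Seed d N K) : ℝ :=
  Real.exp ((traj B c δ sel ω).selfNorm c B.Sigma (noise B c δ sel ω) k j t / (2 * c.sigma ^ 2))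
    * (√((traj B c δ sel ω).regGram c B.Sigma k j t).det)⁻¹

theorem measurable_selfNorm (hc : Admissible c B.Sigma) (hsel : Measurable sel) (k : Fin K)
    (j : Fin N) (t : ℕ) :
    Measurable fun ω => (traj B c δ sel ω).selfNorm c B.Sigma (noise B c δ sel ω) k j t := by
  have ha : ∀ s < t, Measurable fun ω => arm B c δ sel ω s :=
    fun s _ => measurable_arm δ sel hc hsel s
  have hm := measurable_moment δ sel ha (e := noise B c δ sel)
    (fun s hs => measurable_noise δ sel (ha s hs)) k j
  exact measurable_dotProduct hm
    (measurable_mulVec (measurable_matrix_inv (measurable_regGram δ sel ha k j)) hm)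

theorem measurable_expMart (hc : Admissible c B.Sigma) (hsel : Measurable sel) (k : Fin K)
    (j : Fin N) (t : ℕ) : Measurable (expMart (B := B) (c := c) δ sel k j t) := by
  have ha : ∀ s < t, Measurable fun ω => arm B c δ sel ω s :=
    fun s _ => measurable_arm δ sel hc hsel s
  refine Measurable.mul ?_ ?_
  · exact ((measurable_selfNorm δ sel hc hsel k j t).div_const _).exp
  · exact (measurable_matrix_det (measurable_regGram δ sel ha k j)).sqrt.inv

/-- Resampling the noises of round `t` changes neither the past nor the pull of that round. If
another pair is pulled nothing changes; otherwise the integral `√(1 + w)` of the increment cancels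
the growth of `√det`. -/
theorem lintegral_expMart_step (hc : Admissible c B.Sigma) (k : Fin K) (j : Fin N) (t : ℕ)
    (ω : ℕ → Seed d N K) :
    ∫⁻ ε, ENNReal.ofReal (expMart (B := B) (c := c) δ sel k j (t + 1)
        (Function.update ω t ((ω t).1, ε, (ω t).2.2))) ∂(noiseLaw N K c)
      = ENNReal.ofReal (expMart (B := B) (c := c) δ sel k j t ω) := by
  set ω' : (Fin K → Fin N → ℝ) → ℕ → Seed d N K :=
    fun ε => Function.update ω t ((ω t).1, ε, (ω t).2.2) with hω'
  have hpast : ∀ ε, ∀ s < t, ω' ε s = ω s := fun ε s hs => Function.update_of_ne hs.ne _ _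
  have hnow : ∀ ε, ω' ε t = ((ω t).1, ε, (ω t).2.2) := fun ε => Function.update_self _ _ _
  have hagree := fun ε => traj_agreeBefore_of_eq δ sel hc (hpast ε)
  have hnoise := fun ε => noise_congr δ sel hc (hpast ε)
  have harm : ∀ ε, arm B c δ sel (ω' ε) t = arm B c δ sel ω t := fun ε =>
    arm_congr δ sel hc (hpast ε) (by rw [hnow]) (by rw [hnow])
  have hband : ∀ ε, (traj B c δ sel (ω' ε)).bandit t = (traj B c δ sel ω).bandit t :=
    fun ε => by simp only [traj, dataOf, hnow]
  have hctx : ∀ ε, (traj B c δ sel (ω' ε)).context t = (traj B c δ sel ω).context t :=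
    fun ε => by simp only [traj, dataOf, hnow]
  have harm' : ∀ ε, (traj B c δ sel (ω' ε)).arm t = (traj B c δ sel ω).arm t := harm
  by_cases hp : (traj B c δ sel ω).arm t = k ∧ (traj B c δ sel ω).bandit t = j
  · set D := traj B c δ sel ω with hD
    set x := (D.context t).ofLp with hx
    set A := D.regGram c B.Sigma k j t with hA
    set u := D.moment (noise B c δ sel ω) k j t with hu
    have hAp : A.PosDef := D.posDef_regGram hc k j t
    have hh : 0 ≤ x ⬝ᵥ A⁻¹ *ᵥ x := hAp.inv.posSemidef.quad_nonneg x
    have key : ∀ ε, ENNReal.ofReal (expMart (B := B) (c := c) δ sel k j (t + 1) (ω' ε))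
        = ENNReal.ofReal (expMart (B := B) (c := c) δ sel k j t ω
            * (√(1 + x ⬝ᵥ A⁻¹ *ᵥ x))⁻¹) * ENNReal.ofReal (Real.exp ((ε k j ^ 2
            - (ε k j - x ⬝ᵥ A⁻¹ *ᵥ u) ^ 2 / (1 + x ⬝ᵥ A⁻¹ *ᵥ x)) / (2 * c.sigma ^ 2))) := by
      intro ε
      have hp' : (traj B c δ sel (ω' ε)).arm t = k ∧ (traj B c δ sel (ω' ε)).bandit t = j := by
        rw [harm', hband]; exact hp
      have e1 : (traj B c δ sel (ω' ε)).regGram c B.Sigma k j (t + 1) = A + vecMulVec x x := by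
        rw [Data.regGram_succ_of_pull _ hp', (hagree ε).regGram_eq, hctx]
      have e2 : noise B c δ sel (ω' ε) t = ε k j := by
        have h1 : arm B c δ sel ω t = k := hp.1
        have h2 : (ω t).1.1 = j := hp.2
        rw [noise, harm, hnow, h1, h2]
      have e3 : (traj B c δ sel (ω' ε)).moment (noise B c δ sel (ω' ε)) k j (t + 1)
          = u + ε k j • x := by
        rw [Data.moment_succ_of_pull _ _ hp', (hagree ε).moment_eq (hnoise ε), hctx, e2]
      have e4 : 0 ≤ expMart (B := B) (c := c) δ sel k j t ω := by
        unfold expMart; positivity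
      rw [← ENNReal.ofReal_mul (by positivity)]
      congr 1
      rw [expMart, Data.selfNorm, e1, e3, quad_inv_add_vecMulVec hAp, det_add_vecMulVec hAp,
        Real.sqrt_mul hAp.det_pos.le, mul_inv, expMart, Data.selfNorm, ← hD, ← hu, ← hA,
        add_sub_assoc, add_div, Real.exp_add]
      ring
    rw [lintegral_congr key, lintegral_const_mul _ (by fun_prop)]
    have h1 := (measurePreserving_eval (fun _ : Fin K => Measure.pi fun _ : Fin N =>
      gaussianReal 0 (Real.toNNReal (c.sigma ^ 2))) k).lintegral_comp
      (f := fun e => ENNReal.ofReal (Real.exp ((e j ^ 2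
            - (e j - x ⬝ᵥ A⁻¹ *ᵥ u) ^ 2 / (1 + x ⬝ᵥ A⁻¹ *ᵥ x)) / (2 * c.sigma ^ 2))))
      (by fun_prop)
    have h2 := (measurePreserving_eval (fun _ : Fin N =>
      gaussianReal 0 (Real.toNNReal (c.sigma ^ 2))) j).lintegral_comp
      (f := fun e => ENNReal.ofReal (Real.exp ((e ^ 2
            - (e - x ⬝ᵥ A⁻¹ *ᵥ u) ^ 2 / (1 + x ⬝ᵥ A⁻¹ *ᵥ x)) / (2 * c.sigma ^ 2))))
      (by fun_prop)
    simp only [Function.eval] at h1 h2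
    rw [noiseLaw, h1, h2, lintegral_exp_quad_gaussianReal hc.sigma_pos _ hh,
      ← ENNReal.ofReal_mul (by unfold expMart; positivity), mul_assoc,
      inv_mul_cancel₀ (Real.sqrt_pos.2 (by positivity)).ne', mul_one]
  · have key : ∀ ε, expMart (B := B) (c := c) δ sel k j (t + 1) (ω' ε)
        = expMart (B := B) (c := c) δ sel k j t ω := by
      intro ε
      have hp' : ¬((traj B c δ sel (ω' ε)).arm t = k ∧ (traj B c δ sel (ω' ε)).bandit t = j) := by
        rw [harm', hband]; exact hp
      rw [expMart, expMart, Data.selfNorm, Data.selfNorm, Data.regGram_succ_of_not_pull _ hp',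
        Data.moment_succ_of_not_pull _ _ hp', (hagree ε).regGram_eq,
        (hagree ε).moment_eq (hnoise ε)]
    rw [lintegral_congr fun ε => congrArg ENNReal.ofReal (key ε), lintegral_const, measure_univ,
      mul_one]

theorem lintegral_expMart_le (hc : Admissible c B.Sigma) (hB : B.Bounded c)
    (hsel : Measurable sel) (k : Fin K) (j : Fin N) (t : ℕ) :
    ∫⁻ ω, ENNReal.ofReal (expMart (B := B) (c := c) δ sel k j t ω) ∂(law B c)
      ≤ ENNReal.ofReal (√(c.floor ^ d))⁻¹ := by
  induction t with
  | zero =>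
    have := isProbabilityMeasure_law B c hB.isProbabilityMeasure
    have h : ∀ ω, ENNReal.ofReal (expMart (B := B) (c := c) δ sel k j 0 ω)
        ≤ ENNReal.ofReal (√(c.floor ^ d))⁻¹ := by
      intro ω
      refine ENNReal.ofReal_le_ofReal ?_
      have h1 := (traj B c δ sel ω).le_det_regGram hc k j 0
      have h2 : (traj B c δ sel ω).selfNorm c B.Sigma (noise B c δ sel ω) k j 0 = 0 := by
        simp [Data.selfNorm, Data.moment, Data.pulls]
      rw [expMart, h2, zero_div, Real.exp_zero, one_mul]
      exact inv_anti₀ (Real.sqrt_pos.2 (pow_pos hc.floor_pos d)) (Real.sqrt_le_sqrt h1)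
    refine (lintegral_mono h).trans ?_
    simp
  | succ t ih =>
    rw [lintegral_law_resample_noise B c hB.isProbabilityMeasure t
      (measurable_expMart δ sel hc hsel k j (t + 1)).ennreal_ofReal]
    rw [lintegral_congr fun ω => lintegral_expMart_step δ sel hc k j t ω]
    exact ih

/-- The threshold for the self-normalized noise with horizon `n`. -/
noncomputable def noiseThreshold (c : Params) (d n : ℕ) : ℝ :=
  c.sigma ^ 2 * (d * Real.log ((c.sigma ^ 2 * c.lam1 + n * c.xMax ^ 2) / c.floor)
    + 2 * Real.log n)

/-- Markov's inequality for `expMart` at a fixed time, with the random determinant replaced by its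
almost sure bound `L ^ d`. -/
theorem measure_selfNorm_gt_le (hc : Admissible c B.Sigma) (hB : B.Bounded c)
    (hsel : Measurable sel) (k : Fin K) (j : Fin N) {t n : ℕ} (htn : t ≤ n) (hn : 1 ≤ n)
    (hx : 0 < c.xMax) :
    law B c {ω | noiseThreshold c d n
        < (traj B c δ sel ω).selfNorm c B.Sigma (noise B c δ sel ω) k j t}
      ≤ ENNReal.ofReal (n : ℝ)⁻¹ := by
  have hf := hc.floor_pos
  have hσ := hc.sigma_pos
  have hl1 := hc.lam1_nonneg
  have hn' : (0 : ℝ) < n := by exact_mod_cast hn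
  set L : ℝ := c.sigma ^ 2 * c.lam1 + n * c.xMax ^ 2 with hL
  have hLp : 0 < L := by positivity
  set F := √(c.floor ^ d) with hF
  have hFp : 0 < F := Real.sqrt_pos.2 (pow_pos hf d)
  have hlow : ∀ᵐ ω ∂(law B c), ω ∈ {ω | noiseThreshold c d n
        < (traj B c δ sel ω).selfNorm c B.Sigma (noise B c δ sel ω) k j t} →
      ENNReal.ofReal (n * F⁻¹) ≤ ENNReal.ofReal (expMart (B := B) (c := c) δ sel k j t ω) := by
    filter_upwards [ae_context_le hB] with ω hω hQ
    refine ENNReal.ofReal_le_ofReal ?_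
    have hdet := (traj B c δ sel ω).det_regGram_le hc (t := t) (fun s _ => hω s) k j
    have hdet2 : ((traj B c δ sel ω).regGram c B.Sigma k j t).det ≤ L ^ d := by
      refine hdet.trans (pow_le_pow_left₀ (by positivity) ?_ d)
      have : (t : ℝ) ≤ n := by exact_mod_cast htn
      rw [hL]; gcongr
    have hdp := ((traj B c δ sel ω).posDef_regGram hc k j t).det_pos
    have h1 : (√(L ^ d))⁻¹ ≤ (√((traj B c δ sel ω).regGram c B.Sigma k j t).det)⁻¹ :=
      inv_anti₀ (Real.sqrt_pos.2 hdp) (Real.sqrt_le_sqrt hdet2)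
    have h2 : n * √(L ^ d) * F⁻¹ ≤ Real.exp ((traj B c δ sel ω).selfNorm c B.Sigma
        (noise B c δ sel ω) k j t / (2 * c.sigma ^ 2)) := by
      -- The threshold is defined by this equation, so that `expMart` exceeds `n` times the bound
      -- `F⁻¹` on its expectation.
      have hlog : Real.log (n * √(L ^ d) * F⁻¹) = noiseThreshold c d n / (2 * c.sigma ^ 2) := by
        have hs : 0 < √(L ^ d) := Real.sqrt_pos.2 (pow_pos hLp d)
        rw [Real.log_mul (by positivity) (by positivity), Real.log_mul hn'.ne' hs.ne', Real.log_inv,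
          hF, Real.log_sqrt (by positivity), Real.log_sqrt (by positivity), Real.log_pow,
          Real.log_pow, noiseThreshold, ← hL, Real.log_div hLp.ne' hf.ne']
        field_simp
        ring
      rw [← Real.log_le_iff_le_exp (by positivity), hlog]
      have hQ' : noiseThreshold c d n
        < (traj B c δ sel ω).selfNorm c B.Sigma (noise B c δ sel ω) k j t := hQ
      gcongr
    have hs : 0 < √(L ^ d) := Real.sqrt_pos.2 (pow_pos hLp d)
    calc (n : ℝ) * F⁻¹ = (n * √(L ^ d) * F⁻¹) * (√(L ^ d))⁻¹ := by field_simp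
      _ ≤ _ := by
        unfold expMart
        exact mul_le_mul h2 h1 (by positivity) (by positivity)
  have hms : MeasurableSet {ω | noiseThreshold c d n
        < (traj B c δ sel ω).selfNorm c B.Sigma (noise B c δ sel ω) k j t} :=
    measurableSet_lt measurable_const (measurable_selfNorm δ sel hc hsel k j t)
  have h3 : ENNReal.ofReal (n * F⁻¹) * law B c {ω | noiseThreshold c d n
        < (traj B c δ sel ω).selfNorm c B.Sigma (noise B c δ sel ω) k j t}
      ≤ ENNReal.ofReal F⁻¹ := by
    calc _ = ∫⁻ _ in {ω | noiseThreshold c d n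
          < (traj B c δ sel ω).selfNorm c B.Sigma (noise B c δ sel ω) k j t},
          ENNReal.ofReal (n * F⁻¹) ∂(law B c) := by rw [setLIntegral_const]
      _ ≤ ∫⁻ ω in {ω | noiseThreshold c d n
          < (traj B c δ sel ω).selfNorm c B.Sigma (noise B c δ sel ω) k j t},
          ENNReal.ofReal (expMart (B := B) (c := c) δ sel k j t ω) ∂(law B c) :=
          setLIntegral_mono_ae' hms hlow
      _ ≤ _ := (setLIntegral_le_lintegral _ _).trans (lintegral_expMart_le δ sel hc hB hsel k j t)
  have h4 : ENNReal.ofReal (n : ℝ)⁻¹ = ENNReal.ofReal (n * F⁻¹)⁻¹ * ENNReal.ofReal F⁻¹ := by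
    rw [← ENNReal.ofReal_mul (by positivity)]
    congr 1
    field_simp
  rw [h4]
  calc _ = ENNReal.ofReal (n * F⁻¹)⁻¹ * (ENNReal.ofReal (n * F⁻¹) * law B c {ω | noiseThreshold c d n
        < (traj B c δ sel ω).selfNorm c B.Sigma (noise B c δ sel ω) k j t}) := by
        rw [← mul_assoc, ← ENNReal.ofReal_mul (by positivity),
          inv_mul_cancel₀ (by positivity), ENNReal.ofReal_one, one_mul]
    _ ≤ _ := by gcongr

end Law

end EbmTS
namespace EbmTS

open MeasureTheory ProbabilityTheory Matrix
open scoped MatrixOrder NNReal ENNReal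

/-! ### Summing the one-round bounds over the horizon. -/

section RegretSum

variable {d N K : ℕ} {B : MultiBandit d N K} {c : Params} (δ : ℝ) (sel : (Fin K → ℝ) → Fin K)

/-- The squared width of the context of round `t` for the pulled arm. -/
noncomputable def pulledWidth (t : ℕ) (ω : ℕ → Seed d N K) : ℝ :=
  (traj B c δ sel ω).width c B.Sigma (arm B c δ sel ω t) (ω t).1.1 t (ω t).1.2.ofLp

theorem measurable_pulledWidth (hc : Admissible c B.Sigma) (hsel : Measurable sel) (t : ℕ) :
    Measurable (pulledWidth (B := B) (c := c) δ sel t) := by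
  have ha : ∀ s < t, Measurable fun ω => arm B c δ sel ω s :=
    fun s _ => measurable_arm δ sel hc hsel s
  have hx : ∀ i : Fin d, Measurable fun ω : ℕ → Seed d N K => (ω t).1.2.ofLp i :=
    fun i => by fun_prop
  have hj : Measurable fun ω : ℕ → Seed d N K => (ω t).1.1 := by fun_prop
  have h1 : ∀ p : Fin K × Fin N, Measurable fun ω : ℕ → Seed d N K =>
      (traj B c δ sel ω).width c B.Sigma p.1 p.2 t (ω t).1.2.ofLp := fun p =>
    measurable_dotProduct hx
      (measurable_mulVec (measurable_matrix_inv (measurable_regGram δ sel ha p.1 p.2)) hx)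
  have h2 := measurable_apply_of_countable h1 ((measurable_arm δ sel hc hsel t).prodMk hj)
  exact h2

/-- The event that all self-normalized noises are below the threshold for horizon `n`. -/
def confidenceEvent (B : MultiBandit d N K) (c : Params) (t n : ℕ) : Set (ℕ → Seed d N K) :=
  {ω | ∀ k i, (traj B c δ sel ω).selfNorm c B.Sigma (noise B c δ sel ω) k i t
    ≤ noiseThreshold c d n}

theorem measurableSet_confidenceEvent (hc : Admissible c B.Sigma) (hsel : Measurable sel)
    (t n : ℕ) : MeasurableSet (confidenceEvent δ sel B c t n) := by
  simp only [confidenceEvent, Set.ofPred_forall]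
  exact .iInter fun k => .iInter fun i =>
    measurableSet_le (measurable_selfNorm δ sel hc hsel k i t) measurable_const

theorem measure_compl_confidenceEvent_le (hc : Admissible c B.Sigma) (hB : B.Bounded c)
    (hsel : Measurable sel) {t n : ℕ} (htn : t ≤ n) (hn : 1 ≤ n) (hx : 0 < c.xMax) :
    law B c (confidenceEvent δ sel B c t n)ᶜ ≤ ENNReal.ofReal (K * N * (n : ℝ)⁻¹) := by
  have h : (confidenceEvent δ sel B c t n)ᶜ = ⋃ k, ⋃ i, {ω | noiseThreshold c d n
      < (traj B c δ sel ω).selfNorm c B.Sigma (noise B c δ sel ω) k i t} := by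
    ext ω
    simp [confidenceEvent]
  rw [h]
  calc _ ≤ ∑ k : Fin K, ∑ i : Fin N, law B c {ω | noiseThreshold c d n
      < (traj B c δ sel ω).selfNorm c B.Sigma (noise B c δ sel ω) k i t} :=
        (measure_iUnion_fintype_le _ _).trans
          (Finset.sum_le_sum fun k _ => measure_iUnion_fintype_le _ _)
    _ ≤ ∑ _k : Fin K, ∑ _i : Fin N, ENNReal.ofReal (n : ℝ)⁻¹ :=
        Finset.sum_le_sum fun k _ => Finset.sum_le_sum fun i _ =>
          measure_selfNorm_gt_le δ sel hc hB hsel k i htn hn hx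
    _ = _ := by
        simp only [Finset.sum_const, Finset.card_univ, Fintype.card_fin, nsmul_eq_mul]
        rw [ENNReal.ofReal_mul (by positivity), ENNReal.ofReal_mul (by positivity),
          ENNReal.ofReal_natCast, ENNReal.ofReal_natCast, mul_assoc]

/-- Error and sampling deviation both scale with `√w`: the posterior variance is at least `σ²w`, so
`hrad` need only compare the two radii. -/
theorem abs_mean_sub_le (hc : Admissible c B.Sigma) (hB : B.Bounded c) {t n : ℕ}
    {κ : ℝ}
    (hrad : c.biasConst N + c.noiseConst N * √(noiseThreshold c d n)
      ≤ κ * (c.sigma * alpha c N d δ (t + 1)))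
    {ω : ℕ → Seed d N K} (hω : ω ∈ confidenceEvent δ sel B c t n) (hκ : 0 ≤ κ) (k : Fin K) :
    |(ω t).1.2.ofLp ⬝ᵥ (traj B c δ sel ω).betaHat c B.Sigma k (ω t).1.1 t
        - inner ℝ (ω t).1.2 (B.beta k (ω t).1.1)|
      ≤ κ * ‖perturbation (B := B) (c := c) δ (traj B c δ sel ω) t k‖ := by
  have h1 := (traj B c δ sel ω).abs_dotProduct_betaHat_sub_le hc (fun k j => (B.beta k j).ofLp)
    (fun k j => hB.beta_le k j) (noise B c δ sel ω) t (fun s _ => traj_reward δ sel ω s) k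
    (fun i => Real.sqrt_le_sqrt (hω k i)) (ω t).1.1 (ω t).1.2.ofLp
  have h2 : (inner ℝ (ω t).1.2 (B.beta k (ω t).1.1) : ℝ)
      = (ω t).1.2.ofLp ⬝ᵥ (B.beta k (ω t).1.1).ofLp := by
    rw [EuclideanSpace.inner_eq_star_dotProduct, dotProduct_comm]
    rfl
  rw [h2, ← dotProduct_sub]
  refine h1.trans ?_
  set w := (traj B c δ sel ω).width c B.Sigma k (ω t).1.1 t (ω t).1.2.ofLp with hw
  have hw0 : 0 ≤ w := (traj B c δ sel ω).width_nonneg hc _ _ _ _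
  have h3 : √w * (c.sigma * alpha c N d δ (t + 1))
      ≤ ‖perturbation (B := B) (c := c) δ (traj B c δ sel ω) t k‖ := by
    refine le_of_sq_le_sq ?_ (norm_nonneg _)
    rw [norm_perturbation_sq δ hc, mul_pow, mul_pow, Real.sq_sqrt hw0]
    have h4 := (traj B c δ sel ω).le_quad_C hc k (ω t).1.1 t (ω t).1.2.ofLp
    have h5 := mul_le_mul_of_nonneg_left h4 (sq_nonneg (alpha c N d δ (t + 1)))
    refine le_trans (le_of_eq ?_) h5
    ring
  calc √w * (c.biasConst N + c.noiseConst N * √(noiseThreshold c d n))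
      ≤ √w * (κ * (c.sigma * alpha c N d δ (t + 1))) :=
        mul_le_mul_of_nonneg_left hrad (Real.sqrt_nonneg _)
    _ = κ * (√w * (c.sigma * alpha c N d δ (t + 1))) := by ring
    _ ≤ _ := mul_le_mul_of_nonneg_left h3 hκ

theorem lintegral_gap_sample_le (hc : Admissible c B.Sigma) (hB : B.Bounded c)
    (hsel : IsArgmax sel) {t n : ℕ} (htK : K ≤ t) {κ Λ a : ℝ} (hκ : 0 ≤ κ) (ha : 0 < a)
    (hα : 0 ≤ alpha c N d δ (t + 1)) (hΛ : alpha c N d δ (t + 1) ≤ Λ)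
    (hrad : c.biasConst N + c.noiseConst N * √(noiseThreshold c d n)
      ≤ κ * (c.sigma * alpha c N d δ (t + 1)))
    {ω : ℕ → Seed d N K} (hω : ω ∈ confidenceEvent δ sel B c t n) :
    ∫⁻ ζ, ENNReal.ofReal (gap B c δ sel t
        (Function.update ω t ((ω t).1, (ω t).2.1, ζ))) ∂(sampleLaw d K)
      ≤ ENNReal.ofReal (samplingConst K κ * a * (Λ ^ 2 * c.varFactor)) *
          ∫⁻ ζ, ENNReal.ofReal (pulledWidth (B := B) (c := c) δ sel t
            (Function.update ω t ((ω t).1, (ω t).2.1, ζ))) ∂(sampleLaw d K)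
        + ENNReal.ofReal (samplingConst K κ * a⁻¹) := by
  set D := traj B c δ sel ω with hD
  set m : Fin K → ℝ := fun k => (ω t).1.2.ofLp ⬝ᵥ D.betaHat c B.Sigma k (ω t).1.1 t with hm
  set θ : Fin K → ℝ := fun k => inner ℝ (ω t).1.2 (B.beta k (ω t).1.1) with hθ
  set w : Fin K → Vec d := perturbation (B := B) (c := c) δ D t with hw
  set ω' : (Fin K → Vec d) → ℕ → Seed d N K :=
    fun ζ => Function.update ω t ((ω t).1, (ω t).2.1, ζ) with hω'
  have hpast : ∀ ζ, ∀ s < t, ω' ζ s = ω s := fun ζ s hs => Function.update_of_ne hs.ne _ _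
  have hnow : ∀ ζ, ω' ζ t = ((ω t).1, (ω t).2.1, ζ) := fun ζ => Function.update_self _ _ _
  have hagree := fun ζ => traj_agreeBefore_of_eq δ sel hc (hpast ζ)
  have harm : ∀ ζ, arm B c δ sel (ω' ζ) t = sel fun k => m k + inner ℝ (w k) (ζ k) := by
    intro ζ
    rw [arm_eq δ sel hc, dif_neg (not_lt.2 htK), index_congr δ hc (ω' ζ) (hagree ζ)
      (by simp only [traj, dataOf, hnow]) (by simp only [traj, dataOf, hnow])]
    congr 1
    funext k
    rw [index_eq, hnow]
    rfl
  have hconf := abs_mean_sub_le δ sel hc hB hrad hω hκ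
  have : Nonempty (Fin K) := ⟨sel 0⟩
  obtain ⟨k₀, hk₀⟩ := exists_eq_ciSup_of_finite (f := θ)
  have hgap : ∀ ζ, gap B c δ sel t (ω' ζ)
      = θ k₀ - θ (sel fun k => m k + inner ℝ (w k) (ζ k)) := by
    intro ζ
    rw [gap, harm, hnow, hk₀]
  have hvF : 0 ≤ c.varFactor := by
    have := hc.floor_pos
    have := hc.lam_pos
    unfold Params.varFactor
    positivity
  have hnorm : ∀ ζ, ENNReal.ofReal (‖w (sel fun k => m k + inner ℝ (w k) (ζ k))‖ ^ 2)
      ≤ ENNReal.ofReal (Λ ^ 2 * c.varFactor) *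
        ENNReal.ofReal (pulledWidth (B := B) (c := c) δ sel t (ω' ζ)) := by
    intro ζ
    rw [← ENNReal.ofReal_mul (by positivity)]
    refine ENNReal.ofReal_le_ofReal ?_
    rw [pulledWidth, harm, hnow, Data.width, (hagree ζ).regGram_eq]
    set k := sel fun k => m k + inner ℝ (w k) (ζ k)
    have h1 := D.quad_C_le hc k (ω t).1.1 t (ω t).1.2.ofLp
    have h2 : ‖w k‖ ^ 2 = alpha c N d δ (t + 1) ^ 2 *
      ((ω t).1.2.ofLp ⬝ᵥ D.C c B.Sigma k (ω t).1.1 t *ᵥ (ω t).1.2.ofLp) :=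
      norm_perturbation_sq δ hc D t k
    rw [h2, mul_assoc]
    have h3 : 0 ≤ c.varFactor * D.width c B.Sigma k (ω t).1.1 t (ω t).1.2.ofLp :=
      mul_nonneg hvF (D.width_nonneg hc _ _ _ _)
    exact (mul_le_mul_of_nonneg_left h1 (sq_nonneg _)).trans
      (mul_le_mul_of_nonneg_right (pow_le_pow_left₀ hα hΛ 2) h3)
  have hC : 0 ≤ samplingConst K κ := by
    have := gaussianTail_pos κ
    unfold samplingConst
    positivity
  rw [lintegral_congr fun ζ => congrArg ENNReal.ofReal (hgap ζ)]
  refine (lintegral_gap_le hsel m θ w hκ hconf k₀ ha).trans ?_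
  refine add_le_add ?_ le_rfl
  rw [ENNReal.ofReal_mul (by positivity) (q := Λ ^ 2 * c.varFactor), mul_assoc]
  refine mul_le_mul' le_rfl ?_
  refine (lintegral_mono hnorm).trans (le_of_eq ?_)
  rw [lintegral_const_mul' _ _ ENNReal.ofReal_ne_top]
  rfl

/-- On the confidence event the sampling bound applies with the past frozen. Off it, the trivial
bound on the gap is paid with probability at most `KN / n`, which over `n` rounds costs only a
constant. -/
theorem lintegral_gap_round_le (hc : Admissible c B.Sigma) (hB : B.Bounded c)
    (hsel : IsArgmax sel) {t n : ℕ} (htK : K ≤ t) (htn : t ≤ n) (hn : 1 ≤ n) (hx : 0 < c.xMax)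
    {κ Λ a : ℝ} (hκ : 0 ≤ κ) (ha : 0 < a)
    (hα : 0 ≤ alpha c N d δ (t + 1)) (hΛ : alpha c N d δ (t + 1) ≤ Λ)
    (hrad : c.biasConst N + c.noiseConst N * √(noiseThreshold c d n)
      ≤ κ * (c.sigma * alpha c N d δ (t + 1))) :
    ∫⁻ ω, ENNReal.ofReal (gap B c δ sel t ω) ∂(law B c)
      ≤ ENNReal.ofReal (samplingConst K κ * a * (Λ ^ 2 * c.varFactor)) *
          ∫⁻ ω, ENNReal.ofReal (pulledWidth (B := B) (c := c) δ sel t ω) ∂(law B c)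
        + ENNReal.ofReal (samplingConst K κ * a⁻¹)
        + ENNReal.ofReal (2 * c.xMax * c.bMax) * ENNReal.ofReal (K * N * (n : ℝ)⁻¹) := by
  have := isProbabilityMeasure_law B c hB.isProbabilityMeasure
  have hP := hB.isProbabilityMeasure
  rw [lintegral_law_resample_sample B c hP t
      (measurable_gap δ sel hc hsel.measurable t).ennreal_ofReal,
    lintegral_law_resample_sample B c hP t
      (measurable_pulledWidth δ sel hc hsel.measurable t).ennreal_ofReal]
  set E := confidenceEvent δ sel B c t n with hE
  have hEm : MeasurableSet E := measurableSet_confidenceEvent δ sel hc hsel.measurable t n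
  set q := ENNReal.ofReal (samplingConst K κ * a * (Λ ^ 2 * c.varFactor)) with hq
  have hpt : ∀ᵐ ω ∂(law B c), ∫⁻ ζ, ENNReal.ofReal (gap B c δ sel t
        (Function.update ω t ((ω t).1, (ω t).2.1, ζ))) ∂(sampleLaw d K)
      ≤ (q * ∫⁻ ζ, ENNReal.ofReal (pulledWidth (B := B) (c := c) δ sel t
            (Function.update ω t ((ω t).1, (ω t).2.1, ζ))) ∂(sampleLaw d K)
        + ENNReal.ofReal (samplingConst K κ * a⁻¹))
        + Eᶜ.indicator (fun _ => ENNReal.ofReal (2 * c.xMax * c.bMax)) ω := by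
    filter_upwards [ae_context_le hB] with ω hω
    by_cases h : ω ∈ E
    · exact (lintegral_gap_sample_le δ sel hc hB hsel htK hκ ha hα hΛ hrad h).trans
        le_self_add
    · rw [Set.indicator_of_mem (Set.mem_compl h)]
      refine le_trans ?_ le_add_self
      calc _ ≤ ∫⁻ _ζ, ENNReal.ofReal (2 * c.xMax * c.bMax) ∂(sampleLaw d K) := by
            refine lintegral_mono fun ζ => ENNReal.ofReal_le_ofReal ?_
            refine gap_le δ sel hB t _ ?_
            rw [Function.update_self]
            exact hω t
        _ = _ := by rw [lintegral_const, measure_univ, mul_one]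
  refine (lintegral_mono_ae hpt).trans ?_
  rw [lintegral_add_right _ (measurable_const.indicator hEm.compl),
    lintegral_add_right _ measurable_const, lintegral_const_mul' _ _ ENNReal.ofReal_ne_top,
    lintegral_const, measure_univ, mul_one, lintegral_indicator_const hEm.compl]
  gcongr
  exact measure_compl_confidenceEvent_le δ sel hc hB hsel.measurable htn hn hx

/-- The bound on the sum of the squared widths of the pulled arms. -/
noncomputable def widthBound (c : Params) (d N K n : ℕ) : ℝ :=
  (1 + c.floor⁻¹ * c.xMax ^ 2) * (K * N * (d * Real.log ((c.sigma ^ 2 * c.lam1 + n * c.xMax ^ 2)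
    / c.floor)))

theorem sum_lintegral_pulledWidth_le (hc : Admissible c B.Sigma) (hB : B.Bounded c)
    (hsel : Measurable sel) (n : ℕ) (hx : 0 < c.xMax) :
    ∑ t ∈ Finset.range n,
        ∫⁻ ω, ENNReal.ofReal (pulledWidth (B := B) (c := c) δ sel t ω) ∂(law B c)
      ≤ ENNReal.ofReal (widthBound c d N K n) := by
  have := isProbabilityMeasure_law B c hB.isProbabilityMeasure
  rw [← lintegral_finsetSum _ fun t _ => (measurable_pulledWidth δ sel hc hsel t).ennreal_ofReal]
  calc _ ≤ ∫⁻ _ω, ENNReal.ofReal (widthBound c d N K n) ∂(law B c) := by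
        refine lintegral_mono_ae ?_
        filter_upwards [ae_context_le hB] with ω hω
        have h0 : ∀ t ∈ Finset.range n, 0 ≤ pulledWidth (B := B) (c := c) δ sel t ω :=
          fun t _ => (traj B c δ sel ω).width_nonneg hc _ _ _ _
        rw [← ENNReal.ofReal_sum_of_nonneg h0]
        exact ENNReal.ofReal_le_ofReal
          ((traj B c δ sel ω).sum_width_le hc (fun s _ => hω s) hx)
    _ = _ := by rw [lintegral_const, measure_univ, mul_one]

/-- Regret bound in terms of a round `t₀` from which on the radius `κ α_t` is valid. -/
theorem regret_le_of_radius (hc : Admissible c B.Sigma) (hB : B.Bounded c)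
    (hsel : IsArgmax sel) {n t₀ : ℕ} (hK : K ≤ t₀) (hn : 1 ≤ n) (hx : 0 < c.xMax) (hb : 0 ≤ c.bMax)
    {κ Λ a : ℝ} (hκ : 0 ≤ κ) (ha : 0 < a)
    (hα : ∀ t, t₀ ≤ t → t < n → 0 ≤ alpha c N d δ (t + 1) ∧ alpha c N d δ (t + 1) ≤ Λ ∧
      c.biasConst N + c.noiseConst N * √(noiseThreshold c d n)
        ≤ κ * (c.sigma * alpha c N d δ (t + 1))) :
    regret B c δ sel n ≤ 2 * c.xMax * c.bMax * (t₀ + K * N)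
      + samplingConst K κ * (a * (Λ ^ 2 * c.varFactor * max (widthBound c d N K n) 0) + n * a⁻¹) := by
  have hC : 0 ≤ samplingConst K κ := by
    have := gaussianTail_pos κ
    unfold samplingConst
    positivity
  have hvF : 0 ≤ c.varFactor := by
    have := hc.floor_pos
    have := hc.lam_pos
    unfold Params.varFactor
    positivity
  have hn' : (0 : ℝ) < n := by exact_mod_cast hn
  set q : ℝ := samplingConst K κ * a * (Λ ^ 2 * c.varFactor) with hq
  have hq0 : 0 ≤ q := by positivity
  set x2 : ℝ := 2 * c.xMax * c.bMax with hx2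
  have hx20 : 0 ≤ x2 := by positivity
  set V : ℕ → ℝ≥0∞ := fun t =>
    ∫⁻ ω, ENNReal.ofReal (pulledWidth (B := B) (c := c) δ sel t ω) ∂(law B c) with hV
  have hround : ∀ t ∈ Finset.range n, ENNReal.ofReal (∫ ω, gap B c δ sel t ω ∂(law B c))
      ≤ ENNReal.ofReal (if t < t₀ then x2 else 0)
        + (ENNReal.ofReal q * V t + ENNReal.ofReal (samplingConst K κ * a⁻¹)
          + ENNReal.ofReal x2 * ENNReal.ofReal (K * N * (n : ℝ)⁻¹)) := by
    intro t ht
    have htn := Finset.mem_range.1 ht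
    by_cases h : t < t₀
    · rw [if_pos h]
      exact (ENNReal.ofReal_le_ofReal
        (integral_gap_le δ sel hc hB hsel.measurable t)).trans le_self_add
    · obtain ⟨h1, h2, h3⟩ := hα t (not_lt.1 h) htn
      rw [ofReal_integral_eq_lintegral_ofReal (integrable_gap δ sel hc hB hsel.measurable t)
        (ae_of_all _ fun ω => gap_nonneg δ sel t ω)]
      exact (lintegral_gap_round_le δ sel hc hB hsel (hK.trans (not_lt.1 h)) htn.le hn hx hκ ha
        h1 h2 h3).trans le_add_self
  have hsum := Finset.sum_le_sum hround
  rw [← ENNReal.ofReal_sum_of_nonneg fun t _ =>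
    integral_nonneg fun ω => gap_nonneg δ sel t ω] at hsum
  simp only [Finset.sum_add_distrib, Finset.sum_const, Finset.card_range] at hsum
  rw [← Finset.mul_sum, ← ENNReal.ofReal_sum_of_nonneg (by intros; split_ifs <;> simp [hx20]),
    ← ENNReal.ofReal_mul hx20, ← ENNReal.ofReal_nsmul, ← ENNReal.ofReal_nsmul] at hsum
  have hVs : ∑ t ∈ Finset.range n, V t ≤ ENNReal.ofReal (max (widthBound c d N K n) 0) :=
    (sum_lintegral_pulledWidth_le δ sel hc hB hsel.measurable n hx).trans
      (ENNReal.ofReal_le_ofReal (le_max_left _ _))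
  have hfin : ENNReal.ofReal (∑ t ∈ Finset.range n, ∫ ω, gap B c δ sel t ω ∂(law B c))
      ≤ ENNReal.ofReal ((∑ t ∈ Finset.range n, if t < t₀ then x2 else 0)
        + (q * max (widthBound c d N K n) 0 + n • (samplingConst K κ * a⁻¹)
          + n • (x2 * (K * N * (n : ℝ)⁻¹)))) := by
    have hs0 : 0 ≤ ∑ t ∈ Finset.range n, if t < t₀ then x2 else 0 :=
      Finset.sum_nonneg fun t _ => by split_ifs <;> simp [hx20]
    have hm0 : 0 ≤ max (widthBound c d N K n) 0 := le_max_right _ _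
    rw [ENNReal.ofReal_add hs0 (by positivity), ENNReal.ofReal_add (by positivity) (by positivity),
      ENNReal.ofReal_add (by positivity) (by positivity), ENNReal.ofReal_mul hq0]
    refine hsum.trans ?_
    gcongr
  have hs1 : (∑ t ∈ Finset.range n, if t < t₀ then x2 else 0) ≤ x2 * t₀ := by
    rw [← Finset.sum_filter, Finset.sum_const, nsmul_eq_mul, mul_comm]
    refine mul_le_mul_of_nonneg_left ?_ hx20
    have h1 : (Finset.range n).filter (fun t => t < t₀) ⊆ Finset.range t₀ := fun t ht =>
      Finset.mem_range.2 (Finset.mem_filter.1 ht).2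
    exact_mod_cast (Finset.card_le_card h1).trans (Finset.card_range t₀).le
  have hs0 : 0 ≤ ∑ t ∈ Finset.range n, if t < t₀ then x2 else 0 :=
    Finset.sum_nonneg fun t _ => by split_ifs <;> simp [hx20]
  have hm0 : 0 ≤ max (widthBound c d N K n) 0 := le_max_right _ _
  have hreal := (ENNReal.ofReal_le_ofReal_iff (by positivity)).1 hfin
  rw [regret]
  refine hreal.trans ?_
  rw [nsmul_eq_mul, nsmul_eq_mul]
  have h1 : (n : ℝ) * (x2 * (K * N * (n : ℝ)⁻¹)) = x2 * (K * N) := by field_simp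
  rw [h1, hq]
  refine le_of_sub_nonneg ?_
  have h2 := sub_nonneg.2 hs1
  refine h2.trans (le_of_eq ?_)
  ring

end RegretSum

end EbmTS
namespace EbmTS

open MeasureTheory ProbabilityTheory Matrix
open scoped MatrixOrder NNReal ENNReal

/-! ### Growth of the constants in `n` and `d`, and the choice of parameters. -/

section Rate

variable {d N K : ℕ} {B : MultiBandit d N K} {c : Params}

theorem MultiBandit.Bounded.xMax_nonneg (hB : B.Bounded c) : 0 ≤ c.xMax := by
  have := hB.isProbabilityMeasure
  obtain ⟨q, hq⟩ := hB.context_le.exists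
  exact (norm_nonneg _).trans hq

theorem MultiBandit.Bounded.pos_N (hB : B.Bounded c) : 0 < N := by
  have := hB.isProbabilityMeasure
  obtain ⟨q⟩ := nonempty_of_isProbabilityMeasure B.arrival
  exact q.1.pos

theorem MultiBandit.Bounded.bMax_nonneg (hB : B.Bounded c) (k : Fin K) : 0 ≤ c.bMax :=
  (norm_nonneg _).trans (hB.beta_le k ⟨0, hB.pos_N⟩)

theorem alpha_nonneg (hσ : 0 ≤ c.sigma) (hb : 0 ≤ c.bMax) (δ : ℝ) (t : ℕ) :
    0 ≤ alpha c N d δ t := by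
  unfold alpha
  positivity

theorem constC_nonneg : 0 ≤ constC :=
  add_nonneg (Real.iSup_nonneg fun _ => by positivity) zero_le_one

/-- Up to a constant factor the logarithm ignores multiplicative constants. -/
theorem log_mul_le {A y : ℝ} (hA : 0 < A) (hy : 2 ≤ y) :
    Real.log (A * y) ≤ (1 + |Real.log A| / Real.log 2) * Real.log y := by
  have h2 : 0 < Real.log 2 := Real.log_pos one_lt_two
  have h3 : Real.log 2 ≤ Real.log y := Real.log_le_log two_pos hy
  rw [Real.log_mul hA.ne' (by linarith)]
  have h4 : Real.log A ≤ |Real.log A| / Real.log 2 * Real.log y := by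
    calc Real.log A ≤ |Real.log A| / Real.log 2 * Real.log 2 := by
          rw [div_mul_cancel₀ _ h2.ne']; exact le_abs_self _
      _ ≤ _ := mul_le_mul_of_nonneg_left h3 (by positivity)
  linarith

/-- If `N ≥ 2` the term `log N` suffices; if `N = 1` the only arrival probability is 1 and the sum
is `log n`. -/
theorem log_two_le_sum_log (hB : B.Bounded c) {n : ℕ} (hn : 2 ≤ n)
    (hp : ∀ j, 1 ≤ B.prob j * n) :
    Real.log 2 ≤ ∑ j, Real.log (B.prob j * n) + Real.log N := by
  have hP := hB.isProbabilityMeasure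
  have hsum : 0 ≤ ∑ j, Real.log (B.prob j * n) :=
    Finset.sum_nonneg fun j _ => Real.log_nonneg (hp j)
  have hN := hB.pos_N
  rcases Nat.lt_or_ge 1 N with h | h
  · have : Real.log 2 ≤ Real.log N := Real.log_le_log two_pos (by exact_mod_cast h)
    linarith
  · obtain rfl : N = 1 := by omega
    have h1 : B.prob 0 = 1 := by
      have : {q : Fin 1 × Vec d | q.1 = 0} = Set.univ :=
        Set.eq_univ_of_forall fun q => Subsingleton.elim _ _
      rw [MultiBandit.prob, this, probReal_univ]
    simp only [Finset.univ_unique, Fin.default_eq_zero, Fin.isValue, Finset.sum_singleton, h1,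
      one_mul, Nat.cast_one, Real.log_one, add_zero]
    exact Real.log_le_log two_pos (by exact_mod_cast hn)

/-- The factor of `log n` that bounds `log ((σ² λ₁ + n x_max²) / (σ² λ_d))`. -/
noncomputable def Params.detConst (c : Params) : ℝ :=
  1 + |Real.log ((c.sigma ^ 2 * c.lam1 + c.xMax ^ 2) / c.floor)| / Real.log 2

theorem Params.one_le_detConst (c : Params) : 1 ≤ c.detConst := by
  have h2 : 0 < Real.log 2 := Real.log_pos one_lt_two
  rw [Params.detConst]
  have : 0 ≤ |Real.log ((c.sigma ^ 2 * c.lam1 + c.xMax ^ 2) / c.floor)| / Real.log 2 := by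
    positivity
  linarith

theorem log_det_le (hf : 0 < c.floor) (hl1 : 0 ≤ c.lam1) (hx : 0 < c.xMax) {n : ℕ} (hn : 2 ≤ n) :
    Real.log ((c.sigma ^ 2 * c.lam1 + n * c.xMax ^ 2) / c.floor)
      ≤ c.detConst * Real.log n := by
  have hn' : (2 : ℝ) ≤ n := by exact_mod_cast hn
  refine le_trans (Real.log_le_log (by positivity) ?_) (log_mul_le (by positivity) hn')
  rw [div_mul_eq_mul_div]
  gcongr
  nlinarith [mul_nonneg (sq_nonneg c.sigma) hl1]

theorem noiseThreshold_le (hf : 0 < c.floor) (hl1 : 0 ≤ c.lam1) (hx : 0 < c.xMax) {n : ℕ}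
    (hn : 2 ≤ n) (hd : 1 ≤ d) :
    noiseThreshold c d n ≤ c.sigma ^ 2 * (c.detConst + 2) * (d * Real.log n) := by
  have h1 := log_det_le hf hl1 hx hn
  have hd' : (1 : ℝ) ≤ d := by exact_mod_cast hd
  have h2 : 0 ≤ Real.log n := Real.log_natCast_nonneg n
  rw [noiseThreshold, mul_assoc]
  refine mul_le_mul_of_nonneg_left ?_ (sq_nonneg _)
  have h3 := mul_le_mul_of_nonneg_left h1 (by positivity : (0 : ℝ) ≤ d)
  nlinarith

theorem max_widthBound_le (hf : 0 < c.floor) (hl1 : 0 ≤ c.lam1) (hx : 0 < c.xMax) {n : ℕ}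
    (hn : 2 ≤ n) :
    max (widthBound c d N K n) 0
      ≤ ((1 + c.floor⁻¹ * c.xMax ^ 2) * (K * N * c.detConst) + 1) * (d * Real.log n) := by
  have h1 := log_det_le hf hl1 hx hn
  have h2 : 0 ≤ Real.log n := Real.log_natCast_nonneg n
  have h3 := c.one_le_detConst
  refine max_le ?_ (by positivity)
  rw [widthBound]
  calc _ ≤ (1 + c.floor⁻¹ * c.xMax ^ 2) * (K * N * (d * (c.detConst * Real.log n))) := by gcongr
    _ ≤ _ := by
      have : 0 ≤ (d : ℝ) * Real.log n := by positivity
      linarith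

/-- The ratio `(max{λ, σ² λ₁} + x_max²) / √(λ λ_d σ²)` inside the logarithm of the radius. -/
noncomputable def Params.logRatio (c : Params) : ℝ :=
  (max c.lam (c.sigma ^ 2 * c.lam1) + c.xMax ^ 2) / √(c.lam * c.lamD * c.sigma ^ 2)

/-- The constant in the upper bound for `α_t(δ)`. -/
noncomputable def Params.alphaConst (c : Params) (N : ℕ) : ℝ :=
  c.sigma * N * c.bMax * √c.lam1 / √(Real.log 2)
    + 2 * √(c.sigma ^ 2 * max (c.lam1 / c.lam) 1 * (1 + |Real.log c.logRatio| / Real.log 2))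

/-- The assumption `2δ ≤ n` keeps `log (n / δ)` at least `log 2`, so it absorbs both the bias term
and the constants inside the logarithm. -/
theorem alpha_le (hσ : 0 < c.sigma) (hlam : 0 < c.lam) (hlamD : 0 < c.lamD) (hb : 0 ≤ c.bMax)
    (hx : 0 < c.xMax) (hd : 1 ≤ d) {δ : ℝ} (hδ : 0 < δ) {t n : ℕ} (htn : t ≤ n) (hn : 1 ≤ n)
    (hnδ : 2 * δ ≤ n) :
    alpha c N d δ t ≤ c.alphaConst N * √(d * Real.log (n / δ)) := by
  have h2 : 0 < Real.log 2 := Real.log_pos one_lt_two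
  have hd' : (1 : ℝ) ≤ d := by exact_mod_cast hd
  have hn' : (1 : ℝ) ≤ n := by exact_mod_cast hn
  have htn' : (t : ℝ) ≤ n := by exact_mod_cast htn
  have hy : 2 ≤ (n : ℝ) / δ := (le_div_iff₀ hδ).2 hnδ
  have hl : Real.log 2 ≤ Real.log (n / δ) := Real.log_le_log two_pos hy
  have hm : 0 < max c.lam (c.sigma ^ 2 * c.lam1) := lt_max_of_lt_left hlam
  have hm1 : 0 < max (c.lam1 / c.lam) 1 := lt_max_of_lt_right one_pos
  have hs : 0 < √(c.lam * c.lamD * c.sigma ^ 2) := Real.sqrt_pos.2 (by positivity)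
  have hR : 0 < c.logRatio := by unfold Params.logRatio; positivity
  have hlog : Real.log ((max c.lam (c.sigma ^ 2 * c.lam1) + t * c.xMax ^ 2 / d)
      / (√(c.lam * c.lamD * c.sigma ^ 2) * δ))
      ≤ (1 + |Real.log c.logRatio| / Real.log 2) * Real.log (n / δ) := by
    refine le_trans (Real.log_le_log (by positivity) ?_) (log_mul_le hR hy)
    rw [Params.logRatio, div_mul_div_comm]
    gcongr
    have h1 : t * c.xMax ^ 2 / d ≤ n * c.xMax ^ 2 :=
      (div_le_self (by positivity) hd').trans (by gcongr)
    nlinarith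
  have hsq : √(Real.log 2) ≤ √(d * Real.log (n / δ)) := by
    refine Real.sqrt_le_sqrt ?_
    nlinarith
  have hs2 : 0 < √(Real.log 2) := Real.sqrt_pos.2 h2
  rw [alpha, Params.alphaConst, add_mul]
  refine add_le_add ?_ ?_
  · rw [div_mul_eq_mul_div, le_div_iff₀ hs2]
    exact mul_le_mul_of_nonneg_left hsq (by positivity)
  · rw [mul_assoc 2, ← Real.sqrt_mul (by positivity)]
    refine mul_le_mul_of_nonneg_left (Real.sqrt_le_sqrt ?_) two_pos.le
    calc _ ≤ c.sigma ^ 2 * d * max (c.lam1 / c.lam) 1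
          * ((1 + |Real.log c.logRatio| / Real.log 2) * Real.log (n / δ)) := by gcongr
      _ = _ := by ring

/-- From round `d √n` on the radius is at least `σ √(d log n)`, if `n` is large enough. -/
theorem le_alpha (hσ : 0 < c.sigma) (hlam : 0 < c.lam) (hlamD : 0 < c.lamD) (hb : 0 ≤ c.bMax)
    (hx : 0 < c.xMax) (hd : 1 ≤ d) {δ δmax : ℝ} (hδ : 0 < δ) (hδm : δ ≤ δmax) {t n : ℕ}
    (hn : 1 ≤ n) (ht : d * √n ≤ t)
    (hn₀ : (√(c.lam * c.lamD * c.sigma ^ 2) * δmax / c.xMax ^ 2) ^ 4 ≤ n) :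
    c.sigma * √(d * Real.log n) ≤ alpha c N d δ t := by
  have hd' : (1 : ℝ) ≤ d := by exact_mod_cast hd
  have hd0 : (0 : ℝ) < d := by linarith
  have hn' : (1 : ℝ) ≤ n := by exact_mod_cast hn
  have hlogn : 0 ≤ Real.log n := Real.log_nonneg hn'
  have hs : 0 < √(c.lam * c.lamD * c.sigma ^ 2) := Real.sqrt_pos.2 (by positivity)
  set s := √(c.lam * c.lamD * c.sigma ^ 2) with hs_def
  have hm : 0 < max c.lam (c.sigma ^ 2 * c.lam1) := lt_max_of_lt_left hlam
  have hδ' : 0 < δmax := hδ.trans_le hδm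
  set g := s * δmax / c.xMax ^ 2 with hg
  have hgp : 0 < g := by positivity
  set f := √(√(n : ℝ)) with hf
  have hsn : 0 < √(n : ℝ) := Real.sqrt_pos.2 (by linarith)
  have hfp : 0 < f := Real.sqrt_pos.2 hsn
  have hf2 : f * f = √n := Real.mul_self_sqrt hsn.le
  -- Here `f` is the fourth root of `n`, whence the exponent 4 in `hn₀`. The logarithm's argument is
  -- at least `√n / g = f² / g` when `δ = δmax`, and one factor `f` pays for `g`.
  have hgf : g ≤ f := by
    refine Real.le_sqrt_of_sq_le (Real.le_sqrt_of_sq_le ?_)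
    rw [← pow_mul]
    exact hn₀
  have harg : f ≤ (max c.lam (c.sigma ^ 2 * c.lam1) + t * c.xMax ^ 2 / d) / (s * δ) := by
    rw [le_div_iff₀ (by positivity)]
    have h1 : √(n : ℝ) * c.xMax ^ 2 ≤ t * c.xMax ^ 2 / d := by
      rw [le_div_iff₀ hd0]
      nlinarith [mul_le_mul_of_nonneg_right ht (sq_nonneg c.xMax)]
    have h2 : s * δ ≤ f * c.xMax ^ 2 := by
      have h3 : s * δmax = g * c.xMax ^ 2 := by rw [hg]; field_simp
      calc s * δ ≤ s * δmax := by gcongr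
        _ = g * c.xMax ^ 2 := h3
        _ ≤ _ := by gcongr
    calc f * (s * δ) ≤ f * (f * c.xMax ^ 2) := by gcongr
      _ = √(n : ℝ) * c.xMax ^ 2 := by rw [← mul_assoc, hf2]
      _ ≤ _ := by linarith
  have hlogf : Real.log n / 4 = Real.log f := by
    rw [hf, Real.log_sqrt hsn.le, Real.log_sqrt (by linarith)]
    ring
  have hlog : Real.log n / 4 ≤ Real.log ((max c.lam (c.sigma ^ 2 * c.lam1)
      + t * c.xMax ^ 2 / d) / (s * δ)) := by
    rw [hlogf]
    exact Real.log_le_log hfp harg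
  have hm1 : 1 ≤ max (c.lam1 / c.lam) 1 := le_max_right _ _
  have h0 : 0 ≤ c.sigma * N * c.bMax * √c.lam1 := by positivity
  -- The factor 2 in front of the root in `alpha` exactly compensates the quarter of `log n`.
  have key : c.sigma * √(d * Real.log n) = 2 * √(c.sigma ^ 2 * d * 1 * (Real.log n / 4)) := by
    rw [show c.sigma ^ 2 * d * 1 * (Real.log n / 4) = (c.sigma / 2) ^ 2 * (d * Real.log n) by ring,
      Real.sqrt_mul (sq_nonneg (c.sigma / 2)), Real.sqrt_sq (by positivity)]
    ring
  rw [key, alpha]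
  have h5 : √(c.sigma ^ 2 * d * 1 * (Real.log n / 4)) ≤ √(c.sigma ^ 2 * d * max (c.lam1 / c.lam) 1
      * Real.log ((max c.lam (c.sigma ^ 2 * c.lam1) + t * c.xMax ^ 2 / d) / (s * δ))) := by
    refine Real.sqrt_le_sqrt ?_
    gcongr
  linarith

/-- The constant `R` with `bias + noise ≤ R √(d log n)`. -/
noncomputable def Params.radiusConst (c : Params) (N : ℕ) : ℝ :=
  c.biasConst N / √(Real.log 2) + c.noiseConst N * √(c.sigma ^ 2 * (c.detConst + 2))

theorem radius_le (hσ : 0 < c.sigma) (hlam : 0 < c.lam) (hlamD : 0 < c.lamD) (hl1 : 0 ≤ c.lam1)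
    (hb : 0 ≤ c.bMax) (hx : 0 < c.xMax) (hd : 1 ≤ d) {n : ℕ} (hn : 2 ≤ n) :
    0 ≤ c.radiusConst N ∧ c.biasConst N + c.noiseConst N * √(noiseThreshold c d n)
      ≤ c.radiusConst N * √(d * Real.log n) := by
  have h2 : 0 < Real.log 2 := Real.log_pos one_lt_two
  have hs2 : 0 < √(Real.log 2) := Real.sqrt_pos.2 h2
  have hd' : (1 : ℝ) ≤ d := by exact_mod_cast hd
  have hf : 0 < c.floor := mul_pos (pow_pos hσ 2) hlamD
  have hbias : 0 ≤ c.biasConst N := by unfold Params.biasConst; positivity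
  have hnoise : 0 ≤ c.noiseConst N := by unfold Params.noiseConst; positivity
  have hD := c.one_le_detConst
  have hl : Real.log 2 ≤ Real.log n := Real.log_le_log two_pos (by exact_mod_cast hn)
  have hsq : √(Real.log 2) ≤ √(d * Real.log n) := by
    refine Real.sqrt_le_sqrt ?_
    nlinarith
  refine ⟨by unfold Params.radiusConst; positivity, ?_⟩
  rw [Params.radiusConst, add_mul]
  refine add_le_add ?_ ?_
  · rw [div_mul_eq_mul_div, le_div_iff₀ hs2]
    exact mul_le_mul_of_nonneg_left hsq hbias
  · rw [mul_assoc, ← Real.sqrt_mul (by positivity)]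
    exact mul_le_mul_of_nonneg_left (Real.sqrt_le_sqrt (noiseThreshold_le hf hl1 hx hn hd)) hnoise

/-- The factor of the main term of the regret rate. -/
noncomputable def Params.mainConst (c : Params) (N K : ℕ) : ℝ :=
  2 * samplingConst K (c.radiusConst N / c.sigma ^ 2) * c.alphaConst N *
    √(c.varFactor * ((1 + c.floor⁻¹ * c.xMax ^ 2) * (K * N * c.detConst) + 1))

/-- The value `√(n / P)` minimizes `a * P + n / a`. -/
theorem balance_le {n P Q : ℝ} (hn : 0 < n) (hP : 0 < P) (hQ : Q ≤ P) :
    √n / √P * Q + n * (√n / √P)⁻¹ ≤ 2 * (√n * √P) := by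
  have hsP : 0 < √P := Real.sqrt_pos.2 hP
  have hsn : 0 < √n := Real.sqrt_pos.2 hn
  have h1 : √n / √P * P = √n * √P := by
    rw [div_mul_eq_mul_div, div_eq_iff hsP.ne', mul_assoc, Real.mul_self_sqrt hP.le]
  have h2 : n * (√n / √P)⁻¹ = √n * √P := by
    rw [inv_div, mul_div_assoc', div_eq_iff hsn.ne', mul_right_comm, Real.mul_self_sqrt hn.le]
  have h3 := mul_le_mul_of_nonneg_left hQ (by positivity : 0 ≤ √n / √P)
  linarith

theorem sqrt_mul_sqrt_eq {n u d a b v w : ℝ} (hn : 0 ≤ n) (hu : 0 ≤ u) (hd : 0 ≤ d) (ha : 0 ≤ a)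
    (hv : 0 ≤ v) (hw : 0 ≤ w) :
    √n * √((u * √(d * a)) ^ 2 * v * (w * (d * b))) = u * √(v * w) * (d * √(n * a * b)) := by
  rw [mul_pow, Real.sq_sqrt (by positivity), ← Real.sqrt_mul hn,
    show n * (u ^ 2 * (d * a) * v * (w * (d * b))) = (u * d) ^ 2 * ((v * w) * (n * a * b)) by ring,
    Real.sqrt_mul (sq_nonneg _), Real.sqrt_sq (by positivity), Real.sqrt_mul (by positivity)]
  ring

theorem regret_le_rate (hc : Admissible c B.Sigma) (hB : B.Bounded c)
    {sel : (Fin K → ℝ) → Fin K} (hsel : IsArgmax sel) (hx : 0 < c.xMax) (hd : 1 ≤ d)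
    {δ δmax : ℝ} (hδ : 0 < δ) (hδm : δ ≤ δmax) {n : ℕ} (hn : 2 ≤ n) (hnδ : 2 * δ ≤ n)
    (hn₀ : (√(c.lam * c.lamD * c.sigma ^ 2) * δmax / c.xMax ^ 2) ^ 4 ≤ n) :
    regret B c δ sel n ≤ 2 * c.xMax * c.bMax * ((K + 2 + K * N) * (d * √n))
      + c.mainConst N K * (d * √(n * Real.log (n / δ) * Real.log n)) := by
  have hσ := hc.sigma_pos
  have hlam := hc.lam_pos
  have hlamD := hc.lamD_pos
  have hl1 := hc.lam1_nonneg
  have hf := hc.floor_pos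
  have hb := hB.bMax_nonneg (sel 0)
  have h2 : 0 < Real.log 2 := Real.log_pos one_lt_two
  have hd' : (1 : ℝ) ≤ d := by exact_mod_cast hd
  have hd0 : (0 : ℝ) < d := by linarith
  have hn' : (2 : ℝ) ≤ n := by exact_mod_cast hn
  have hn0 : (0 : ℝ) < n := by linarith
  have hy : 2 ≤ (n : ℝ) / δ := (le_div_iff₀ hδ).2 hnδ
  have hlδ : 0 < Real.log (n / δ) := h2.trans_le (Real.log_le_log two_pos hy)
  have hl : 0 < Real.log n := h2.trans_le (Real.log_le_log two_pos hn')
  have hsn : 1 ≤ √(n : ℝ) := Real.one_le_sqrt.2 (by linarith)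
  obtain ⟨hR0, hR⟩ := radius_le (N := N) hσ hlam hlamD hl1 hb hx hd hn
  set κ := c.radiusConst N / c.sigma ^ 2 with hκ_def
  have hκ : 0 ≤ κ := by positivity
  have hm1 : 0 < max (c.lam1 / c.lam) 1 := lt_max_of_lt_right one_pos
  have hU : 0 < c.alphaConst N := by
    unfold Params.alphaConst
    positivity
  set W := (1 + c.floor⁻¹ * c.xMax ^ 2) * (K * N * c.detConst) + 1 with hW
  have hdet := c.one_le_detConst
  have hWp : 0 < W := by positivity
  have hvF : 0 < c.varFactor := by
    unfold Params.varFactor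
    positivity
  have hC : 0 ≤ samplingConst K κ := by
    have := gaussianTail_pos κ
    unfold samplingConst
    positivity
  set Λ := c.alphaConst N * √(d * Real.log (n / δ)) with hΛ
  have hΛp : 0 < Λ := mul_pos hU (Real.sqrt_pos.2 (by positivity))
  set P := Λ ^ 2 * c.varFactor * (W * (d * Real.log n)) with hP
  have hPp : 0 < P := by positivity
  -- The `K` forced pulls are followed by the rounds in which the radius may be too small. The
  -- factor `d` offsets the division by `d` inside the logarithm of `alpha`.
  set t₀ := K + ⌈d * √(n : ℝ)⌉₊ with ht₀
  have hsP : 0 < √P := Real.sqrt_pos.2 hPp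
  have hsn0 : 0 < √(n : ℝ) := by linarith
  have hmain := regret_le_of_radius (δ := δ) sel hc hB hsel (n := n) (t₀ := t₀) (κ := κ) (Λ := Λ)
    (a := √n / √P) (Nat.le_add_right _ _) (by omega) hx hb hκ (by positivity) (by
      intro t ht htn
      have ht' : d * √(n : ℝ) ≤ ((t + 1 : ℕ) : ℝ) := by
        have h3 : (⌈d * √(n : ℝ)⌉₊ : ℝ) ≤ t := by exact_mod_cast (Nat.le_add_left _ _).trans ht
        push_cast
        linarith [Nat.le_ceil (d * √(n : ℝ))]
      refine ⟨alpha_nonneg hσ.le hb δ _, alpha_le hσ hlam hlamD hb hx hd hδ htn (by omega) hnδ,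
        hR.trans ?_⟩
      have h4 := le_alpha (N := N) hσ hlam hlamD hb hx hd hδ hδm (by omega) ht' hn₀
      calc c.radiusConst N * √(d * Real.log n)
          = κ * (c.sigma * (c.sigma * √(d * Real.log n))) := by
            rw [hκ_def]; field_simp
        _ ≤ _ := by gcongr)
  refine hmain.trans (add_le_add ?_ ?_)
  · refine mul_le_mul_of_nonneg_left ?_ (by positivity)
    have h5 : (⌈d * √(n : ℝ)⌉₊ : ℝ) ≤ d * √(n : ℝ) + 1 := (Nat.ceil_lt_add_one (by positivity)).le
    have h6 : 1 ≤ d * √(n : ℝ) := one_le_mul_of_one_le_of_one_le hd' hsn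
    have h7 : (t₀ : ℝ) = K + (⌈d * √(n : ℝ)⌉₊ : ℝ) := by rw [ht₀]; push_cast; ring
    have h8 : (0 : ℝ) ≤ K + 1 + K * N := by positivity
    rw [h7]
    nlinarith [mul_le_mul_of_nonneg_left h6 h8]
  · have h9 := max_widthBound_le (d := d) (N := N) (K := K) hf hl1 hx hn
    have h11 : Λ ^ 2 * c.varFactor * max (widthBound c d N K n) 0 ≤ P :=
      mul_le_mul_of_nonneg_left h9 (by positivity)
    have h10 := balance_le hn0 hPp h11
    have h15 : √(n : ℝ) * √P = c.alphaConst N * √(c.varFactor * W)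
        * (d * √(n * Real.log (n / δ) * Real.log n)) :=
      sqrt_mul_sqrt_eq hn0.le hU.le hd0.le hlδ.le hvF.le hWp.le
    calc _ ≤ samplingConst K κ * (2 * (√n * √P)) := mul_le_mul_of_nonneg_left h10 hC
      _ = _ := by rw [h15, Params.mainConst]; ring

end Rate

end EbmTS
namespace EbmTS

open MeasureTheory ProbabilityTheory Matrix
open scoped MatrixOrder NNReal ENNReal

/-! ### The two assertions of the theorem. -/

section Main

variable {d N K : ℕ} {B : MultiBandit d N K} {c : Params}

/-- The last summand alone dominates the linear bound; of the first summand only nonnegativity is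
used. -/
theorem regret_le_explicit (hc : Admissible c B.Sigma) (hB : B.Bounded c)
    {sel : (Fin K → ℝ) → Fin K} (hsel : IsArgmax sel) {δ : ℝ} (hδ : 0 < δ) (n : ℕ) :
    regret B c δ sel n ≤
      2 * constC * (√(2 * Real.log (d * n ^ 2)) + 1) * alpha c N d δ n
        * √(c1 c * n * d * K * ∑ j, Real.log (1 + c2 c d * (B.prob j * n))
            + c3 c * n * d * K * Real.log (1 + c4 c * N))
      + 2 * c.xMax * c.bMax * K * N * n * (δ + Real.pi ^ 2 / 6) := by
  have hx := hB.xMax_nonneg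
  have hb := hB.bMax_nonneg (sel 0)
  have hα := alpha_nonneg (N := N) (d := d) hc.sigma_pos.le hb δ n
  have hC := constC_nonneg
  have hN : (1 : ℝ) ≤ N := by exact_mod_cast hB.pos_N
  have hK : (1 : ℝ) ≤ K := by exact_mod_cast (sel 0).pos
  have h1 := regret_le_linear δ sel hc hB hsel.measurable n
  refine h1.trans (le_add_of_nonneg_of_le (by positivity) ?_)
  have hpi : 1 ≤ δ + Real.pi ^ 2 / 6 := by nlinarith [Real.pi_gt_three]
  have h2 : (1 : ℝ) ≤ K * N * (δ + Real.pi ^ 2 / 6) :=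
    one_le_mul_of_one_le_of_one_le (one_le_mul_of_one_le_of_one_le hK hN) hpi
  have h3 : 0 ≤ 2 * c.xMax * c.bMax * n := by positivity
  calc _ = 2 * c.xMax * c.bMax * n * 1 := (mul_one _).symm
    _ ≤ 2 * c.xMax * c.bMax * n * (K * N * (δ + Real.pi ^ 2 / 6)) :=
        mul_le_mul_of_nonneg_left h2 h3
    _ = _ := by ring

/-- The threshold for the horizon above which the radius is eventually valid. -/
noncomputable def Params.horizon (c : Params) (δmax : ℝ) : ℝ :=
  (√(c.lam * c.lamD * c.sigma ^ 2) * δmax / c.xMax ^ 2) ^ 4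

/-- The constant of the regret rate. -/
noncomputable def Params.rateConst (c : Params) (N K : ℕ) (δmax : ℝ) : ℝ :=
  2 * c.xMax * c.bMax * (K + 2 + K * N + √(c.horizon δmax)) / √(Real.log 2 ^ 3)
    + c.mainConst N K / √(Real.log 2)

theorem regret_le_rateConst (hc : Admissible c B.Sigma) (hB : B.Bounded c)
    {sel : (Fin K → ℝ) → Fin K} (hsel : IsArgmax sel) (hd : 1 ≤ d)
    {δ δmax : ℝ} (hδ : 0 < δ) (hδm : δ ≤ δmax) {n : ℕ} (hn : 2 ≤ n) (hnδ : 2 * δ ≤ n)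
    (hp : ∀ j, 1 ≤ B.prob j * n) :
    regret B c δ sel n ≤ c.rateConst N K δmax *
      (d * √(n * Real.log (n / δ) * Real.log n
        * (∑ j, Real.log (B.prob j * n) + Real.log N))) := by
  have h2 : 0 < Real.log 2 := Real.log_pos one_lt_two
  have hb := hB.bMax_nonneg (sel 0)
  have hx0 := hB.xMax_nonneg
  have hσ := hc.sigma_pos
  have hf := hc.floor_pos
  have hlam := hc.lam_pos
  have hl1 := hc.lam1_nonneg
  have hd' : (1 : ℝ) ≤ d := by exact_mod_cast hd
  have hn' : (2 : ℝ) ≤ n := by exact_mod_cast hn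
  have hn0 : (0 : ℝ) < n := by linarith
  set S := ∑ j, Real.log (B.prob j * n) + Real.log N with hS_def
  have hS : Real.log 2 ≤ S := log_two_le_sum_log hB hn hp
  have hlδ : Real.log 2 ≤ Real.log (n / δ) := Real.log_le_log two_pos ((le_div_iff₀ hδ).2 hnδ)
  have hl : Real.log 2 ≤ Real.log n := Real.log_le_log two_pos hn'
  have hS0 := h2.trans_le hS
  have hlδ0 := h2.trans_le hlδ
  have hl0 := h2.trans_le hl
  set T := d * √(n * Real.log (n / δ) * Real.log n * S) with hT
  -- Each of the three logarithmic factors of `T` is at least `log 2`.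
  have hT1 : d * √(n : ℝ) ≤ T / √(Real.log 2 ^ 3) := by
    rw [le_div_iff₀ (Real.sqrt_pos.2 (by positivity)), mul_assoc, ← Real.sqrt_mul hn0.le, hT]
    refine mul_le_mul_of_nonneg_left (Real.sqrt_le_sqrt ?_) (by positivity)
    calc (n : ℝ) * Real.log 2 ^ 3 = n * Real.log 2 * Real.log 2 * Real.log 2 := by ring
      _ ≤ _ := by gcongr
  have hT2 : d * √(n * Real.log (n / δ) * Real.log n) ≤ T / √(Real.log 2) := by
    rw [le_div_iff₀ (Real.sqrt_pos.2 h2), mul_assoc, ← Real.sqrt_mul (by positivity), hT]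
    refine mul_le_mul_of_nonneg_left (Real.sqrt_le_sqrt ?_) (by positivity)
    gcongr
  have hT0 : 0 ≤ T := by positivity
  have hdetc := c.one_le_detConst
  have hR : 0 ≤ c.radiusConst N := by
    unfold Params.radiusConst Params.biasConst Params.noiseConst
    positivity
  have hmain : 0 ≤ c.mainConst N K := by
    have h3 : 0 ≤ c.radiusConst N / c.sigma ^ 2 := by positivity
    have h4 : 0 ≤ samplingConst K (c.radiusConst N / c.sigma ^ 2) := by
      have := gaussianTail_pos (c.radiusConst N / c.sigma ^ 2)
      unfold samplingConst
      positivity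
    have h5 : 0 ≤ c.alphaConst N := by
      unfold Params.alphaConst
      positivity
    unfold Params.mainConst
    positivity
  have hq : (0 : ℝ) ≤ K + 2 + K * N := by positivity
  have hxb : 0 ≤ 2 * c.xMax * c.bMax := by positivity
  have hexp : c.rateConst N K δmax * T
      = 2 * c.xMax * c.bMax * ((K + 2 + K * N + √(c.horizon δmax)) * (T / √(Real.log 2 ^ 3)))
        + c.mainConst N K * (T / √(Real.log 2)) := by
    rw [Params.rateConst]
    ring
  rw [hexp]
  have hTa : 0 ≤ T / √(Real.log 2 ^ 3) := by positivity
  have hTb : 0 ≤ T / √(Real.log 2) := by positivity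
  by_cases hlarge : 0 < c.xMax ∧ c.horizon δmax ≤ n
  · refine (regret_le_rate hc hB hsel hlarge.1 hd hδ hδm hn hnδ hlarge.2).trans ?_
    refine add_le_add (mul_le_mul_of_nonneg_left ?_ hxb) (mul_le_mul_of_nonneg_left hT2 hmain)
    refine mul_le_mul ?_ hT1 (by positivity) (by positivity)
    linarith [Real.sqrt_nonneg (c.horizon δmax)]
  -- Without large `n` and positive `xMax` the linear bound suffices: it vanishes for `xMax = 0`,
  -- and otherwise `n` is at most `√horizon * √n`, which is why `rateConst` contains `√horizon`.
  · refine (regret_le_linear δ sel hc hB hsel.measurable n).trans ?_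
    refine le_add_of_le_of_nonneg ?_ (by positivity)
    rcases hx0.eq_or_lt with h0 | h0
    · rw [← h0]; simp
    · have h6 : (n : ℝ) ≤ c.horizon δmax := by
        by_contra h
        exact hlarge ⟨h0, (not_le.1 h).le⟩
      refine mul_le_mul_of_nonneg_left ?_ hxb
      have h7 : √(n : ℝ) ≤ √(c.horizon δmax) := Real.sqrt_le_sqrt h6
      calc (n : ℝ) = √n * √n := (Real.mul_self_sqrt hn0.le).symm
        _ ≤ √(c.horizon δmax) * (d * √n) :=
            mul_le_mul h7 (le_mul_of_one_le_left (Real.sqrt_nonneg _) hd')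
              (Real.sqrt_nonneg _) (Real.sqrt_nonneg _)
        _ ≤ _ := mul_le_mul (by linarith) hT1 (by positivity) (by positivity)

end Main

end EbmTS

theorem mainTheorem3 (N K : ℕ) (c : EbmTS.Params)
    (hsigma : 0 < c.sigma) (hlam : 0 < c.lam) (hlamD : 0 < c.lamD) :
    (∀ (d : ℕ), 1 ≤ d → ∀ (B : EbmTS.MultiBandit d N K), B.Bounded c →
      ∀ (sel : (Fin K → ℝ) → Fin K), EbmTS.IsArgmax sel → ∀ (δ : ℝ), 0 < δ →
        (∀ t : ℕ, MeasureTheory.Integrable (EbmTS.gap B c δ sel t) (EbmTS.law B c)) ∧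
        ∀ n : ℕ, 1 ≤ n →
          EbmTS.regret B c δ sel n ≤
            2 * EbmTS.constC * (√(2 * Real.log (d * n ^ 2)) + 1) * EbmTS.alpha c N d δ n
              * √(EbmTS.c1 c * n * d * K * ∑ j, Real.log (1 + EbmTS.c2 c d * (B.prob j * n))
                  + EbmTS.c3 c * n * d * K * Real.log (1 + EbmTS.c4 c * N))
            + 2 * c.xMax * c.bMax * K * N * n * (δ + Real.pi ^ 2 / 6)) ∧
    (∀ (δmax : ℝ), 0 < δmax → ∃ M : ℝ,
      ∀ (d : ℕ), 1 ≤ d → ∀ (B : EbmTS.MultiBandit d N K), B.Bounded c →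
        ∀ (sel : (Fin K → ℝ) → Fin K), EbmTS.IsArgmax sel →
          ∀ (δ : ℝ), 0 < δ → δ ≤ δmax →
            ∀ n : ℕ, 2 ≤ n → 2 * δ ≤ n → (∀ j, 1 ≤ B.prob j * n) →
              EbmTS.regret B c δ sel n ≤
                M * (d * √(n * Real.log (n / δ) * Real.log n
                  * (∑ j, Real.log (B.prob j * n) + Real.log N)))) := by
  have hadm : ∀ (d : ℕ), 1 ≤ d → ∀ (B : EbmTS.MultiBandit d N K), B.Bounded c →
      ∀ sel : (Fin K → ℝ) → Fin K, EbmTS.Admissible c B.Sigma := fun d hd B hB sel =>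
    hB.admissible hsigma hlam hlamD hd (sel 0)
  refine ⟨fun d hd B hB sel hsel δ hδ => ⟨fun t => ?_, fun n _ => ?_⟩,
    fun δmax _ => ⟨c.rateConst N K δmax, fun d hd B hB sel hsel δ hδ hδm n hn hnδ hp => ?_⟩⟩
  · exact EbmTS.integrable_gap δ sel (hadm d hd B hB sel) hB hsel.measurable t
  · exact EbmTS.regret_le_explicit (hadm d hd B hB sel) hB hsel hδ n
  · exact EbmTS.regret_le_rateConst (hadm d hd B hB sel) hB hsel hd hδ hδm hn hnδ hp
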